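/- Let $M,N\ge 0$. The super Yangian $Y(\mathfrak{gl}_{M|N})$ is the associative $\mathbb{Z}_2$-graded $\mathbb{C}$-algebra with generators $t_{ij}^{(r)}$ ($1\le i,j\le M+N$, $r\ge 0$), where $t_{ij}^{(0)}=\delta_{ij}$, and defining relations $$[t_{ij}^{(r)},t_{hk}^{(s)}]=(-1)^{|i||j|+|i||h|+|j||h|}\sum_{t=0}^{\min(r,s)-1}\big(t_{hj}^{(t)}t_{ik}^{(r+s-1-t)}-t_{hj}^{(r+s-1-t)}t_{ik}^{(t)}\big),$$ where $|i|=0$ for $i\le M$, $|i|=1$ for $i>M$, the generator $t_{ij}^{(r)}$ has parity $|i|+|j|$, and $[\cdot,\cdot]$ always denotes the supercommutator. Let $\lambda=(\mu_1,\dots,\mu_m)$ be a composition of $M$ and $\nu=(\mu_{m+1},\dots,\mu_{m+n})$ a composition of $N$. Let $T(u)=\big(\sum_{r\ge0}t_{ij}^{(r)}u^{-r}\big)_{i,j}$, divided into blocks according to $\mu=(\lambda|\nu)$, and let $T(u)=F(u)D(u)E(u)$ be its unique block Gauss decomposition: $D(u)$ is block diagonal with diagonal blocks $D_a(u)$, $E(u)$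 is block upper unitriangular with blocks $E_{a,b}(u)$ ($a<b$), and $F(u)$ is block lower unitriangular with blocks $F_{b,a}(u)$ ($a<b$). Put $D'_a(u)=D_a(u)^{-1}$, $E_a(u)=E_{a,a+1}(u)$, $F_a(u)=F_{a+1,a}(u)$, and denote by $D_{a;i,j}^{(r)},D_{a;i,j}^{\prime(r)},E_{a;i,j}^{(r)},F_{a;i,j}^{(r)}$ the coefficients of $u^{-r}$ in the $(i,j)$ entries. Let $\bar a=0$ for $1\le a\le m$ and $\bar a=1$ for $m+1\le a\le m+n$. Then the following relations hold in $Y(\mathfrak{gl}_{M|N})$ for all admissible block indices and entry indices and all admissible superscripts ($r\ge0$ for $D$ and $D'$; $r\ge 1$ for $E$ and $F$). The index $p$ is summed over $1,\dots,\mu_a$ and $q$ over $1,\dots,\mu_{a+1}$. 1. $D_{a;i,j}^{(0)}=\delta_{ij}$. 2. $\sum_{t=0}^{r}\sum_p D_{a;i,p}^{(t)}D_{a;p,j}^{\prime(r-t)}=\delta_{r0}\delta_{ij}$. 3. $[D_{a;i,j}^{(r)},D_{b;h,k}^{(s)}]=\delta_{ab}(-1)^{\bar a}\sum_{t=0}^{\min(r,s)-1}\big(D_{a;h,j}^{(t)}D_{a;i,k}^{(r+s-1-t)}-D_{a;h,j}^{(r+s-1-t)}D_{a;i,k}^{(t)}\big)$.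 4. $[D_{a;i,j}^{(r)},E_{b;h,k}^{(s)}]$ equals $(-1)^{\bar b}\big(\delta_{ab}\delta_{hj}\sum_{t=0}^{r-1}\sum_pD_{a;i,p}^{(t)}E_{a;p,k}^{(r+s-1-t)}-\delta_{a,b+1}\sum_{t=0}^{r-1}D_{a;i,k}^{(t)}E_{b;h,j}^{(r+s-1-t)}\big)$ if $b\ne m$, and $\delta_{ab}\delta_{hj}\sum_{t=0}^{r-1}\sum_pD_{a;i,p}^{(t)}E_{a;p,k}^{(r+s-1-t)}+\delta_{a,b+1}\sum_{t=0}^{r-1}D_{a;i,k}^{(t)}E_{b;h,j}^{(r+s-1-t)}$ if $b=m$. 5. $[D_{a;i,j}^{(r)},F_{b;h,k}^{(s)}]$ equals $(-1)^{\bar b}\big(-\delta_{ab}\delta_{ki}\sum_{t=0}^{r-1}\sum_pF_{b;h,p}^{(r+s-1-t)}D_{a;p,j}^{(t)}+\delta_{a,b+1}\sum_{t=0}^{r-1}F_{b;i,k}^{(r+s-1-t)}D_{a;h,j}^{(t)}\big)$ if $b\ne m$, and $-\delta_{ab}\delta_{ki}\sum_{t=0}^{r-1}\sum_pF_{b;h,p}^{(r+s-1-t)}D_{a;p,j}^{(t)}-\delta_{a,b+1}\sum_{t=0}^{r-1}F_{b;i,k}^{(r+s-1-t)}D_{a;h,j}^{(t)}$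 if $b=m$. 6. $[E_{a;i,j}^{(r)},E_{a;h,k}^{(s)}]$ equals $(-1)^{\bar a}\big(\sum_{t=1}^{s-1}E_{a;i,k}^{(t)}E_{a;h,j}^{(r+s-1-t)}-\sum_{t=1}^{r-1}E_{a;i,k}^{(t)}E_{a;h,j}^{(r+s-1-t)}\big)$ if $a\ne m$, and $\sum_{t=1}^{r-1}E_{a;i,k}^{(t)}E_{a;h,j}^{(r+s-1-t)}-\sum_{t=1}^{s-1}E_{a;i,k}^{(t)}E_{a;h,j}^{(r+s-1-t)}$ if $a=m$. 7. $[F_{a;i,j}^{(r)},F_{a;h,k}^{(s)}]$ equals $(-1)^{\bar a}\big(\sum_{t=1}^{r-1}F_{a;i,k}^{(r+s-1-t)}F_{a;h,j}^{(t)}-\sum_{t=1}^{s-1}F_{a;i,k}^{(r+s-1-t)}F_{a;h,j}^{(t)}\big)$ if $a\neq m$, and $\sum_{t=1}^{r-1}F_{a;i,k}^{(r+s-1-t)}F_{a;h,j}^{(t)}-\sum_{t=1}^{s-1}F_{a;i,k}^{(r+s-1-t)}F_{a;h,j}^{(t)}$ if $a=m$. 8. $[E_{a;i,j}^{(r)},F_{b;h,k}^{(s)}]=-(-1)^{\overline{b+1}}\delta_{ab}\sum_{t=0}^{r+s-1}D_{a+1;h,j}^{(r+s-1-t)}D_{a;i,k}^{\prime(t)}$.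 9. $[E_{a;i,j}^{(r+1)},E_{a+1;h,k}^{(s)}]-[E_{a;i,j}^{(r)},E_{a+1;h,k}^{(s+1)}]=(-1)^{\overline{a+1}}\delta_{hj}\sum_qE_{a;i,q}^{(r)}E_{a+1;q,k}^{(s)}$. 10. $[F_{a;i,j}^{(r+1)},F_{a+1;h,k}^{(s)}]-[F_{a;i,j}^{(r)},F_{a+1;h,k}^{(s+1)}]=-(-1)^{\overline{a+1}}\delta_{ik}\sum_qF_{a+1;h,q}^{(s)}F_{a;q,j}^{(r)}$. 11. $[E_{a;i,j}^{(r)},E_{b;h,k}^{(s)}]=0$ if $b>a+1$, or if $b=a+1$ and $h\ne j$. 12. $[F_{a;i,j}^{(r)},F_{b;h,k}^{(s)}]=0$ if $b>a+1$, or if $b=a+1$ and $i\ne k$. 13. $\big[E_{a;i,j}^{(r)},[E_{a;h,k}^{(s)},E_{b;f,g}^{(l)}]\big]+\big[E_{a;i,j}^{(s)},[E_{a;h,k}^{(r)},E_{b;f,g}^{(l)}]\big]=0$ if $|a-b|\ge1$. 14. $\big[F_{a;i,j}^{(r)},[F_{a;h,k}^{(s)},F_{b;f,g}^{(l)}]\big]+\big[F_{a;i,j}^{(s)},[F_{a;h,k}^{(r)},F_{b;f,g}^{(l)}]\big]=0$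 if $|a-b|\ge1$. 15. $\big[[E_{m-1;i,j}^{(r)},E_{m;h,k}^{(1)}],[E_{m;h_0,k_0}^{(1)},E_{m+1;f,g}^{(s)}]\big]=0$ if $m>1$ and $n>1$. 16. $\big[[F_{m-1;i,j}^{(r)},F_{m;h,k}^{(1)}],[F_{m;h_0,k_0}^{(1)},F_{m+1;f,g}^{(s)}]\big]=0$ if $m>1$ and $n>1$. -/

import Mathlib

/-! ### The super Yangian of `gl_{M|N}` -/

/-- The parity (`0` or `1`) of the index `i` (counted from `0`): even for the first `M` indices. -/
def idxParity (M : ℕ) {n : ℕ} (i : Fin n) : ℕ := if (i : ℕ) < M then 0 else 1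

/-- The free associative algebra on symbols `t i j r`. -/
abbrev FreeT (M N : ℕ) : Type := FreeAlgebra ℂ (Fin (M + N) × Fin (M + N) × ℕ)

/-- The free generator `t i j r`. -/
def freeT (M N : ℕ) (i j : Fin (M + N)) (r : ℕ) : FreeT M N := FreeAlgebra.ι ℂ (i, j, r)

/-- The defining relations of the super Yangian; the left-hand side of `comm` is the supercommutator
of two generators, `t i j r` having parity `|i| + |j|`. -/
inductive YangianRel (M N : ℕ) : FreeT M N → FreeT M N → Prop
  | zero (i j : Fin (M + N)) : YangianRel M N (freeT M N i j 0) (if i = j then 1 else 0)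
  | comm (i j h k : Fin (M + N)) (r s : ℕ) :
      YangianRel M N
        (freeT M N i j r * freeT M N h k s
          - (-1) ^ ((idxParity M i + idxParity M j) * (idxParity M h + idxParity M k))
            * (freeT M N h k s * freeT M N i j r))
        ((-1) ^ (idxParity M i * idxParity M j + idxParity M i * idxParity M h
            + idxParity M j * idxParity M h)
          * ∑ t ∈ Finset.range (min r s),
            (freeT M N h j t * freeT M N i k (r + s - 1 - t)
              - freeT M N h j (r + s - 1 - t) * freeT M N i k t))

/-- The super Yangian `Y(gl_{M|N})`. -/
def SuperYangian (M N : ℕ) : Type := RingQuot (YangianRel M N)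

namespace SuperYangian

noncomputable instance (M N : ℕ) : Ring (SuperYangian M N) :=
  inferInstanceAs (Ring (RingQuot (YangianRel M N)))

noncomputable instance (M N : ℕ) : Algebra ℂ (SuperYangian M N) :=
  inferInstanceAs (Algebra ℂ (RingQuot (YangianRel M N)))

variable {M N : ℕ}

/-- The quotient map from the free algebra. -/
noncomputable def mk (M N : ℕ) : FreeT M N →ₐ[ℂ] SuperYangian M N :=
  RingQuot.mkAlgHom ℂ (YangianRel M N)

/-- The generator `t_{ij}^{(r)}` of `Y(gl_{M|N})`. -/
noncomputable def t (i j : Fin (M + N)) (r : ℕ) : SuperYangian M N := mk M N (freeT M N i j r)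

theorem t_zero (i j : Fin (M + N)) : (t i j 0 : SuperYangian M N) = if i = j then 1 else 0 := by
  have := RingQuot.mkAlgHom_rel ℂ (YangianRel.zero (M := M) (N := N) i j)
  refine this.trans ?_
  split_ifs
  · exact map_one (mk M N)
  · exact map_zero (mk M N)

theorem t_comm (i j h k : Fin (M + N)) (r s : ℕ) :
    (t i j r * t h k s
      - (-1) ^ ((idxParity M i + idxParity M j) * (idxParity M h + idxParity M k))
        * (t h k s * t i j r) : SuperYangian M N)
    = (-1) ^ (idxParity M i * idxParity M j + idxParity M i * idxParity M h
          + idxParity M j * idxParity M h)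
        * ∑ l ∈ Finset.range (min r s),
          (t h j l * t i k (r + s - 1 - l) - t h j (r + s - 1 - l) * t i k l) := by
  have := RingQuot.mkAlgHom_rel ℂ (YangianRel.comm (M := M) (N := N) i j h k r s)
  change mk M N _ = mk M N _ at this
  simp only [map_sub, map_mul, map_sum, map_pow, map_neg, map_one] at this
  exact this

/-- The parity automorphism: it multiplies `t_{ij}^{(r)}` by `(-1)^{|i|+|j|}`. Its eigenspaces for
`1` and `-1` are the even and the odd part of the superalgebra `Y(gl_{M|N})`. -/
noncomputable def parityAut (M N : ℕ) : SuperYangian M N →ₐ[ℂ] SuperYangian M N :=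
  RingQuot.liftAlgHom ℂ ⟨FreeAlgebra.lift ℂ fun x : Fin (M + N) × Fin (M + N) × ℕ =>
      (-1) ^ (idxParity M x.1 + idxParity M x.2.1) * t x.1 x.2.1 x.2.2, by
    have key : ∀ (i j h k : Fin (M + N)) (r s : ℕ),
        ((-1) ^ (idxParity M i + idxParity M j) * t i j r
          * ((-1) ^ (idxParity M h + idxParity M k) * t h k s) : SuperYangian M N)
        = (-1) ^ (idxParity M i + idxParity M j + (idxParity M h + idxParity M k))
          * (t i j r * t h k s) := by
      intro i j h k r s
      rcases neg_one_pow_eq_or (SuperYangian M N) (idxParity M i + idxParity M j) with e | e <;>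
      rcases neg_one_pow_eq_or (SuperYangian M N) (idxParity M h + idxParity M k) with e' | e' <;>
      simp [pow_add (-1 : SuperYangian M N) (idxParity M i + idxParity M j), e, e']
    intro x y hxy
    cases hxy with
    | zero i j =>
      by_cases hij : i = j
      · subst hij
        simp [freeT, t_zero, ← two_mul]
      · simp [freeT, t_zero, hij]
    | comm i j h k r s =>
      simp only [freeT, map_sub, map_mul, map_sum, map_pow, map_neg, map_one,
        FreeAlgebra.lift_ι_apply, key]
      have e1 : idxParity M h + idxParity M k + (idxParity M i + idxParity M j)
          = idxParity M i + idxParity M j + (idxParity M h + idxParity M k) := by ring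
      have e2 : idxParity M h + idxParity M j + (idxParity M i + idxParity M k)
          = idxParity M i + idxParity M j + (idxParity M h + idxParity M k) := by ring
      rw [e1, e2]
      simp only [← mul_sub, ← Finset.mul_sum]
      have hc := t_comm (M := M) (N := N) i j h k r s
      rcases neg_one_pow_eq_or (SuperYangian M N)
        (idxParity M i + idxParity M j + (idxParity M h + idxParity M k)) with e | e
      · rw [e]
        simpa using hc
      · rw [e]
        simp only [neg_mul, one_mul, mul_neg, sub_neg_eq_add] at hc ⊢
        rw [← hc]
        abel⟩

theorem parityAut_t (i j : Fin (M + N)) (r : ℕ) :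
    parityAut M N (t i j r) = (-1) ^ (idxParity M i + idxParity M j) * t i j r := by
  unfold parityAut t mk
  erw [RingQuot.liftAlgHom_mkAlgHom_apply]
  simp [freeT]

/-- The component of `x` of parity `p` (even for `p = 0`, odd for `p = 1`). -/
noncomputable def part (p : ℕ) (x : SuperYangian M N) : SuperYangian M N :=
  (1 / 2 : ℂ) • (x + (-1) ^ p * parityAut M N x)

/-- The supercommutator of the superalgebra `Y(gl_{M|N})`: the bilinear extension of
`[x, y] = x y - (-1)^{p q} y x` for `x` of parity `p` and `y` of parity `q`. -/
noncomputable def sbr (x y : SuperYangian M N) : SuperYangian M N :=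
  ∑ p ∈ Finset.range 2, ∑ q ∈ Finset.range 2,
    (part p x * part q y - (-1) ^ (p * q) * (part q y * part p x))

theorem sbr_eq {x y : SuperYangian M N} {p q : ℕ} (hp : p < 2) (hq : q < 2)
    (hx : parityAut M N x = (-1) ^ p * x) (hy : parityAut M N y = (-1) ^ q * y) :
    sbr x y = x * y - (-1) ^ (p * q) * (y * x) := by
  have h2 : ∀ z : SuperYangian M N, (2⁻¹ : ℂ) • z + (2⁻¹ : ℂ) • z = z := fun z => by
    rw [← add_smul]; norm_num
  interval_cases p <;> interval_cases q <;>
    simp [sbr, part, Finset.sum_range_succ, hx, hy, h2]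

end SuperYangian

/-! ### Block Gauss decomposition of a power series of matrices -/

namespace BlockGauss

open PowerSeries

variable {ι R : Type} [Fintype ι] [DecidableEq ι] [Ring R]

/-- `T = F D E` with `D` block diagonal, `E` block upper and `F` block lower unitriangular (identity
matrices as diagonal blocks); the block of the index `i` is `β i`, and a series of matrices is
regarded as a matrix of series through its coefficients. -/
structure IsGauss (β : ι → ℕ) (T F D E : PowerSeries (Matrix ι ι R)) : Prop where
  eq_mul : T = F * D * E
  diag : ∀ r i j, β i ≠ β j → coeff r D i j = 0
  upper : ∀ r i j, β j < β i → coeff r E i j = 0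
  upper_one : ∀ r i j, β i = β j → coeff r E i j = coeff r (1 : PowerSeries (Matrix ι ι R)) i j
  lower : ∀ r i j, β i < β j → coeff r F i j = 0
  lower_one : ∀ r i j, β i = β j → coeff r F i j = coeff r (1 : PowerSeries (Matrix ι ι R)) i j

theorem coeff_mul_diff {S : Type} [Ring S] (r : ℕ) (A B A' B' : PowerSeries S)
    (hA : ∀ s < r, coeff s A = coeff s A') (hB : ∀ s < r, coeff s B = coeff s B')
    (hA0 : coeff 0 A' = 1) (hB0 : coeff 0 B = 1) :
    coeff r (A * B) - coeff r (A' * B')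
      = (coeff r A - coeff r A') + (coeff r B - coeff r B') := by
  have e : A * B - A' * B' = (A - A') * B + A' * (B - B') := by noncomm_ring
  rw [← map_sub, e, map_add, coeff_mul, coeff_mul]
  congr 1
  · rw [Finset.sum_eq_single (r, 0)]
    · simp [hB0]
    · rintro ⟨a, b⟩ hab hne
      have hab' := Finset.HasAntidiagonal.mem_antidiagonal.1 hab
      have : a < r := by
        rcases Nat.eq_zero_or_pos b with hb | hb
        · exact absurd (by simp_all) hne
        · simp at hab'; omega
      simp [hA a this]
    · intro h; exact absurd (by simp) h
  · rw [Finset.sum_eq_single (0, r)]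
    · simp [hA0]
    · rintro ⟨a, b⟩ hab hne
      have hab' := Finset.HasAntidiagonal.mem_antidiagonal.1 hab
      have : b < r := by
        rcases Nat.eq_zero_or_pos a with hb | hb
        · exact absurd (by simp_all) hne
        · simp at hab'; omega
      simp [hB b this]
    · intro h; exact absurd (by simp) h

theorem coeff_mul_mul_diff {S : Type} [Ring S] (r : ℕ) (A B C A' B' C' : PowerSeries S)
    (hA : ∀ s < r, coeff s A = coeff s A') (hB : ∀ s < r, coeff s B = coeff s B')
    (hC : ∀ s < r, coeff s C = coeff s C')
    (hA0 : coeff 0 A' = 1) (hB0' : coeff 0 B' = 1) (hB0 : coeff 0 B = 1) (hC0 : coeff 0 C = 1) :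
    coeff r (A * B * C) - coeff r (A' * B' * C')
      = (coeff r A - coeff r A') + (coeff r B - coeff r B') + (coeff r C - coeff r C') := by
  rw [coeff_mul_diff r (A * B) C (A' * B') C' _ hC _ hC0, coeff_mul_diff r A B A' B' hA hB hA0 hB0]
  · intro s hs
    rw [coeff_mul, coeff_mul]
    refine Finset.sum_congr rfl fun x hx => ?_
    have := Finset.HasAntidiagonal.mem_antidiagonal.1 hx
    rw [hA x.1 (by omega), hB x.2 (by omega)]
  · simp [coeff_mul, hA0, hB0']

/-- The part of a matrix in the block positions `(β i, β j)` that satisfy `p`. -/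
def cut (β : ι → ℕ) (p : ℕ → ℕ → Prop) [DecidableRel p] (A : Matrix ι ι R) : Matrix ι ι R :=
  Matrix.of fun i j => if p (β i) (β j) then A i j else 0

/-- The series with constant term `1` and coefficients `g r` (`0 < r < n`). -/
def ser {S : Type} [Ring S] (n : ℕ) (g : ℕ → S) : PowerSeries S :=
  PowerSeries.mk fun r => if r = 0 then 1 else if r < n then g r else 0

/-- `F_r + D_r + E_r`, where `F D E` is the decomposition of a series with constant term `1`. -/
noncomputable def gaussSum (β : ι → ℕ) (T : PowerSeries (Matrix ι ι R)) (r : ℕ) : Matrix ι ι R :=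
  coeff r T - coeff r
    (ser r (fun s => if _h : s < r then cut β (· > ·) (gaussSum β T s) else 0)
      * ser r (fun s => if _h : s < r then cut β (· = ·) (gaussSum β T s) else 0)
      * ser r (fun s => if _h : s < r then cut β (· < ·) (gaussSum β T s) else 0))
termination_by r

/-- The full series with constant term `1`. -/
def full {S : Type} [Ring S] (g : ℕ → S) : PowerSeries S :=
  PowerSeries.mk fun r => if r = 0 then 1 else g r

theorem exists_gauss (β : ι → ℕ) (T : PowerSeries (Matrix ι ι R)) (hT : coeff 0 T = 1) :
    ∃ F D E, IsGauss β T F D E := by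
  refine ⟨full fun s => cut β (· > ·) (gaussSum β T s), full fun s => cut β (· = ·) (gaussSum β T s),
    full fun s => cut β (· < ·) (gaussSum β T s), ?_, ?_, ?_, ?_, ?_, ?_⟩
  · ext1 r
    rcases Nat.eq_zero_or_pos r with rfl | hr
    · rw [hT]; simp [coeff_mul, full]
    · have hlow : ∀ (c : ℕ → Matrix ι ι R), ∀ s < r, coeff s (full c)
          = coeff s (ser r (fun s => if _h : s < r then c s else 0)) := by
        intro c s hs
        simp [full, ser, hs]
      have h0 : ∀ (c : ℕ → Matrix ι ι R), coeff r (full c)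
          - coeff r (ser r (fun s => if _h : s < r then c s else 0)) = c r := by
        intro c
        simp [full, ser, hr.ne']
      have key := coeff_mul_mul_diff r _ _ _ _ _ _
        (hlow fun s => cut β (· > ·) (gaussSum β T s))
        (hlow fun s => cut β (· = ·) (gaussSum β T s))
        (hlow fun s => cut β (· < ·) (gaussSum β T s))
        (by simp [ser]) (by simp [ser]) (by simp [full]) (by simp [full])
      rw [h0, h0, h0] at key
      have hs := gaussSum.eq_1 β T r
      have hsum : cut β (· > ·) (gaussSum β T r) + cut β (· = ·) (gaussSum β T r)
          + cut β (· < ·) (gaussSum β T r) = gaussSum β T r := by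
        ext i j
        simp only [cut, Matrix.add_apply, Matrix.of_apply]
        rcases lt_trichotomy (β i) (β j) with h | h | h
        · simp [h, h.ne, h.le]
        · simp [h]
        · simp [h, h.ne', h.le]
      rw [hsum] at key
      rw [sub_eq_iff_eq_add.1 key, hs]
      exact (sub_add_cancel _ _).symm
  all_goals
    intro r i j h
    rcases Nat.eq_zero_or_pos r with rfl | hr
    · first
      | (have : i ≠ j := by (rintro rfl; simp at h)
         simp [full, this])
      | simp [full]
    · have h0 := hr.ne'
      simp only [full, cut, coeff_mk, h0, if_false, Matrix.of_apply, coeff_one]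
      first
      | (rw [if_neg (by omega)]; done)
      | (rw [if_neg (by omega)]; rfl)

theorem const_gauss (β : ι → ℕ) (T F D E : PowerSeries (Matrix ι ι R)) (hT : coeff 0 T = 1)
    (h : IsGauss β T F D E) : coeff 0 F = 1 ∧ coeff 0 D = 1 ∧ coeff 0 E = 1 := by
  have hm : coeff 0 F * coeff 0 D * coeff 0 E = 1 := by
    rw [← hT, h.eq_mul]; simp [coeff_mul]
  have hd := h.diag 0
  have hu := h.upper 0
  have hu1 := h.upper_one 0
  have hl := h.lower 0
  have hl1 := h.lower_one 0
  simp only [coeff_zero_one] at hu1 hl1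
  generalize coeff 0 F = f at *
  generalize coeff 0 D = d at *
  generalize coeff 0 E = e at *
  have main : ∀ n : ℕ, ∀ x, β x = n → (∀ j, d x j = (1 : Matrix ι ι R) x j) ∧
      (∀ i, d i x = (1 : Matrix ι ι R) i x) ∧
      (∀ j, e x j = (1 : Matrix ι ι R) x j) ∧ (∀ i, f i x = (1 : Matrix ι ι R) i x) := by
    intro n
    induction n using Nat.strong_induction_on with
    | _ n ih =>
      have frow : ∀ x, β x = n → ∀ k, f x k = (1 : Matrix ι ι R) x k := by
        intro x hx k
        rcases lt_trichotomy (β x) (β k) with hk | hk | hk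
        · rw [hl x k hk, Matrix.one_apply_ne (by rintro rfl; omega)]
        · exact hl1 x k hk
        · exact (ih (β k) (by omega) k rfl).2.2.2 x
      have ecol : ∀ x, β x = n → ∀ k, e k x = (1 : Matrix ι ι R) k x := by
        intro x hx k
        rcases lt_trichotomy (β x) (β k) with hk | hk | hk
        · rw [hu k x hk, Matrix.one_apply_ne (by rintro rfl; omega)]
        · exact hu1 k x hk.symm
        · exact (ih (β k) (by omega) k rfl).2.2.1 x
      have hde : ∀ x, β x = n → ∀ j, (d * e) x j = (1 : Matrix ι ι R) x j := by
        intro x hx j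
        have := congrFun (congrFun hm x) j
        rw [Matrix.mul_assoc, Matrix.mul_apply] at this
        simpa [frow x hx, Matrix.one_apply] using this
      have hfd : ∀ x, β x = n → ∀ i, (f * d) i x = (1 : Matrix ι ι R) i x := by
        intro x hx i
        have := congrFun (congrFun hm i) x
        rw [Matrix.mul_apply] at this
        simpa [ecol x hx, Matrix.one_apply] using this
      have hdd : ∀ x y, β x = n → β y = n → d x y = (1 : Matrix ι ι R) x y := by
        intro x y hx hy
        have := hde x hx y
        rw [Matrix.mul_apply] at this
        simpa [ecol y hy, Matrix.one_apply] using this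
      have drow : ∀ x, β x = n → ∀ j, d x j = (1 : Matrix ι ι R) x j := by
        intro x hx j
        by_cases hj : β j = n
        · exact hdd x j hx hj
        · rw [hd x j (by omega), Matrix.one_apply_ne (by rintro rfl; omega)]
      have dcol : ∀ x, β x = n → ∀ i, d i x = (1 : Matrix ι ι R) i x := by
        intro x hx j
        by_cases hj : β j = n
        · exact hdd j x hj hx
        · rw [hd j x (by omega), Matrix.one_apply_ne (by rintro rfl; omega)]
      intro x hx
      refine ⟨drow x hx, dcol x hx, fun j => ?_, fun i => ?_⟩
      · have := hde x hx j
        rw [Matrix.mul_apply] at this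
        simpa [drow x hx, Matrix.one_apply] using this
      · have := hfd x hx i
        rw [Matrix.mul_apply] at this
        simpa [dcol x hx, Matrix.one_apply] using this
  refine ⟨?_, ?_, ?_⟩ <;> ext i j
  · exact (main _ j rfl).2.2.2 i
  · exact (main _ i rfl).1 j
  · exact (main _ i rfl).2.2.1 j

theorem gauss_unique (β : ι → ℕ) (T F D E F' D' E' : PowerSeries (Matrix ι ι R))
    (hT : coeff 0 T = 1) (h : IsGauss β T F D E) (h' : IsGauss β T F' D' E') :
    F = F' ∧ D = D' ∧ E = E' := by
  obtain ⟨a1, a2, a3⟩ := const_gauss β T F D E hT h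
  obtain ⟨b1, b2, b3⟩ := const_gauss β T F' D' E' hT h'
  have main : ∀ r, coeff r F = coeff r F' ∧ coeff r D = coeff r D' ∧ coeff r E = coeff r E' := by
    intro r
    induction r using Nat.strong_induction_on with
    | _ r ih =>
      have key := coeff_mul_mul_diff r F D E F' D' E' (fun s hs => (ih s hs).1)
        (fun s hs => (ih s hs).2.1) (fun s hs => (ih s hs).2.2) b1 b2 a2 a3
      rw [← h.eq_mul, ← h'.eq_mul, sub_self] at key
      have ent : ∀ i j, 0 = (coeff r F i j - coeff r F' i j) + (coeff r D i j - coeff r D' i j)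
          + (coeff r E i j - coeff r E' i j) := fun i j => congrFun (congrFun key i) j
      refine ⟨?_, ?_, ?_⟩ <;> ext i j <;> have e := ent i j <;>
        rcases lt_trichotomy (β i) (β j) with hij | hij | hij
      · rw [h.lower r i j hij, h'.lower r i j hij]
      · rw [h.lower_one r i j hij, h'.lower_one r i j hij]
      · rw [h.diag r i j hij.ne', h'.diag r i j hij.ne', h.upper r i j hij,
          h'.upper r i j hij] at e
        simpa [sub_eq_zero] using e.symm
      · rw [h.diag r i j hij.ne, h'.diag r i j hij.ne]
      · rw [h.lower_one r i j hij, h'.lower_one r i j hij, h.upper_one r i j hij,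
          h'.upper_one r i j hij] at e
        simpa [sub_eq_zero] using e.symm
      · rw [h.diag r i j hij.ne', h'.diag r i j hij.ne']
      · rw [h.diag r i j hij.ne, h'.diag r i j hij.ne, h.lower r i j hij,
          h'.lower r i j hij] at e
        simpa [sub_eq_zero] using e.symm
      · rw [h.upper_one r i j hij, h'.upper_one r i j hij]
      · rw [h.upper r i j hij, h'.upper r i j hij]
  exact ⟨PowerSeries.ext fun r => (main r).1, PowerSeries.ext fun r => (main r).2.1,
    PowerSeries.ext fun r => (main r).2.2⟩

end BlockGauss

/-! ### The parabolic generators -/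

namespace SuperYangian

open PowerSeries

variable {M N : ℕ} (lam : Composition M) (nu : Composition N)

/-- The number `m + n` of blocks of the composition `μ = (λ | ν)` of `(M | N)`. -/
abbrev numBlocks : ℕ := (lam.append nu).length

/-- The size `μ_a` of the block `a`; blocks are counted from `0`, those with `a < m` (the length of
`λ`) coming from `λ` and the others from `ν`. -/
abbrev sz (a : Fin (numBlocks lam nu)) : ℕ := (lam.append nu).blocksFun a

/-- Row and column indices arranged in blocks: pairs of a block and a position in it. -/
abbrev BlockIdx : Type := Σ a : Fin (numBlocks lam nu), Fin (sz lam nu a)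

/-- The parity of the block `a`: `0` for the blocks of `λ`, `1` for those of `ν`. -/
def bpar (a : Fin (numBlocks lam nu)) : ℕ := if (a : ℕ) < lam.length then 0 else 1

/-- The matrix `T(u)`, a power series in `u⁻¹`, with rows and columns arranged in blocks. -/
noncomputable def blockT :
    PowerSeries (Matrix (BlockIdx lam nu) (BlockIdx lam nu) (SuperYangian M N)) :=
  PowerSeries.mk fun r => Matrix.of fun x y =>
    t ((lam.append nu).blocksFinEquiv x) ((lam.append nu).blocksFinEquiv y) r

theorem coeff_zero_blockT : coeff 0 (blockT lam nu) = 1 := by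
  ext x y
  simp [blockT, t_zero, Matrix.one_apply]

/-- The triples `(F(u), D(u), E(u))` of a block Gauss decomposition `T(u) = F(u) D(u) E(u)`: there is
exactly one. -/
theorem existsUnique_gauss :
    ∃! G : PowerSeries (Matrix (BlockIdx lam nu) (BlockIdx lam nu) (SuperYangian M N))
        × PowerSeries (Matrix (BlockIdx lam nu) (BlockIdx lam nu) (SuperYangian M N))
        × PowerSeries (Matrix (BlockIdx lam nu) (BlockIdx lam nu) (SuperYangian M N)),
      BlockGauss.IsGauss (fun x => (x.1 : ℕ)) (blockT lam nu) G.1 G.2.1 G.2.2 := by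
  obtain ⟨F, D, E, h⟩ := BlockGauss.exists_gauss (fun x : BlockIdx lam nu => (x.1 : ℕ))
    (blockT lam nu) (coeff_zero_blockT lam nu)
  refine ⟨(F, D, E), h, ?_⟩
  rintro ⟨F', D', E'⟩ h'
  obtain ⟨e1, e2, e3⟩ := BlockGauss.gauss_unique _ _ _ _ _ _ _ _ (coeff_zero_blockT lam nu) h' h
  exact Prod.ext e1 (Prod.ext e2 e3)

/-- The block lower unitriangular factor `F(u)`. -/
noncomputable def gaussF :
    PowerSeries (Matrix (BlockIdx lam nu) (BlockIdx lam nu) (SuperYangian M N)) :=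
  (existsUnique_gauss lam nu).choose.1

/-- The block diagonal factor `D(u)`. -/
noncomputable def gaussD :
    PowerSeries (Matrix (BlockIdx lam nu) (BlockIdx lam nu) (SuperYangian M N)) :=
  (existsUnique_gauss lam nu).choose.2.1

/-- The block upper unitriangular factor `E(u)`. -/
noncomputable def gaussE :
    PowerSeries (Matrix (BlockIdx lam nu) (BlockIdx lam nu) (SuperYangian M N)) :=
  (existsUnique_gauss lam nu).choose.2.2

theorem isGauss :
    BlockGauss.IsGauss (fun x => (x.1 : ℕ)) (blockT lam nu) (gaussF lam nu) (gaussD lam nu)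
      (gaussE lam nu) :=
  (existsUnique_gauss lam nu).choose_spec.1

/-- The diagonal block `D_a(u)`. -/
noncomputable def blockD (a : Fin (numBlocks lam nu)) :
    PowerSeries (Matrix (Fin (sz lam nu a)) (Fin (sz lam nu a)) (SuperYangian M N)) :=
  PowerSeries.mk fun r => Matrix.of fun i j => coeff r (gaussD lam nu) ⟨a, i⟩ ⟨a, j⟩

theorem isUnit_blockD (a : Fin (numBlocks lam nu)) : IsUnit (blockD lam nu a) := by
  have h0 : constantCoeff (blockD lam nu a) = 1 := by
    rw [← coeff_zero_eq_constantCoeff_apply]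
    simp only [blockD, coeff_mk]
    rw [(BlockGauss.const_gauss _ _ _ _ _ (coeff_zero_blockT lam nu) (isGauss lam nu)).2.1]
    ext i j
    simp [Matrix.one_apply]
  rw [isUnit_iff_constantCoeff, h0]
  exact isUnit_one

/-- `D_{a;i,j}^{(r)}`. -/
noncomputable def Dgen (a : Fin (numBlocks lam nu)) (i j : Fin (sz lam nu a)) (r : ℕ) :
    SuperYangian M N :=
  coeff r (blockD lam nu a) i j

/-- `D'_{a;i,j}^{(r)}`, where `D'_a(u)` is the inverse of `D_a(u)`. -/
noncomputable def Dgen' (a : Fin (numBlocks lam nu)) (i j : Fin (sz lam nu a)) (r : ℕ) :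
    SuperYangian M N :=
  coeff r (Ring.inverse (blockD lam nu a)) i j

/-- `E_{a,b;i,j}^{(r)}`; for `b = a + 1` it is also written `E_{a;i,j}^{(r)}`. -/
noncomputable def Egen (a b : Fin (numBlocks lam nu)) (i : Fin (sz lam nu a))
    (j : Fin (sz lam nu b)) (r : ℕ) : SuperYangian M N :=
  coeff r (gaussE lam nu) ⟨a, i⟩ ⟨b, j⟩

/-- `F_{b,a;i,j}^{(r)}`; for `b = a + 1` it is also written `F_{a;i,j}^{(r)}`. -/
noncomputable def Fgen (b a : Fin (numBlocks lam nu)) (i : Fin (sz lam nu b))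
    (j : Fin (sz lam nu a)) (r : ℕ) : SuperYangian M N :=
  coeff r (gaussF lam nu) ⟨b, i⟩ ⟨a, j⟩

end SuperYangian

/-! ### Supercommutators of matrices -/

namespace SuperRTT

open Matrix

variable {ι : Type} [Fintype ι] [DecidableEq ι] {B : Type} [Ring B] {K : Type} [CommRing K]
  [Algebra K B]

/-! Write the defining relations in series form: (u - v)[t_ij(u), t_hk(v)] is a sign times t_hj(u)
t_ik(v) - t_hj(v) t_ik(u). Let t_ij(u) act by the signed scalar diagonal matrix `hat`. Then the
supercommutators of t_ij(u) with all the entries of T(v) are, up to sign, the entries of an ordinary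
commutator of matrices, and the relations become one identity (`RTT`): c [t_ij(u), T(v)] = ± d (T(u)
E_ji T(v) - T(v) E_ji T(u)), with c = v⁻¹ - u⁻¹ regular and d = κ u⁻¹v⁻¹. The Leibniz rule,
conjugation and inversion now work without signs. Below, `G` stands for the decomposition at u and
`H` for the one at v; a prime denotes an inverse.

For T = FDE the matrix F'[x,T]E' is the sum of F'[x,F]D, [x,D] and D[x,E]E', which are strictly
lower, block diagonal and strictly upper (`RTTPair.lie_decomp`, `RTTPair.conj_rtt`). If i lies in
the first block, the right-hand side of the relation simplifies, because row i of F is trivial, and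
comparing block positions gives the commutators of the first block row of T(u) with F(v), D(v),
E(v). In that row T_ij = ∑ D_ip E_pj. The commutators of D_ip are already known and D is invertible,
so D can be cancelled (`RTTPair.lie_strip`, `LDU.strip_eq`), and the commutators of the first block
row of E remain. Other rows reduce to the first one by `RTTPair.sub`: the blocks of T' = E'D'F' from
a on form the inverse of the product of the truncated factors, and `RTT` survives inversion and
passage to principal submatrices. Comparing coefficients and telescoping along r + s = const turns
the series identities into the stated sums.

Three families need more. For E_a against itself the cancellation yields only a formula for c² times
the bracket. The defect of the expected formula and the defect with two column indices exchanged
satisfy a coupled system, which forces both to vanish by induction on the total degree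
(`double_seq_eq_zero`, `eq_zero_of_smul_system`). For the cubic relations, the bracket of E_a(v) and
E_{a+1}(w) is a scalar multiple of an entry of E(v)E'(w); bracketing with E_a(u) gives a fraction
whose numerator is symmetric in u, v and whose denominator is antisymmetric (`Rel.cubic_series`).
For the quartic relations, the two inner brackets are multiples of a coefficient of E and of one of
E', and these supercommute (`Rel.quartic`).

Two symmetries supply the rest. Transposition over the opposite ring exchanges E and F
(`LDU.opposite`). Combined with inversion and reversal of the block order (`LDU.rev`), it turns the
cubic relation for b = a + 1 into the one for b = a - 1. Finally, uniqueness of the Gauss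
decomposition shows that the generators are homogeneous (`conjParity_gauss`), so that the bracket
`sbr` can be computed as the explicit expression `sc`. -/

theorem neg_one_pow_three (R : Type) [Ring R] : (-1 : R) ^ 3 = -1 := Odd.neg_one_pow (by decide)

theorem neg_one_pow_five (R : Type) [Ring R] : (-1 : R) ^ 5 = -1 := Odd.neg_one_pow (by decide)

/-- The supercommutator of two elements whose parities have product `e`. -/
def sc (e : ℕ) (x y : B) : B := x * y - (-1) ^ e * (y * x)

/-- The action of `x`, of the parity of the matrix entry `(i, j)`, on the superspace with basis `ι`
tensored with `B`. -/
def hat (p : ι → ℕ) (i j : ι) (x : B) : Matrix ι ι B :=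
  diagonal fun h => (-1) ^ ((p i + p j) * p h) * x

/-- The parity of the middle index cancels modulo 2. This lets a product of entries be expanded by
the Leibniz rule, in particular T_ij = ∑ D_ip E_pj. -/
theorem hat_mul {p : ι → ℕ} (hp : ∀ i, p i = 0 ∨ p i = 1) (i q j : ι) (x y : B) :
    hat p i q x * hat p q j y = hat p i j (x * y) := by
  unfold hat
  rw [diagonal_mul_diagonal]
  congr 1
  funext h
  rcases hp i with hi | hi <;> rcases hp j with hj | hj <;> rcases hp q with hq | hq <;>
    rcases hp h with hh | hh <;> simp [hi, hj, hq, hh]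

theorem hat_sum {p : ι → ℕ} (i j : ι) {κ : Type} (s : Finset κ) (f : κ → B) :
    hat p i j (∑ q ∈ s, f q) = ∑ q ∈ s, hat p i j (f q) := by
  ext h k
  by_cases hk : h = k
  · subst hk; simp [hat, Finset.mul_sum, Matrix.sum_apply]
  · simp [hat, Matrix.sum_apply, hk]

theorem hat_apply_mul {p : ι → ℕ} (i j : ι) (x : B) (M : Matrix ι ι B) (h k : ι) :
    (hat p i j x * M) h k = (-1) ^ ((p i + p j) * p h) * x * M h k := by
  simp [hat, diagonal_mul]

theorem mul_hat_apply {p : ι → ℕ} (i j : ι) (x : B) (M : Matrix ι ι B) (h k : ι) :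
    (M * hat p i j x) h k = M h k * ((-1) ^ ((p i + p j) * p k) * x) := by
  simp [hat, mul_diagonal]

/-- Multiplying on the left gives the sign of row h, on the right that of column k; their quotient
is exactly the supercommutator sign for an entry of parity p h + p k. Super-derivations thus become
ordinary inner derivations of the matrix ring. -/
theorem lie_hat_apply {p : ι → ℕ} (hp : ∀ i, p i = 0 ∨ p i = 1) (i j : ι) (x : B)
    (M : Matrix ι ι B) (h k : ι) :
    ⁅hat p i j x, M⁆ h k
      = (-1) ^ ((p i + p j) * p h) * sc ((p i + p j) * (p h + p k)) x (M h k) := by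
  rw [Ring.lie_def, Matrix.sub_apply, hat_apply_mul, mul_hat_apply]
  rcases hp i with hi | hi <;> rcases hp j with hj | hj <;> rcases hp h with hh | hh <;>
    rcases hp k with hk | hk <;> simp [sc, hi, hj, hh, hk] <;> noncomm_ring

theorem sc_eq_lie_hat {p : ι → ℕ} (hp : ∀ i, p i = 0 ∨ p i = 1) (i j : ι) (x : B)
    (M : Matrix ι ι B) (h k : ι) :
    sc ((p i + p j) * (p h + p k)) x (M h k)
      = (-1) ^ ((p i + p j) * p h) * ⁅hat p i j x, M⁆ h k := by
  rw [lie_hat_apply hp, ← mul_assoc, ← pow_add, Even.neg_one_pow ⟨_, rfl⟩, one_mul]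

/-- Antisymmetry of the supercommutator, which allows either of the two matrices of a relation to be
the one acting through its entries. -/
theorem lie_hat_swap {p : ι → ℕ} (hp : ∀ i, p i = 0 ∨ p i = 1) (i j h k : ι)
    (M N : Matrix ι ι B) :
    ⁅hat p h k (M h k), N⁆ i j
      = -((-1) ^ (p i * p h + p j * p k) * ⁅hat p i j (N i j), M⁆ h k) := by
  rw [lie_hat_apply hp, lie_hat_apply hp]
  rcases hp i with hi | hi <;> rcases hp j with hj | hj <;> rcases hp h with hh | hh <;>
    rcases hp k with hk | hk <;> norm_num [sc, hi, hj, hh, hk] <;> abel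

/-- The matrix unit `E_{ji}`. -/
abbrev unit (j i : ι) : Matrix ι ι B := single j i 1

/-- The `RTT` relation between the values `T`, `U` of a matrix at two points. -/
def RTT (p : ι → ℕ) (c d : K) (T U : Matrix ι ι B) : Prop :=
  ∀ i j, c • ⁅hat p i j (T i j), U⁆
    = (d * (-1) ^ (p i * p j)) • (T * unit j i * U - U * unit j i * T)

theorem neg_one_pow_smul (n : ℕ) (x : B) : ((-1 : K) ^ n) • x = (-1) ^ n * x := by
  rcases neg_one_pow_eq_or K n with h | h <;> rcases Nat.even_or_odd n with h' | h' <;>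
    simp [h'.neg_one_pow]

theorem mul_unit_mul_apply (M N : Matrix ι ι B) (i j h k : ι) :
    (M * unit j i * N : Matrix ι ι B) h k = M h j * N i k := by
  simp [Matrix.mul_apply, unit, single_apply, Finset.sum_mul, ite_and]

theorem RTT.of_entries {p : ι → ℕ} (hp : ∀ i, p i = 0 ∨ p i = 1) {c d : K} {T U : Matrix ι ι B}
    (H : ∀ i j h k, c • sc ((p i + p j) * (p h + p k)) (T i j) (U h k)
      = d • ((-1) ^ (p i * p j + p i * p h + p j * p h) * (T h j * U i k - U h j * T i k))) :
    RTT p c d T U := by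
  intro i j
  ext h k
  rw [Matrix.smul_apply, lie_hat_apply hp, ← mul_smul_comm, H, Matrix.smul_apply, Matrix.sub_apply,
    mul_unit_mul_apply, mul_unit_mul_apply, mul_smul, neg_one_pow_smul, mul_smul_comm,
    ← mul_assoc, ← pow_add]
  congr 2
  rcases hp i with hi | hi <;> rcases hp j with hj | hj <;> rcases hp h with hh | hh <;>
    simp [hi, hj, hh, neg_one_pow_three, neg_one_pow_five]

theorem lie_inv {x T T' : B} (h1 : T * T' = 1) (h2 : T' * T = 1) :
    ⁅x, T'⁆ = -(T' * ⁅x, T⁆ * T') := by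
  have : T' * ⁅x, T⁆ * T' = T' * x * (T * T') - (T' * T) * x * T' := by
    rw [Ring.lie_def]; noncomm_ring
  rw [this, h1, h2, Ring.lie_def]; noncomm_ring

theorem RTT.lie_inv {p : ι → ℕ} {c d : K} {T U U' : Matrix ι ι B} (H : RTT p c d T U)
    (h1 : U * U' = 1) (h2 : U' * U = 1) (i j : ι) :
    c • ⁅hat p i j (T i j), U'⁆
      = (d * (-1) ^ (p i * p j)) • (unit j i * T * U' - U' * T * unit j i) := by
  have e : U' * (T * unit j i * U - U * unit j i * T) * U'
      = U' * T * unit j i * (U * U') - (U' * U) * unit j i * T * U' := by noncomm_ring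
  rw [SuperRTT.lie_inv h1 h2, smul_neg, ← smul_mul_assoc, ← mul_smul_comm, H i j, mul_smul_comm,
    smul_mul_assoc, e, h1, h2, ← smul_neg]
  congr 1
  noncomm_ring

/-- The second matrix is inverted by `RTT.lie_inv`, antisymmetry exchanges the roles of the two
matrices, and the other one is then inverted in the same way. Hence the inverses come out in the
opposite order. -/
theorem RTT.inv {p : ι → ℕ} (hp : ∀ i, p i = 0 ∨ p i = 1) {c d : K} {T U T' U' : Matrix ι ι B}
    (H : RTT p c d T U) (h1 : U * U' = 1) (h2 : U' * U = 1) (h3 : T * T' = 1) (h4 : T' * T = 1) :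
    RTT p c d U' T' := by
  intro h k
  -- The relation obtained by inverting U, read as a statement on the bracket of an entry of U' with
  -- T.
  have key : c • ⁅hat p h k (U' h k), T⁆
      = -((d * (-1) ^ (p h * p k)) • (T * U' * unit k h - unit k h * U' * T)) := by
    ext i j
    have e := congrFun (congrFun (H.lie_inv h1 h2 i j) h) k
    rw [Matrix.smul_apply, lie_hat_swap hp i j h k U' T, smul_neg, ← mul_smul_comm,
      ← Matrix.smul_apply, e]
    have a1 : (unit j i * T * U' : Matrix ι ι B) h k = if j = h then (T * U') i k else 0 := by
      rw [Matrix.mul_assoc]; split_ifs with hh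
      · subst hh; simp
      · simp [Matrix.mul_apply, unit, single_apply, hh]
    have a2 : (U' * T * unit j i : Matrix ι ι B) h k = if i = k then (U' * T) h j else 0 := by
      split_ifs with hh
      · subst hh; simp
      · simp [Matrix.mul_apply, unit, single_apply, hh]
    have a3 : (unit k h * U' * T : Matrix ι ι B) i j = if i = k then (U' * T) h j else 0 := by
      rw [Matrix.mul_assoc]; split_ifs with hh
      · subst hh; simp
      · simp [Matrix.mul_apply, unit, single_apply, Ne.symm hh]
    have a4 : (T * U' * unit k h : Matrix ι ι B) i j = if j = h then (T * U') i k else 0 := by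
      split_ifs with hh
      · subst hh; simp
      · simp [Matrix.mul_apply, unit, single_apply, Ne.symm hh]
    simp only [Matrix.smul_apply, Matrix.sub_apply, Matrix.neg_apply, a1, a2, a3, a4]
    rw [mul_smul, mul_smul, neg_one_pow_smul, neg_one_pow_smul, mul_smul_comm, ← mul_assoc,
      ← pow_add]
    congr 2
    split_ifs with h1 h2 h2
    · subst h1 h2
      rcases hp i with hi | hi <;> rcases hp j with hj | hj <;> simp [hi, hj, neg_one_pow_three]
    · subst h1
      rcases hp i with hi | hi <;> rcases hp j with hj | hj <;> rcases hp k with hk | hk <;>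
        simp [hi, hj, hk, neg_one_pow_three]
    · subst h2
      rcases hp i with hi | hi <;> rcases hp j with hj | hj <;> rcases hp h with hk | hk <;>
        simp [hi, hj, hk, neg_one_pow_three]
    · simp
  have e : T' * (T * U' * unit k h - unit k h * U' * T) * T'
      = (T' * T) * U' * unit k h * T' - T' * unit k h * U' * (T * T') := by noncomm_ring
  rw [SuperRTT.lie_inv h3 h4, smul_neg, ← smul_mul_assoc, ← mul_smul_comm, key, mul_neg, neg_mul,
    neg_neg, mul_smul_comm, smul_mul_assoc, e, h3, h4, one_mul, mul_one]

/-- Each entry of the relation involves only the indices i, j, h, k, with no summation over a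
further index. -/
theorem RTT.submatrix {p : ι → ℕ} {c d : K} {T U : Matrix ι ι B} (H : RTT p c d T U)
    {κ : Type} [Fintype κ] [DecidableEq κ] (f : κ → ι) :
    RTT (p ∘ f) c d (T.submatrix f f) (U.submatrix f f) := by
  intro i j
  ext h k
  have e := congrFun (congrFun (H (f i) (f j)) (f h)) (f k)
  simp only [Matrix.smul_apply, Matrix.sub_apply, mul_unit_mul_apply, Ring.lie_def, hat_apply_mul,
    mul_hat_apply] at e ⊢
  exact e

end SuperRTT

/-! ### Block triangular decompositions -/

namespace SuperRTT

open Matrix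

variable {ι : Type} [Fintype ι] [DecidableEq ι] {B : Type} [Ring B] {K : Type} [CommRing K]
  [Algebra K B]

/-- The matrix `M` is supported in the block positions allowed by the relation `r`. -/
def Tri (β : ι → ℕ) (r : ℕ → ℕ → Prop) (M : Matrix ι ι B) : Prop :=
  ∀ i j, ¬ r (β i) (β j) → M i j = 0

theorem Tri.mul {β : ι → ℕ} {r s t : ℕ → ℕ → Prop} {M N : Matrix ι ι B} (hM : Tri β r M)
    (hN : Tri β s N) (h : ∀ a b c, r a b → s b c → t a c) : Tri β t (M * N) := by
  intro i j hij
  rw [Matrix.mul_apply]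
  refine Finset.sum_eq_zero fun g _ => ?_
  by_cases h1 : r (β i) (β g)
  · by_cases h2 : s (β g) (β j)
    · exact absurd (h _ _ _ h1 h2) hij
    · rw [hN _ _ h2, mul_zero]
  · rw [hM _ _ h1, zero_mul]

/-- A block Gauss decomposition `F D E` together with the inverses of its factors. -/
structure LDU (β : ι → ℕ) (B : Type) [Ring B] where
  F : Matrix ι ι B
  D : Matrix ι ι B
  E : Matrix ι ι B
  F' : Matrix ι ι B
  D' : Matrix ι ι B
  E' : Matrix ι ι B
  mul_F' : F * F' = 1
  F'_mul : F' * F = 1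
  mul_D' : D * D' = 1
  D'_mul : D' * D = 1
  mul_E' : E * E' = 1
  E'_mul : E' * E = 1
  triF : ∀ i j, β i ≤ β j → F i j = (1 : Matrix ι ι B) i j
  triF' : ∀ i j, β i ≤ β j → F' i j = (1 : Matrix ι ι B) i j
  triD : ∀ i j, β i ≠ β j → D i j = 0
  triD' : ∀ i j, β i ≠ β j → D' i j = 0
  triE : ∀ i j, β j ≤ β i → E i j = (1 : Matrix ι ι B) i j
  triE' : ∀ i j, β j ≤ β i → E' i j = (1 : Matrix ι ι B) i j

namespace LDU

variable {β : ι → ℕ} (G : LDU β B)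

/-- The decomposed matrix. -/
def T : Matrix ι ι B := G.F * G.D * G.E

/-- The inverse of the decomposed matrix. -/
def T' : Matrix ι ι B := G.E' * G.D' * G.F'

theorem mul_T' : G.T * G.T' = 1 := by
  have : G.T * G.T' = G.F * (G.D * (G.E * G.E') * G.D') * G.F' := by
    unfold T T'; noncomm_ring
  rw [this, G.mul_E', mul_one, G.mul_D', mul_one, G.mul_F']

theorem T'_mul : G.T' * G.T = 1 := by
  have : G.T' * G.T = G.E' * (G.D' * (G.F' * G.F) * G.D) * G.E := by
    unfold T T'; noncomm_ring
  rw [this, G.F'_mul, mul_one, G.D'_mul, mul_one, G.E'_mul]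

theorem one_ne {i j : ι} (h : β i ≠ β j) : (1 : Matrix ι ι B) i j = 0 :=
  Matrix.one_apply_ne fun e => h (congrArg β e)

theorem F_tri : Tri β (· ≥ ·) G.F := fun i j h => by
  rw [G.triF i j (by omega), one_ne (β := β) (by omega)]

theorem F'_tri : Tri β (· ≥ ·) G.F' := fun i j h => by
  rw [G.triF' i j (by omega), one_ne (β := β) (by omega)]

theorem E_tri : Tri β (· ≤ ·) G.E := fun i j h => by
  rw [G.triE i j (by omega), one_ne (β := β) (by omega)]

theorem E'_tri : Tri β (· ≤ ·) G.E' := fun i j h => by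
  rw [G.triE' i j (by omega), one_ne (β := β) (by omega)]

theorem D_tri : Tri β (· = ·) G.D := fun i j h => G.triD i j h

theorem D'_tri : Tri β (· = ·) G.D' := fun i j h => G.triD' i j h

/-- The part of a matrix in the blocks from `a` on. -/
abbrev res (β : ι → ℕ) (a : ℕ) (M : Matrix ι ι B) : Matrix {x // a ≤ β x} {x // a ≤ β x} B :=
  M.submatrix Subtype.val Subtype.val

/-- Truncation is multiplicative as soon as no product passes through an earlier block. It is enough
that the left factor is upper or the right factor lower triangular. -/
theorem res_mul {a : ℕ} {M N : Matrix ι ι B}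
    (h : ∀ x y g, a ≤ β x → a ≤ β y → β g < a → M x g * N g y = 0) :
    res β a (M * N) = res β a M * res β a N := by
  ext x y
  simp only [submatrix_apply, Matrix.mul_apply]
  rw [← Fintype.sum_subtype_add_sum_subtype (fun g => a ≤ β g)]
  refine add_eq_left.2 (Finset.sum_eq_zero fun g _ => ?_)
  exact h _ _ _ x.2 y.2 (not_le.1 g.2)

theorem res_mul_upper {a : ℕ} {M N : Matrix ι ι B} (h : Tri β (· ≤ ·) M) :
    res β a (M * N) = res β a M * res β a N :=
  res_mul fun x y g hx _ hg => by rw [h x g (by omega), zero_mul]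

theorem res_mul_lower {a : ℕ} {M N : Matrix ι ι B} (h : Tri β (· ≥ ·) N) :
    res β a (M * N) = res β a M * res β a N :=
  res_mul fun x y g _ hy hg => by rw [h g y (by omega), mul_zero]

theorem _root_.SuperRTT.Tri.mono {r s : ℕ → ℕ → Prop} {M : Matrix ι ι B} (h : Tri β r M)
    (hrs : ∀ a b, r a b → s a b) : Tri β s M := fun i j hij => h i j fun e => hij (hrs _ _ e)

theorem res_one {a : ℕ} :
    res β a (1 : Matrix ι ι B) = 1 :=
  Matrix.submatrix_one _ Subtype.val_injective

/-- The decomposition formed by the blocks from `a` on. -/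
def sub (a : ℕ) : LDU (fun x : {x // a ≤ β x} => β x) B where
  F := res β a G.F
  D := res β a G.D
  E := res β a G.E
  F' := res β a G.F'
  D' := res β a G.D'
  E' := res β a G.E'
  mul_F' := by rw [← res_mul_lower G.F'_tri, G.mul_F', res_one]
  F'_mul := by rw [← res_mul_lower G.F_tri, G.F'_mul, res_one]
  mul_D' := by
    rw [← res_mul_lower (G.D'_tri.mono fun _ _ h => h.ge), G.mul_D', res_one]
  D'_mul := by
    rw [← res_mul_lower (G.D_tri.mono fun _ _ h => h.ge), G.D'_mul, res_one]
  mul_E' := by rw [← res_mul_upper G.E_tri, G.mul_E', res_one]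
  E'_mul := by rw [← res_mul_upper G.E'_tri, G.E'_mul, res_one]
  triF i j h := by
    exact (G.triF _ _ h).trans (congrFun (congrFun (res_one (β := β) (a := a) (B := B)) i) j)
  triF' i j h := by
    exact (G.triF' _ _ h).trans (congrFun (congrFun (res_one (β := β) (a := a) (B := B)) i) j)
  triD i j h := G.triD _ _ h
  triD' i j h := G.triD' _ _ h
  triE i j h := by
    exact (G.triE _ _ h).trans (congrFun (congrFun (res_one (β := β) (a := a) (B := B)) i) j)
  triE' i j h := by
    exact (G.triE' _ _ h).trans (congrFun (congrFun (res_one (β := β) (a := a) (B := B)) i) j)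

/-- E' on the left is upper and F' on the right is lower triangular, so truncation goes through
E'D'F'. It does not go through FDE: the matrix of the truncated decomposition is a Schur complement,
not a submatrix of T. -/
theorem sub_T' (a : ℕ) : (G.sub a).T' = res β a G.T' := by
  unfold T'
  rw [res_mul_lower G.F'_tri, res_mul_upper G.E'_tri]
  rfl

/-- The image of a decomposition under a ring homomorphism. -/
def map {C : Type} [Ring C] (f : B →+* C) : LDU β C where
  F := G.F.map f
  D := G.D.map f
  E := G.E.map f
  F' := G.F'.map f
  D' := G.D'.map f
  E' := G.E'.map f
  mul_F' := by rw [← Matrix.map_mul, G.mul_F', Matrix.map_one _ (map_zero f) (map_one f)]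
  F'_mul := by rw [← Matrix.map_mul, G.F'_mul, Matrix.map_one _ (map_zero f) (map_one f)]
  mul_D' := by rw [← Matrix.map_mul, G.mul_D', Matrix.map_one _ (map_zero f) (map_one f)]
  D'_mul := by rw [← Matrix.map_mul, G.D'_mul, Matrix.map_one _ (map_zero f) (map_one f)]
  mul_E' := by rw [← Matrix.map_mul, G.mul_E', Matrix.map_one _ (map_zero f) (map_one f)]
  E'_mul := by rw [← Matrix.map_mul, G.E'_mul, Matrix.map_one _ (map_zero f) (map_one f)]
  triF i j h := by
    rw [← Matrix.map_one f (map_zero f) (map_one f), map_apply, map_apply, G.triF i j h]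
  triF' i j h := by
    rw [← Matrix.map_one f (map_zero f) (map_one f), map_apply, map_apply, G.triF' i j h]
  triD i j h := by rw [map_apply, G.triD i j h, map_zero]
  triD' i j h := by rw [map_apply, G.triD' i j h, map_zero]
  triE i j h := by
    rw [← Matrix.map_one f (map_zero f) (map_one f), map_apply, map_apply, G.triE i j h]
  triE' i j h := by
    rw [← Matrix.map_one f (map_zero f) (map_one f), map_apply, map_apply, G.triE' i j h]

theorem map_T {C : Type} [Ring C] (f : B →+* C) : (G.map f).T = G.T.map f := by
  unfold T; rw [Matrix.map_mul, Matrix.map_mul]; rfl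

theorem unit_mul_F {i j : ι} (hi : ∀ x, β i ≤ β x) : unit j i * G.F = unit j i := by
  ext h k
  by_cases hh : j = h
  · subst hh
    simp [G.triF i k (hi k), Matrix.one_apply, unit, single_apply]
  · simp [Matrix.mul_apply, unit, single_apply, hh]

theorem E_mul_unit {i j : ι} (hj : ∀ x, β j ≤ β x) : G.E * unit j i = unit j i := by
  ext h k
  by_cases hh : i = k
  · subst hh
    simp [G.triE h j (hj h), Matrix.one_apply, unit, single_apply, eq_comm]
  · simp [Matrix.mul_apply, unit, single_apply, hh]

theorem unit_mul_T {i j : ι} (hi : ∀ x, β i ≤ β x) : unit j i * G.T = unit j i * G.D * G.E := by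
  unfold T; rw [← mul_assoc, ← mul_assoc, G.unit_mul_F hi]

theorem T_mul_unit {i j : ι} (hj : ∀ x, β j ≤ β x) : G.T * unit j i = G.F * G.D * unit j i := by
  unfold T; rw [mul_assoc, G.E_mul_unit hj]

end LDU

/-- Block decompositions of the values at two points of a matrix that satisfies the `RTT` relation,
the parity of an index depending on its block only. -/
structure RTTPair {β : ι → ℕ} (P : ℕ → ℕ) (c d : K) (G H : LDU β B) : Prop where
  parity : ∀ n, P n = 0 ∨ P n = 1
  rtt : RTT (P ∘ β) c d G.T H.T
  rtt_swap : RTT (P ∘ β) (-c) d H.T G.T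
  reg : ∀ x : B, c • x = 0 → x = 0

namespace RTTPair

variable {β : ι → ℕ} {P : ℕ → ℕ} {c d : K} {G H : LDU β B}

theorem hp (R : RTTPair P c d G H) (i : ι) : (P ∘ β) i = 0 ∨ (P ∘ β) i = 1 := R.parity _

/-- Invert, restrict to a principal submatrix, invert again: each step preserves `RTT`, and by
`LDU.sub_T'` the result is the product of the truncated factors. -/
theorem sub (R : RTTPair P c d G H) (a : ℕ) : RTTPair P c d (G.sub a) (H.sub a) := by
  have key : ∀ {c : K} {G H : LDU β B}, RTT (P ∘ β) c d G.T H.T →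
      RTT (P ∘ fun x : {x // a ≤ β x} => β x) c d (G.sub a).T (H.sub a).T := by
    intro c G H h
    have h1 := (h.inv R.hp H.mul_T' H.T'_mul G.mul_T' G.T'_mul).submatrix
      (Subtype.val : {x // a ≤ β x} → ι)
    change RTT _ c d (LDU.res β a H.T') (LDU.res β a G.T') at h1
    rw [← LDU.sub_T', ← LDU.sub_T'] at h1
    exact h1.inv (fun i => R.parity _) (G.sub a).T'_mul (G.sub a).mul_T' (H.sub a).T'_mul
      (H.sub a).mul_T'
  exact ⟨R.parity, key R.rtt, key R.rtt_swap, R.reg⟩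

/-- Leibniz rule for FDE. The three summands occupy disjoint block positions, so an equation for T
splits into equations for its factors. -/
theorem lie_decomp (G : LDU β B) (x : Matrix ι ι B) :
    G.F' * ⁅x, G.T⁆ * G.E' = G.F' * ⁅x, G.F⁆ * G.D + ⁅x, G.D⁆ + G.D * ⁅x, G.E⁆ * G.E' := by
  have e1 : G.F' * ⁅x, G.T⁆ * G.E'
      = G.F' * x * G.F * G.D * (G.E * G.E') - (G.F' * G.F) * G.D * G.E * x * G.E' := by
    unfold LDU.T; rw [Ring.lie_def]; noncomm_ring
  have e2 : G.F' * ⁅x, G.F⁆ * G.D + ⁅x, G.D⁆ + G.D * ⁅x, G.E⁆ * G.E'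
      = G.F' * x * G.F * G.D - (G.F' * G.F) * x * G.D + x * G.D - G.D * x
        + G.D * x * (G.E * G.E') - G.D * G.E * x * G.E' := by
    simp only [Ring.lie_def]; noncomm_ring
  rw [e1, e2, G.F'_mul, G.mul_E']
  noncomm_ring

theorem lie_tri {r : ℕ → ℕ → Prop} {p : ι → ℕ} {i₀ j₀ : ι} {x₀ : B} {M : Matrix ι ι B} (hM : Tri β r M) :
    Tri β r ⁅hat p i₀ j₀ x₀, M⁆ := by
  intro i j h
  simp [hat, Ring.lie_def, hM i j h]

/-- On and above the diagonal blocks F has the entries of the identity, which commute with a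
diagonal matrix. -/
theorem lie_F_tri (G : LDU β B) {p : ι → ℕ} {i₀ j₀ : ι} {x₀ : B} : Tri β (· > ·) ⁅hat p i₀ j₀ x₀, G.F⁆ := by
  intro i j h
  simp only [hat, Ring.lie_def, Matrix.sub_apply, diagonal_mul, mul_diagonal,
    G.triF i j (by omega), Matrix.one_apply]
  split_ifs with e
  · simp [e]
  · simp

theorem lie_E_tri (G : LDU β B) {p : ι → ℕ} {i₀ j₀ : ι} {x₀ : B} : Tri β (· < ·) ⁅hat p i₀ j₀ x₀, G.E⁆ := by
  intro i j h
  simp only [hat, Ring.lie_def, Matrix.sub_apply, diagonal_mul, mul_diagonal,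
    G.triE i j (by omega), Matrix.one_apply]
  split_ifs with e
  · simp [e]
  · simp

theorem F'_lie_F_D_tri (G : LDU β B) {p : ι → ℕ} {i₀ j₀ : ι} {x₀ : B} :
    Tri β (· > ·) (G.F' * ⁅hat p i₀ j₀ x₀, G.F⁆ * G.D) :=
  (G.F'_tri.mul (lie_F_tri G) (t := (· > ·)) (by intros; omega)).mul G.D_tri (by intros; omega)

theorem D_lie_E_E'_tri (G : LDU β B) {p : ι → ℕ} {i₀ j₀ : ι} {x₀ : B} :
    Tri β (· < ·) (G.D * ⁅hat p i₀ j₀ x₀, G.E⁆ * G.E') :=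
  (G.D_tri.mul (lie_E_tri G) (t := (· < ·)) (by intros; omega)).mul G.E'_tri (by intros; omega)

theorem conj_rtt (R : RTTPair P c d G H) (i j : ι) :
    c • (H.F' * ⁅hat (P ∘ β) i j (G.T i j), H.F⁆ * H.D)
      + c • ⁅hat (P ∘ β) i j (G.T i j), H.D⁆
      + c • (H.D * ⁅hat (P ∘ β) i j (G.T i j), H.E⁆ * H.E')
    = (d * (-1) ^ (P (β i) * P (β j))) •
      (H.F' * G.T * unit j i * H.F * H.D - H.D * H.E * unit j i * G.T * H.E') := by
  rw [← smul_add, ← smul_add, ← lie_decomp, ← smul_mul_assoc, ← mul_smul_comm, R.rtt i j,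
    mul_smul_comm, smul_mul_assoc]
  congr 1
  have : H.F' * (G.T * unit j i * H.T - H.T * unit j i * G.T) * H.E'
      = H.F' * G.T * unit j i * H.F * H.D * (H.E * H.E')
        - (H.F' * H.F) * H.D * H.E * unit j i * G.T * H.E' := by
    conv_lhs => rw [show H.T = H.F * H.D * H.E from rfl]
    noncomm_ring
  rw [this, H.mul_E', H.F'_mul, mul_one, one_mul]

theorem tri_split {L M U L₂ M₂ U₂ : Matrix ι ι B} (h : L + M + U = L₂ + M₂ + U₂)
    (hL : Tri β (· > ·) L) (hM : Tri β (· = ·) M) (hU : Tri β (· < ·) U)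
    (hL₂ : Tri β (· > ·) L₂) (hM₂ : Tri β (· = ·) M₂) (hU₂ : Tri β (· < ·) U₂) :
    L = L₂ ∧ M = M₂ ∧ U = U₂ := by
  have e : ∀ i j, L i j + M i j + U i j = L₂ i j + M₂ i j + U₂ i j :=
    fun i j => congrFun (congrFun h i) j
  refine ⟨?_, ?_, ?_⟩ <;> ext i j <;> have e' := e i j <;>
    rcases lt_trichotomy (β i) (β j) with hij | hij | hij
  · rw [hL i j (by omega), hL₂ i j (by omega)]
  · rw [hL i j (by omega), hL₂ i j (by omega)]
  · simpa [hM i j (by omega), hM₂ i j (by omega), hU i j (by omega), hU₂ i j (by omega)] using e'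
  · rw [hM i j (by omega), hM₂ i j (by omega)]
  · simpa [hL i j (by omega), hL₂ i j (by omega), hU i j (by omega), hU₂ i j (by omega)] using e'
  · rw [hM i j (by omega), hM₂ i j (by omega)]
  · simpa [hM i j (by omega), hM₂ i j (by omega), hL i j (by omega), hL₂ i j (by omega)] using e'
  · rw [hU i j (by omega), hU₂ i j (by omega)]
  · rw [hU i j (by omega), hU₂ i j (by omega)]

theorem smul_tri {r : ℕ → ℕ → Prop} (k : K) {M : Matrix ι ι B} (hM : Tri β r M) :
    Tri β r (k • M) := fun i j h => by rw [Matrix.smul_apply, hM i j h, smul_zero]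

theorem unit_tri {i j : ι} (h : β i = β j) : Tri β (· = ·) (unit j i : Matrix ι ι B) := by
  intro x y hxy
  refine single_apply_of_ne _ _ _ _ _ ?_
  rintro ⟨rfl, rfl⟩
  exact hxy h.symm

theorem F'_mul_F_sub_one_tri (G H : LDU β B) : Tri β (· > ·) (H.F' * G.F - 1) := by
  intro i j h
  have hij : β i ≤ β j := not_lt.1 h
  rw [Matrix.sub_apply, Matrix.mul_apply, Finset.sum_eq_single i]
  · rw [H.triF' i i le_rfl, G.triF i j hij]; simp
  · intro g _ hg
    rcases le_or_gt (β i) (β g) with h1 | h1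
    · rw [H.triF' i g h1, Matrix.one_apply_ne hg.symm, zero_mul]
    · rw [G.triF g j (by omega), LDU.one_ne (β := β) (by omega), mul_zero]
  · simp

theorem E_mul_E'_sub_one_tri (G H : LDU β B) : Tri β (· < ·) (G.E * H.E' - 1) := by
  intro i j h
  have hij : β j ≤ β i := not_lt.1 h
  rw [Matrix.sub_apply, Matrix.mul_apply, Finset.sum_eq_single i]
  · rw [G.triE i i le_rfl, H.triE' i j hij]; simp
  · intro g _ hg
    rcases le_or_gt (β g) (β i) with h1 | h1
    · rw [G.triE i g h1, Matrix.one_apply_ne hg.symm, zero_mul]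
    · rw [H.triE' g j (by omega), LDU.one_ne (β := β) (by omega), mul_zero]
  · simp

/-- The commutators of the first diagonal block with the three factors. -/
theorem lie_first (R : RTTPair P c d G H) {i j : ι} (hi : ∀ x, β i ≤ β x) (hij : β i = β j) :
    c • ⁅hat (P ∘ β) i j (G.T i j), H.F⁆
        = (d * (-1) ^ P (β i)) • ((G.F - H.F) * G.D * unit j i) ∧
    c • ⁅hat (P ∘ β) i j (G.T i j), H.D⁆
        = (d * (-1) ^ P (β i)) • (G.D * unit j i * H.D - H.D * unit j i * G.D) ∧
    c • ⁅hat (P ∘ β) i j (G.T i j), H.E⁆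
        = (d * (-1) ^ P (β i)) • (unit j i * G.D * (H.E - G.E)) := by
  have hj : ∀ x, β j ≤ β x := fun x => hij ▸ hi x
  have hsq : P (β i) * P (β j) = P (β i) := by
    rw [← hij]; rcases R.parity (β i) with h | h <;> simp [h]
  set κ := d * (-1 : K) ^ P (β i) with hκ
  have h0 := R.conj_rtt i j
  rw [hsq, ← hκ] at h0
  have e1 : H.F' * G.T * unit j i * H.F * H.D = H.F' * G.F * G.D * unit j i * H.D := by
    rw [mul_assoc H.F', G.T_mul_unit hj]
    calc _ = H.F' * (G.F * G.D) * (unit j i * H.F) * H.D := by noncomm_ring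
      _ = _ := by rw [H.unit_mul_F hi]; noncomm_ring
  have e2 : H.D * H.E * unit j i * G.T * H.E' = H.D * unit j i * G.D * G.E * H.E' := by
    rw [mul_assoc H.D, H.E_mul_unit hj, mul_assoc H.D, G.unit_mul_T hi]
    noncomm_ring
  -- Adding and subtracting block diagonal terms separates the right-hand side into strictly lower,
  -- diagonal and strictly upper parts.
  have e3 : κ • (H.F' * G.T * unit j i * H.F * H.D - H.D * H.E * unit j i * G.T * H.E')
      = κ • ((H.F' * G.F - 1) * G.D * unit j i * H.D)
        + κ • (G.D * unit j i * H.D - H.D * unit j i * G.D)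
        + κ • (H.D * unit j i * G.D * (1 - G.E * H.E')) := by
    rw [e1, e2, ← smul_add, ← smul_add]
    congr 1
    noncomm_ring
  rw [e3] at h0
  have hu := unit_tri (B := B) hij
  obtain ⟨a1, a2, a3⟩ := tri_split h0 (smul_tri c (F'_lie_F_D_tri H))
    (smul_tri c (lie_tri H.D_tri)) (smul_tri c (D_lie_E_E'_tri H))
    (smul_tri κ ((((F'_mul_F_sub_one_tri G H).mul G.D_tri (t := (· > ·)) (by intros; omega)).mul hu
      (t := (· > ·)) (by intros; omega)).mul H.D_tri (by intros; omega)))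
    (smul_tri κ (by
      intro x y hxy
      rw [Matrix.sub_apply,
        ((G.D_tri.mul hu (t := (· = ·)) (by intros; omega)).mul H.D_tri (t := (· = ·))
          (by intros; omega)) x y hxy,
        ((H.D_tri.mul hu (t := (· = ·)) (by intros; omega)).mul G.D_tri (t := (· = ·))
          (by intros; omega)) x y hxy, sub_zero]))
    (smul_tri κ (((H.D_tri.mul hu (t := (· = ·)) (by intros; omega)).mul G.D_tri (t := (· = ·))
      (by intros; omega)).mul (s := (· < ·)) (by
        intro x y hxy
        have := E_mul_E'_sub_one_tri G H x y hxy
        rw [← neg_sub, Matrix.neg_apply, this, neg_zero]) (by intros; omega)))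
  refine ⟨?_, a2, ?_⟩
  · have := congrArg (fun M => H.F * M * H.D') a1
    simp only [mul_smul_comm, smul_mul_assoc] at this
    have l1 : H.F * (H.F' * ⁅hat (P ∘ β) i j (G.T i j), H.F⁆ * H.D) * H.D'
        = ⁅hat (P ∘ β) i j (G.T i j), H.F⁆ := by
      calc _ = (H.F * H.F') * ⁅hat (P ∘ β) i j (G.T i j), H.F⁆ * (H.D * H.D') := by noncomm_ring
        _ = _ := by rw [H.mul_F', H.mul_D', one_mul, mul_one]
    have l2 : H.F * ((H.F' * G.F - 1) * G.D * unit j i * H.D) * H.D'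
        = (G.F - H.F) * G.D * unit j i := by
      calc _ = ((H.F * H.F') * G.F - H.F) * G.D * unit j i * (H.D * H.D') := by noncomm_ring
        _ = _ := by rw [H.mul_F', H.mul_D', one_mul, mul_one]
    rw [l1, l2] at this
    exact this
  · have := congrArg (fun M => H.D' * M * H.E) a3
    simp only [mul_smul_comm, smul_mul_assoc] at this
    have l1 : H.D' * (H.D * ⁅hat (P ∘ β) i j (G.T i j), H.E⁆ * H.E') * H.E
        = ⁅hat (P ∘ β) i j (G.T i j), H.E⁆ := by
      calc _ = (H.D' * H.D) * ⁅hat (P ∘ β) i j (G.T i j), H.E⁆ * (H.E' * H.E) := by noncomm_ring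
        _ = _ := by rw [H.D'_mul, H.E'_mul, one_mul, mul_one]
    have l2 : H.D' * (H.D * unit j i * G.D * (1 - G.E * H.E')) * H.E
        = unit j i * G.D * (H.E - G.E) := by
      calc _ = (H.D' * H.D) * unit j i * G.D * (H.E - G.E * (H.E' * H.E)) := by noncomm_ring
        _ = _ := by rw [H.D'_mul, H.E'_mul, one_mul, mul_one]
    rw [l1, l2] at this
    exact this

end RTTPair

end SuperRTT

/-! ### Commutators of the first block row of T with the factors. -/

namespace SuperRTT

open Matrix

namespace RTTPair

variable {ι : Type} [Fintype ι] [DecidableEq ι] {B : Type} [Ring B] {K : Type} [CommRing K]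
  [Algebra K B] {β : ι → ℕ} {P : ℕ → ℕ} {c d : K} {G H : LDU β B}

theorem _root_.SuperRTT.LDU.D_mul_E_apply (G : LDU β B) {h j : ι} (hj : β j ≤ β h) :
    (G.D * G.E) h j = G.D h j := by
  rw [Matrix.mul_apply, Finset.sum_eq_single j]
  · rw [G.triE j j le_rfl]; simp
  · intro g _ hg
    by_cases hb : β h = β g
    · rw [G.triE g j (by omega), Matrix.one_apply_ne hg, mul_zero]
    · rw [G.triD _ _ hb, zero_mul]
  · simp

theorem _root_.SuperRTT.LDU.T_apply (G : LDU β B) {i j : ι} (hi : ∀ x, β i ≤ β x) :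
    G.T i j = ∑ p, G.D i p * G.E p j := by
  have := congrFun (congrFun (G.unit_mul_T (j := i) hi) i) j
  rw [mul_assoc] at this
  simpa [unit, -mul_assoc, Matrix.mul_apply, single_apply] using this

theorem _root_.SuperRTT.LDU.T_eq_D (G : LDU β B) {i j : ι} (hi : ∀ x, β i ≤ β x)
    (hij : β i = β j) : G.T i j = G.D i j := by
  rw [G.T_apply hi, ← Matrix.mul_apply, G.D_mul_E_apply hij.ge]

theorem _root_.SuperRTT.LDU.D_E_E'_apply (G H : LDU β B) {i k : ι} (hi : ∀ x, β i ≤ β x)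
    (hk : β i = β k) : (G.D * G.E * H.E') i k = G.D i k := by
  have h1 := (G.D_tri.mul (E_mul_E'_sub_one_tri G H) (t := (· < ·)) (by intros; omega)) i k
    (by omega)
  rw [mul_sub, mul_one, ← mul_assoc, Matrix.sub_apply, sub_eq_zero] at h1
  exact h1

/-- For k outside the first block the first product on the right contains the vanishing entry `H.D i
k`, so a single product remains. In each block position at most one summand on the left survives,
which gives the next three lemmas. -/
theorem row_entry (R : RTTPair P c d G H) {i j h k : ι} (hi : ∀ x, β i ≤ β x) (hk : β i < β k) :
    c • (H.F' * ⁅hat (P ∘ β) i j (G.T i j), H.F⁆ * H.D) h k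
      + c • ⁅hat (P ∘ β) i j (G.T i j), H.D⁆ h k
      + c • (H.D * ⁅hat (P ∘ β) i j (G.T i j), H.E⁆ * H.E') h k
    = -((d * (-1) ^ (P (β i) * P (β j))) • ((H.D * H.E) h j * (G.D * G.E * H.E') i k)) := by
  have h0 := congrFun (congrFun (R.conj_rtt i j) h) k
  simp only [Matrix.add_apply, Matrix.smul_apply, Matrix.sub_apply] at h0
  rw [h0, ← smul_neg, mul_assoc (H.F' * G.T), H.unit_mul_F hi, mul_assoc (H.D * H.E),
    G.unit_mul_T hi]
  congr 1
  have e : H.D * H.E * (unit j i * G.D * G.E) * H.E'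
      = (H.D * H.E) * unit j i * (G.D * G.E * H.E') := by noncomm_ring
  rw [e, mul_unit_mul_apply, mul_unit_mul_apply, H.triD i k hk.ne, mul_zero, zero_sub]

theorem lie_D_row (R : RTTPair P c d G H) {i j h k : ι} (hi : ∀ x, β i ≤ β x) (hk : β i < β k)
    (hhk : β h = β k) :
    c • ⁅hat (P ∘ β) i j (G.T i j), H.D⁆ h k
    = -((d * (-1) ^ (P (β i) * P (β j))) • ((H.D * H.E) h j * (G.D * G.E * H.E') i k)) := by
  rw [← R.row_entry hi hk, F'_lie_F_D_tri H h k (by omega), D_lie_E_E'_tri H h k (by omega)]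
  simp

theorem D_lie_E_E'_row (R : RTTPair P c d G H) {i j h k : ι} (hi : ∀ x, β i ≤ β x)
    (hk : β i < β k) (hhk : β h < β k) :
    c • (H.D * ⁅hat (P ∘ β) i j (G.T i j), H.E⁆ * H.E') h k
    = -((d * (-1) ^ (P (β i) * P (β j))) • ((H.D * H.E) h j * (G.D * G.E * H.E') i k)) := by
  rw [← R.row_entry hi hk, F'_lie_F_D_tri H h k (by omega), lie_tri H.D_tri h k (by omega)]
  simp

theorem F'_lie_F_D_row (R : RTTPair P c d G H) {i j h k : ι} (hi : ∀ x, β i ≤ β x)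
    (hk : β i < β k) (hhk : β k < β h) :
    c • (H.F' * ⁅hat (P ∘ β) i j (G.T i j), H.F⁆ * H.D) h k
    = -((d * (-1) ^ (P (β i) * P (β j))) • ((H.D * H.E) h j * (G.D * G.E * H.E') i k)) := by
  rw [← R.row_entry hi hk, D_lie_E_E'_tri H h k (by omega), lie_tri H.D_tri h k (by omega)]
  simp

/-- The product on the right contains an entry of the upper triangular matrix DE strictly below the
diagonal blocks, hence vanishes; regularity of c then removes the scalar. -/
theorem lie_F_row (R : RTTPair P c d G H) {i j h k : ι} (hi : ∀ x, β i ≤ β x) (hk : β i < β k)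
    (hjk : β j ≤ β k) (hhk : β k < β h) :
    ⁅hat (P ∘ β) i j (G.T i j), H.F⁆ h k = 0 := by
  set x := hat (P ∘ β) i j (G.T i j) with hx
  have e : ⁅x, H.F⁆ = H.F * (H.F' * ⁅x, H.F⁆ * H.D) * H.D' := by
    calc _ = (H.F * H.F') * ⁅x, H.F⁆ * (H.D * H.D') := by rw [H.mul_F', H.mul_D']; simp
      _ = _ := by noncomm_ring
  rw [e, Matrix.mul_apply]
  refine Finset.sum_eq_zero fun l _ => ?_
  by_cases hl : β l = β k
  · rw [Matrix.mul_apply, Finset.sum_eq_zero, zero_mul]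
    intro g _
    rcases le_or_gt (β g) (β l) with hg | hg
    · rw [hx, F'_lie_F_D_tri H g l (by omega), mul_zero]
    · have := R.F'_lie_F_D_row (j := j) (h := g) (k := l) hi (by omega) hg
      rw [(H.D_tri.mul H.E_tri (t := (· ≤ ·)) (by intros; omega)) g j (by omega), zero_mul,
        smul_zero, neg_zero] at this
      rw [R.reg _ this, mul_zero]
  · rw [H.triD' _ _ hl, mul_zero]

/-- In [x,E'] = -E'D'(D[x,E]E') the left factor E'D' cancels the factor DE on the right-hand side.
This leaves a Kronecker delta: brackets with the inverse of E have a simpler closed form than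
brackets with E. -/
theorem lie_E'_row (R : RTTPair P c d G H) {i j h k : ι} (hi : ∀ x, β i ≤ β x) (hk : β i < β k)
    (hjk : β j < β k) :
    c • ⁅hat (P ∘ β) i j (G.T i j), H.E'⁆ h k
      = (d * (-1) ^ (P (β i) * P (β j))) • (if h = j then (G.D * G.E * H.E') i k else 0) := by
  set x := hat (P ∘ β) i j (G.T i j) with hx
  have e : ⁅x, H.E'⁆ = -((H.E' * H.D') * (H.D * ⁅x, H.E⁆ * H.E')) := by
    rw [SuperRTT.lie_inv H.mul_E' H.E'_mul]
    calc _ = -(H.E' * 1 * ⁅x, H.E⁆ * H.E') := by noncomm_ring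
      _ = _ := by rw [← H.D'_mul]; noncomm_ring
  rw [e, Matrix.neg_apply, Matrix.mul_apply, smul_neg, Finset.smul_sum]
  have hg : ∀ g, c • ((H.E' * H.D') h g * (H.D * ⁅x, H.E⁆ * H.E') g k)
      = -((d * (-1) ^ (P (β i) * P (β j))) •
        (((H.E' * H.D') h g * (H.D * H.E) g j) * (G.D * G.E * H.E') i k)) := by
    intro g
    rcases le_or_gt (β k) (β g) with hg | hg
    · rw [hx, D_lie_E_E'_tri H g k (by omega),
        (H.D_tri.mul H.E_tri (t := (· ≤ ·)) (by intros; omega)) g j (by omega)]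
      simp
    · rw [← mul_smul_comm, R.D_lie_E_E'_row hi hk hg, mul_neg, mul_smul_comm, ← mul_assoc]
  rw [Finset.sum_congr rfl fun g _ => hg g, Finset.sum_neg_distrib, neg_neg, ← Finset.smul_sum,
    ← Finset.sum_mul, ← Matrix.mul_apply]
  have : H.E' * H.D' * (H.D * H.E) = 1 := by
    rw [mul_assoc, ← mul_assoc H.D', H.D'_mul, one_mul, H.E'_mul]
  rw [this, Matrix.one_apply]
  split_ifs <;> simp

theorem lie_E_row (R : RTTPair P c d G H) {i j h l : ι} (hi : ∀ x, β i ≤ β x) (hh : β h = β i) :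
    c • ⁅hat (P ∘ β) i j (G.T i j), H.E⁆ h l
      = (d * (-1) ^ (P (β i) * P (β j))) • (H.E h j * (G.D * (H.E - G.E)) i l) := by
  set x := hat (P ∘ β) i j (G.T i j) with hx
  have e : ⁅x, H.E⁆ = H.D' * ((H.D * ⁅x, H.E⁆ * H.E') * H.E) := by
    calc _ = (H.D' * H.D) * ⁅x, H.E⁆ * (H.E' * H.E) := by rw [H.D'_mul, H.E'_mul]; simp
      _ = _ := by noncomm_ring
  -- Subtracting `G.D` makes the formula hold for every k: inside the first block both sides vanish,
  -- outside it the correction is zero.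
  have hg : ∀ g, β g = β i → ∀ k, c • (H.D * ⁅x, H.E⁆ * H.E') g k
      = -((d * (-1) ^ (P (β i) * P (β j))) •
        ((H.D * H.E) g j * (G.D * G.E * H.E' - G.D) i k)) := by
    intro g hg k
    rcases (hi k).eq_or_lt with hk | hk
    · rw [hx, D_lie_E_E'_tri H g k (by omega), Matrix.sub_apply, LDU.D_E_E'_apply G H hi hk]
      simp
    · rw [R.D_lie_E_E'_row hi hk (by omega), Matrix.sub_apply, G.triD i k hk.ne, sub_zero]
  have hg2 : ∀ g, β g = β i → c • ((H.D * ⁅x, H.E⁆ * H.E') * H.E) g l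
      = (d * (-1) ^ (P (β i) * P (β j))) • ((H.D * H.E) g j * (G.D * (H.E - G.E)) i l) := by
    intro g hgi
    rw [Matrix.mul_apply, Finset.smul_sum]
    have : ∀ k, c • ((H.D * ⁅x, H.E⁆ * H.E') g k * H.E k l)
        = -((d * (-1) ^ (P (β i) * P (β j))) •
          ((H.D * H.E) g j * ((G.D * G.E * H.E' - G.D) i k * H.E k l))) := by
      intro k
      rw [← smul_mul_assoc, hg g hgi k, neg_mul, smul_mul_assoc, mul_assoc]
    rw [Finset.sum_congr rfl fun k _ => this k, Finset.sum_neg_distrib, ← Finset.smul_sum,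
      ← Finset.mul_sum, ← Matrix.mul_apply, ← smul_neg, ← mul_neg, ← Matrix.neg_apply]
    congr 3
    have : -((G.D * G.E * H.E' - G.D) * H.E) = G.D * H.E - G.D * G.E * (H.E' * H.E) := by
      noncomm_ring
    rw [this, H.E'_mul]; noncomm_ring
  have e' : ⁅x, H.E⁆ h l = ∑ g, H.D' h g * ((H.D * ⁅x, H.E⁆ * H.E') * H.E) g l := by
    rw [← Matrix.mul_apply, ← e]
  rw [e', Finset.smul_sum]
  have : ∀ g, c • (H.D' h g * ((H.D * ⁅x, H.E⁆ * H.E') * H.E) g l)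
      = (d * (-1) ^ (P (β i) * P (β j))) •
        (H.D' h g * (H.D * H.E) g j * (G.D * (H.E - G.E)) i l) := by
    intro g
    by_cases hgh : β h = β g
    · rw [← mul_smul_comm, hg2 g (by omega), mul_smul_comm, mul_assoc]
    · rw [H.triD' _ _ hgh]; simp
  rw [Finset.sum_congr rfl fun k _ => this k, ← Finset.smul_sum, ← Finset.sum_mul,
    ← Matrix.mul_apply, ← mul_assoc, H.D'_mul, one_mul]

/-- By `hadj` the block of h immediately follows the first one. Row h of F then consists of entries
in the first block and of the identity, so multiplying a strictly lower matrix by F on the left does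
not change its row h. -/
theorem lie_F_first_col (R : RTTPair P c d G H) {i j h k : ι} (hi : ∀ x, β i ≤ β x)
    (hk : β k = β i) (hih : β i < β h) (hhj : β h = β j)
    (hadj : ∀ x, β i < β x → β h ≤ β x) :
    c • ⁅hat (P ∘ β) i j (G.T i j), H.F⁆ h k
      = (d * (-1) ^ (P (β i) * P (β j))) •
        ((if i = k then (H.F' * G.T) h j else 0) - H.D h j * (G.D * H.D') i k) := by
  set x := hat (P ∘ β) i j (G.T i j) with hx
  have e : ⁅x, H.F⁆ = H.F * (H.F' * ⁅x, H.F⁆ * H.D) * H.D' := by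
    calc _ = (H.F * H.F') * ⁅x, H.F⁆ * (H.D * H.D') := by rw [H.mul_F', H.mul_D']; simp
      _ = _ := by noncomm_ring
  have hl : ∀ l, β l = β i → c • (H.F * (H.F' * ⁅x, H.F⁆ * H.D)) h l
      = (d * (-1) ^ (P (β i) * P (β j))) • ((H.F' * G.T) h j * H.D i l - H.D h j * G.D i l) := by
    intro l hl
    have h1 : (H.F * (H.F' * ⁅x, H.F⁆ * H.D)) h l = (H.F' * ⁅x, H.F⁆ * H.D) h l := by
      rw [Matrix.mul_apply, Finset.sum_eq_single h]
      · rw [H.triF h h le_rfl]; simp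
      · intro g _ hg
        rcases (hi g).eq_or_lt with h2 | h2
        · rw [hx, F'_lie_F_D_tri H g l (by omega), mul_zero]
        · rw [H.triF h g (hadj g h2), Matrix.one_apply_ne hg.symm, zero_mul]
      · simp
    have h0 := congrFun (congrFun (R.conj_rtt i j) h) l
    simp only [Matrix.add_apply, Matrix.smul_apply, Matrix.sub_apply] at h0
    rw [← hx] at h0
    rw [hx, D_lie_E_E'_tri H h l (by omega), ← hx, hx, lie_tri H.D_tri h l (by omega), ← hx,
      smul_zero, add_zero, add_zero, mul_assoc (H.F' * G.T), H.unit_mul_F hi,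
      mul_assoc (H.D * H.E), G.unit_mul_T hi] at h0
    have e : H.D * H.E * (unit j i * G.D * G.E) * H.E'
        = (H.D * H.E) * unit j i * (G.D * G.E * H.E') := by noncomm_ring
    rw [h1, h0, e, mul_unit_mul_apply, mul_unit_mul_apply, LDU.D_E_E'_apply G H hi hl.symm,
      H.D_mul_E_apply hhj.ge]
  have e' : ⁅x, H.F⁆ h k = ∑ l, (H.F * (H.F' * ⁅x, H.F⁆ * H.D)) h l * H.D' l k := by
    rw [← Matrix.mul_apply, ← e]
  rw [e', Finset.smul_sum]
  have : ∀ l, c • ((H.F * (H.F' * ⁅x, H.F⁆ * H.D)) h l * H.D' l k)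
      = (d * (-1) ^ (P (β i) * P (β j))) •
        ((H.F' * G.T) h j * (H.D i l * H.D' l k) - H.D h j * (G.D i l * H.D' l k)) := by
    intro l
    by_cases hlk : β l = β k
    · rw [← smul_mul_assoc, hl l (by omega), smul_mul_assoc, sub_mul, mul_assoc, mul_assoc]
    · rw [H.triD' _ _ hlk]; simp
  rw [Finset.sum_congr rfl fun k _ => this k, ← Finset.smul_sum, Finset.sum_sub_distrib,
    ← Finset.mul_sum, ← Finset.mul_sum, ← Matrix.mul_apply, ← Matrix.mul_apply, H.mul_D',
    Matrix.one_apply]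
  split_ifs <;> simp

end RTTPair

end SuperRTT

/-! ### Cancelling D: commutators of the first block row of E. -/

namespace SuperRTT

open Matrix

namespace RTTPair

variable {ι : Type} [Fintype ι] [DecidableEq ι] {B : Type} [Ring B] {K : Type} [CommRing K]
  [Algebra K B] {β : ι → ℕ} {P : ℕ → ℕ} {c d : K} {G H : LDU β B}

/-- Multiplication by D' solves the linear system, and it stays inside the block since D' is block
diagonal. -/
theorem _root_.SuperRTT.LDU.strip (G : LDU β B) {a : ℕ} {y : ι → B}
    (h : ∀ i, β i = a → ∑ p, G.D i p * y p = 0) {p : ι} (hp : β p = a) : y p = 0 := by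
  have h1 : ∑ i, G.D' p i * ∑ q, G.D i q * y q = y p := by
    simp only [Finset.mul_sum, ← mul_assoc]
    rw [Finset.sum_comm]
    simp only [← Finset.sum_mul, ← Matrix.mul_apply, G.D'_mul, Matrix.one_apply]
    simp
  rw [← h1]
  refine Finset.sum_eq_zero fun i _ => ?_
  by_cases hi : β p = β i
  · rw [h i (by omega), mul_zero]
  · rw [G.triD' _ _ hi, zero_mul]

theorem _root_.SuperRTT.LDU.strip_eq (G : LDU β B) {a : ℕ} {y z : ι → B}
    (h : ∀ i, β i = a → ∑ p, G.D i p * y p = ∑ p, G.D i p * z p) {p : ι} (hp : β p = a) :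
    y p = z p := by
  rw [← sub_eq_zero]
  refine G.strip (a := a) (y := fun p => y p - z p) (fun i hi => ?_) hp
  simp only [mul_sub, Finset.sum_sub_distrib, h i hi, sub_self]

theorem lie_hat_even {p : ι → ℕ} {i j : ι} (h : p i = p j) (x : B) (M : Matrix ι ι B) (h' k : ι) :
    ⁅hat p i j x, M⁆ h' k = x * M h' k - M h' k * x := by
  rw [Ring.lie_def, Matrix.sub_apply, hat_apply_mul, mul_hat_apply, h, ← two_mul]
  simp [mul_assoc, pow_mul]

/-- Leibniz rule for T_ij = ∑ D_ip E_pj. The second sum vanishes when the first block of D commutes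
with the given entry of M; otherwise it is evaluated from the brackets in `lie_first`. -/
theorem lie_strip (hP : ∀ n, P n = 0 ∨ P n = 1) (G : LDU β B) {i j : ι} (hi : ∀ x, β i ≤ β x)
    (M : Matrix ι ι B) (h k : ι) :
    ⁅hat (P ∘ β) i j (G.T i j), M⁆ h k
      = ∑ p, G.D i p * ⁅hat (P ∘ β) p j (G.E p j), M⁆ h k
        + ∑ p, (G.D i p * M h k - M h k * G.D i p)
            * ((-1) ^ ((P (β p) + P (β j)) * P (β k)) * G.E p j) := by
  have e : ⁅hat (P ∘ β) i j (G.T i j), M⁆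
      = ∑ p, (hat (P ∘ β) i p (G.D i p) * ⁅hat (P ∘ β) p j (G.E p j), M⁆
        + ⁅hat (P ∘ β) i p (G.D i p), M⁆ * hat (P ∘ β) p j (G.E p j)) := by
    rw [G.T_apply hi, hat_sum, Ring.lie_def, Finset.sum_mul, Finset.mul_sum,
      ← Finset.sum_sub_distrib]
    refine Finset.sum_congr rfl fun p _ => ?_
    rw [← hat_mul (p := P ∘ β) (fun _ => hP _) i p j]
    simp only [Ring.lie_def]
    noncomm_ring
  rw [e, Matrix.sum_apply, ← Finset.sum_add_distrib]
  refine Finset.sum_congr rfl fun p _ => ?_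
  rw [Matrix.add_apply, hat_apply_mul, mul_hat_apply]
  by_cases hip : β i = β p
  · have h2 : (P ∘ β) i = (P ∘ β) p := congrArg P hip
    rw [lie_hat_even h2, h2, ← two_mul]
    simp [mul_assoc, pow_mul]
  · rw [G.triD _ _ hip]
    simp [hat, Ring.lie_def]

theorem first_comm_D_D (R : RTTPair P c d G H) {i j : ι} (hi : ∀ x, β i ≤ β x) (hij : β i = β j)
    (h k : ι) :
    c • (G.D i j * H.D h k - H.D h k * G.D i j)
      = (d * (-1) ^ P (β i)) • (G.D h j * H.D i k - H.D h j * G.D i k) := by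
  have h0 := congrFun (congrFun (R.lie_first hi hij).2.1 h) k
  rw [Matrix.smul_apply, Matrix.smul_apply, lie_hat_even (p := P ∘ β) (congrArg P hij), Matrix.sub_apply,
    mul_unit_mul_apply, mul_unit_mul_apply, G.T_eq_D hi hij] at h0
  exact h0

theorem first_comm_D_E (R : RTTPair P c d G H) {i j : ι} (hi : ∀ x, β i ≤ β x) (hij : β i = β j)
    (h k : ι) :
    c • (G.D i j * H.E h k - H.E h k * G.D i j)
      = (d * (-1) ^ P (β i)) • (if h = j then (G.D * (H.E - G.E)) i k else 0) := by
  have h0 := congrFun (congrFun (R.lie_first hi hij).2.2 h) k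
  rw [Matrix.smul_apply, Matrix.smul_apply, lie_hat_even (p := P ∘ β) (congrArg P hij), G.T_eq_D hi hij] at h0
  rw [h0, mul_assoc, Matrix.mul_apply]
  congr 1
  split_ifs with e
  · subst e; simp [unit, single_apply]
  · simp [unit, single_apply, Ne.symm e]

theorem first_comm_D_F (R : RTTPair P c d G H) {i j : ι} (hi : ∀ x, β i ≤ β x) (hij : β i = β j)
    (h k : ι) :
    c • (G.D i j * H.F h k - H.F h k * G.D i j)
      = (d * (-1) ^ P (β i)) • (if i = k then ((G.F - H.F) * G.D) h j else 0) := by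
  have h0 := congrFun (congrFun (R.lie_first hi hij).1 h) k
  rw [Matrix.smul_apply, Matrix.smul_apply, lie_hat_even (p := P ∘ β) (congrArg P hij), G.T_eq_D hi hij] at h0
  rw [h0, Matrix.mul_apply]
  congr 1
  split_ifs with e
  · subst e; simp [unit, single_apply]
  · simp [unit, single_apply, e]

theorem first_comm_D_D_of_lt (R : RTTPair P c d G H) {i j : ι} (hi : ∀ x, β i ≤ β x) (hij : β i = β j)
    {h k : ι} (hh : β i < β h) : G.D i j * H.D h k = H.D h k * G.D i j := by
  have := R.first_comm_D_D hi hij h k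
  rw [G.triD h j (by omega), H.triD h j (by omega), zero_mul, zero_mul, sub_zero, smul_zero] at this
  exact sub_eq_zero.1 (R.reg _ this)

theorem first_comm_D_E_of_lt (R : RTTPair P c d G H) {i j : ι} (hi : ∀ x, β i ≤ β x) (hij : β i = β j)
    {h k : ι} (hh : β i < β h) : G.D i j * H.E h k = H.E h k * G.D i j := by
  have := R.first_comm_D_E hi hij h k
  rw [if_neg (by rintro rfl; omega), smul_zero] at this
  exact sub_eq_zero.1 (R.reg _ this)

theorem first_comm_D_F_of_lt (R : RTTPair P c d G H) {i j : ι} (hi : ∀ x, β i ≤ β x) (hij : β i = β j)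
    {h k : ι} (hh : β i < β k) : G.D i j * H.F h k = H.F h k * G.D i j := by
  have := R.first_comm_D_F hi hij h k
  rw [if_neg (by rintro rfl; omega), smul_zero] at this
  exact sub_eq_zero.1 (R.reg _ this)

theorem first_comm_D_E'_of_lt (R : RTTPair P c d G H) {i j : ι} (hi : ∀ x, β i ≤ β x) (hij : β i = β j)
    {h k : ι} (hh : β i < β h) : G.D i j * H.E' h k = H.E' h k * G.D i j := by
  have h1 : c • ⁅hat (P ∘ β) i j (G.T i j), H.E'⁆ h k = 0 := by
    rw [SuperRTT.lie_inv H.mul_E' H.E'_mul, Matrix.neg_apply, smul_neg, neg_eq_zero,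
      ← Matrix.smul_apply, ← smul_mul_assoc, ← mul_smul_comm, (R.lie_first hi hij).2.2,
      mul_smul_comm, smul_mul_assoc, Matrix.smul_apply]
    have e : H.E' * (unit j i * G.D * (H.E - G.E)) * H.E'
        = H.E' * unit j i * (G.D * (H.E - G.E) * H.E') := by noncomm_ring
    rw [e, mul_unit_mul_apply, H.triE' h j (by omega), LDU.one_ne (β := β) (by omega), zero_mul,
      smul_zero]
  rw [lie_hat_even (p := P ∘ β) (congrArg P hij), G.T_eq_D hi hij] at h1
  exact sub_eq_zero.1 (R.reg _ h1)

/-- The supercommutators of the first block row of `E` with the later blocks of `D`. -/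
theorem first_lie_E_D (R : RTTPair P c d G H) {p j h k : ι} (hp : ∀ x, β p ≤ β x) (hk : β p < β k)
    (hhk : β h = β k) (hj : β j ≤ β h) :
    c • ⁅hat (P ∘ β) p j (G.E p j), H.D⁆ h k
      = -((d * (-1) ^ (P (β p) * P (β j))) • (H.D h j * (G.E * H.E') p k)) := by
  refine G.strip_eq (a := β p) (y := fun p => c • ⁅hat (P ∘ β) p j (G.E p j), H.D⁆ h k)
    (z := fun p' => -((d * (-1) ^ (P (β p) * P (β j))) • (H.D h j * (G.E * H.E') p' k)))
    (fun i hip => ?_) rfl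
  have hi : ∀ x, β i ≤ β x := fun x => hip ▸ hp x
  have h0 := R.lie_D_row (j := j) hi (by omega) hhk
  rw [lie_strip R.parity G hi, H.D_mul_E_apply hj, Finset.sum_eq_zero (f := fun p =>
    (G.D i p * H.D h k - H.D h k * G.D i p) * _), add_zero, Finset.smul_sum, hip] at h0
  · simp only [mul_smul_comm, mul_neg] at h0 ⊢
    rw [h0, mul_assoc, Matrix.mul_apply, Finset.mul_sum, Finset.smul_sum, ← Finset.sum_neg_distrib]
    refine Finset.sum_congr rfl fun q _ => ?_
    by_cases hq : β i = β q
    · rw [← mul_assoc, ← mul_assoc, R.first_comm_D_D_of_lt hi hq (by omega)]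
    · rw [G.triD _ _ hq]; simp
  · intro q _
    by_cases hq : β i = β q
    · rw [R.first_comm_D_D_of_lt hi hq (by omega), sub_self, zero_mul]
    · rw [G.triD _ _ hq]; simp

/-- The bracket with E', rather than E, is the source of the relations between neighbouring blocks,
of the cubic and of the quartic ones: between adjacent blocks E' is just -E. -/
theorem first_lie_E_E' (R : RTTPair P c d G H) {p j h k : ι} (hp : ∀ x, β p ≤ β x) (hk : β j < β k)
    (hh : β p < β h) :
    c • ⁅hat (P ∘ β) p j (G.E p j), H.E'⁆ h k
      = (d * (-1) ^ (P (β p) * P (β j))) • (if h = j then (G.E * H.E') p k else 0) := by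
  refine G.strip_eq (a := β p) (y := fun p => c • ⁅hat (P ∘ β) p j (G.E p j), H.E'⁆ h k)
    (z := fun p' => (d * (-1) ^ (P (β p) * P (β j))) • (if h = j then (G.E * H.E') p' k else 0))
    (fun i hip => ?_) rfl
  have hi : ∀ x, β i ≤ β x := fun x => hip ▸ hp x
  have h0 := R.lie_E'_row (h := h) (j := j) hi (by have := hi j; omega) hk
  rw [lie_strip R.parity G hi, Finset.sum_eq_zero (f := fun p =>
    (G.D i p * H.E' h k - H.E' h k * G.D i p) * _), add_zero, Finset.smul_sum, hip] at h0
  · simp only [mul_smul_comm] at h0 ⊢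
    rw [h0, ← Finset.smul_sum]
    congr 1
    split_ifs
    · rw [mul_assoc, Matrix.mul_apply]
    · simp
  · intro q _
    by_cases hq : β i = β q
    · rw [R.first_comm_D_E'_of_lt hi hq (by omega), sub_self, zero_mul]
    · rw [G.triD _ _ hq]; simp

theorem first_lie_E_F_eq_zero (R : RTTPair P c d G H) {p j h k : ι} (hp : ∀ x, β p ≤ β x)
    (hk : β p < β k) (hj : β j ≤ β k) (hhk : β k < β h) :
    ⁅hat (P ∘ β) p j (G.E p j), H.F⁆ h k = 0 := by
  refine G.strip (a := β p) (y := fun p => ⁅hat (P ∘ β) p j (G.E p j), H.F⁆ h k)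
    (fun i hip => ?_) rfl
  have hi : ∀ x, β i ≤ β x := fun x => hip ▸ hp x
  have h0 := R.lie_F_row (j := j) hi (by omega) hj hhk
  rw [lie_strip R.parity G hi, Finset.sum_eq_zero (f := fun p =>
    (G.D i p * H.F h k - H.F h k * G.D i p) * _), add_zero] at h0
  · exact h0
  · intro q _
    by_cases hq : β i = β q
    · rw [R.first_comm_D_F_of_lt hi hq (by omega), sub_self, zero_mul]
    · rw [G.triD _ _ hq]; simp

/-- Here D does not commute with the entry of F, and its contribution turns the term F'(v)T(u) of
`lie_F_first_col` into the single entry `G.D h j`. -/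
theorem first_lie_E_F (R : RTTPair P c d G H) {p j h k : ι} (hp : ∀ x, β p ≤ β x)
    (hk : β k = β p) (hph : β p < β h) (hhj : β h = β j) (hadj : ∀ x, β p < β x → β h ≤ β x) :
    c • ⁅hat (P ∘ β) p j (G.E p j), H.F⁆ h k
      = (d * (-1) ^ (P (β p) * P (β j))) • (G.D' p k * G.D h j - H.D h j * H.D' p k) := by
  refine G.strip_eq (a := β p) (y := fun p => c • ⁅hat (P ∘ β) p j (G.E p j), H.F⁆ h k)
    (z := fun p' => (d * (-1) ^ (P (β p) * P (β j))) •
      (G.D' p' k * G.D h j - H.D h j * H.D' p' k)) (fun i hip => ?_) rfl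
  have hi : ∀ x, β i ≤ β x := fun x => hip ▸ hp x
  have h0 := R.lie_F_first_col (j := j) (h := h) (k := k) hi (by omega) (by omega) hhj
    (fun x hx => hadj x (by omega))
  have e1 : ∀ q, β q = β p → ((G.F - H.F) * G.D) h q = ((H.F' * G.F - 1) * G.D) h q := by
    intro q hq
    have : G.F - H.F = H.F * (H.F' * G.F - 1) := by
      rw [mul_sub, ← mul_assoc, H.mul_F']; simp
    rw [this, mul_assoc, Matrix.mul_apply, Finset.sum_eq_single h]
    · rw [H.triF h h le_rfl]; simp
    · intro g _ hg
      rcases (hp g).eq_or_lt with h2 | h2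
      · rw [((F'_mul_F_sub_one_tri G H).mul G.D_tri (t := (· > ·)) (by intros; omega)) g q
          (by omega), mul_zero]
      · rw [H.triF h g (hadj g h2), Matrix.one_apply_ne hg.symm, zero_mul]
    · simp
  have e2 : ∀ q, β q ≠ β p → ((H.F' * G.F - 1) * G.D) h q = 0 := by
    intro q hq
    have := hp q
    have := hadj q (by omega)
    exact ((F'_mul_F_sub_one_tri G H).mul G.D_tri (t := (· > ·)) (by intros; omega)) h q
      (by omega)
  have e3 : ∑ q, ((H.F' * G.F - 1) * G.D) h q * G.E q j = (H.F' * G.T) h j - G.D h j := by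
    rw [← Matrix.mul_apply, ← G.D_mul_E_apply hhj.ge, ← Matrix.sub_apply, LDU.T]
    congr 2
    noncomm_ring
  have h1 : ∑ q, c • ((G.D i q * H.F h k - H.F h k * G.D i q)
        * ((-1) ^ ((P (β q) + P (β j)) * P (β k)) * G.E q j))
      = (d * (-1) ^ (P (β p) * P (β j))) • (if i = k then (H.F' * G.T) h j - G.D h j else 0) := by
    have h2 : ∀ q, c • ((G.D i q * H.F h k - H.F h k * G.D i q)
        * ((-1) ^ ((P (β q) + P (β j)) * P (β k)) * G.E q j))
        = (d * (-1) ^ (P (β p) * P (β j))) •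
          (if i = k then ((H.F' * G.F - 1) * G.D) h q * G.E q j else 0) := by
      intro q
      by_cases hq : β q = β p
      · rw [← smul_mul_assoc, R.first_comm_D_F hi (by omega), e1 q hq, hq, hk, hip]
        split_ifs
        · rw [smul_mul_assoc, mul_smul, mul_smul, neg_one_pow_smul, neg_one_pow_smul,
            ← mul_assoc _ _ (G.E q j), (Commute.neg_one_right _).pow_right _ |>.eq, mul_assoc,
            ← mul_assoc, ← pow_add]
          congr 2
          rcases R.parity (β p) with h | h <;> rcases R.parity (β j) with h' | h' <;>
            simp [h, h', neg_one_pow_three]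
        · simp
      · rw [e2 q hq, G.triD i q (by omega)]; simp
    rw [Finset.sum_congr rfl fun q _ => h2 q, ← Finset.smul_sum]
    congr 1
    split_ifs
    · exact e3
    · simp
  rw [lie_strip R.parity G hi, smul_add, Finset.smul_sum, Finset.smul_sum, hip, h1,
    ← eq_sub_iff_add_eq, ← smul_sub] at h0
  simp only [mul_smul_comm] at h0 ⊢
  rw [h0, ← Finset.smul_sum]
  congr 1
  -- The Kronecker delta is written as an entry of DD' to expose a left factor D; on the other term
  -- this factor moves past `H.D h j`, which lies in a later block.
  have h3 : ∑ q, G.D i q * (G.D' q k * G.D h j - H.D h j * H.D' q k)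
      = (if i = k then 1 else 0) * G.D h j - H.D h j * (G.D * H.D') i k := by
    have : (if i = k then 1 else 0 : B) = (G.D * G.D') i k := by
      rw [G.mul_D', Matrix.one_apply]
    rw [this, Matrix.mul_apply, Matrix.mul_apply, Finset.sum_mul, Finset.mul_sum,
      ← Finset.sum_sub_distrib]
    refine Finset.sum_congr rfl fun q _ => ?_
    by_cases hq : β i = β q
    · rw [mul_sub, ← mul_assoc, ← mul_assoc, ← mul_assoc,
        R.first_comm_D_D_of_lt hi hq (by omega)]
    · rw [G.triD _ _ hq]; simp
  rw [h3]
  split_ifs <;> simp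

/-- One factor c is already in `lie_E_row`. The second one pays for moving an entry of D past `H.E h
j`, which is needed before D can be cancelled. Hence c appears squared, and it is not visible yet
that the right-hand side is divisible by c. -/
theorem first_lie_E_E (R : RTTPair P c d G H) {p j h l : ι} (hp : ∀ x, β p ≤ β x)
    (hh : β h = β p) :
    c • c • ⁅hat (P ∘ β) p j (G.E p j), H.E⁆ h l
      = (c * (d * (-1) ^ (P (β p) * P (β j)))) • (H.E h j * (H.E - G.E) p l)
        - (d * (-1) ^ (P (β p) * P (β j)) * (d * (-1) ^ P (β p))) •
          ((H.E - G.E) p j * (H.E - G.E) h l)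
        - (c * (d * (-1) ^ P (β p)) * (-1) ^ ((P (β p) + P (β j)) * P (β l))) •
          ((H.E - G.E) p l * G.E h j) := by
  refine G.strip_eq (a := β p)
    (y := fun p => c • c • ⁅hat (P ∘ β) p j (G.E p j), H.E⁆ h l)
    (z := fun p' => (c * (d * (-1) ^ (P (β p) * P (β j)))) • (H.E h j * (H.E - G.E) p' l)
        - (d * (-1) ^ (P (β p) * P (β j)) * (d * (-1) ^ P (β p))) •
          ((H.E - G.E) p' j * (H.E - G.E) h l)
        - (c * (d * (-1) ^ P (β p)) * (-1) ^ ((P (β p) + P (β j)) * P (β l))) •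
          ((H.E - G.E) p' l * G.E h j)) (fun i hip => ?_) rfl
  have hi : ∀ x, β i ≤ β x := fun x => hip ▸ hp x
  have h0 := R.lie_E_row (j := j) (h := h) (l := l) hi (by omega)
  have e1 : ∑ q, c • ((G.D i q * H.E h l - H.E h l * G.D i q)
        * ((-1) ^ ((P (β q) + P (β j)) * P (β l)) * G.E q j))
      = (d * (-1) ^ P (β p) * (-1) ^ ((P (β p) + P (β j)) * P (β l))) •
        ((G.D * (H.E - G.E)) i l * G.E h j) := by
    rw [Finset.sum_eq_single h]
    · rw [← smul_mul_assoc, R.first_comm_D_E hi (by omega), if_pos rfl, hip, hh, smul_mul_assoc,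
        ← neg_one_pow_smul (K := K), mul_smul_comm, smul_smul]
    · intro q _ hq
      by_cases hiq : β i = β q
      · rw [← smul_mul_assoc, R.first_comm_D_E hi hiq, if_neg (Ne.symm hq), smul_zero, zero_mul]
      · rw [G.triD _ _ hiq]; simp
    · simp
  have e2 : c • (H.E h j * (G.D * (H.E - G.E)) i l)
      = c • ∑ q, G.D i q * (H.E h j * (H.E - G.E) q l)
        - (d * (-1) ^ P (β p)) • ((G.D * (H.E - G.E)) i j * (H.E - G.E) h l) := by
    rw [eq_sub_iff_add_eq, ← eq_sub_iff_add_eq', ← smul_sub, Matrix.mul_apply (i := i) (k := l),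
      Finset.mul_sum, ← Finset.sum_sub_distrib, Finset.smul_sum, Finset.sum_eq_single h]
    · rw [← mul_assoc, ← mul_assoc, ← sub_mul, ← smul_mul_assoc c, R.first_comm_D_E hi (by omega),
        if_pos rfl, hip, smul_mul_assoc]
    · intro q _ hq
      by_cases hiq : β i = β q
      · rw [← mul_assoc, ← mul_assoc, ← sub_mul, ← smul_mul_assoc c, R.first_comm_D_E hi hiq,
          if_neg (Ne.symm hq), smul_zero, zero_mul]
      · rw [G.triD _ _ hiq]; simp
    · simp
  rw [lie_strip R.parity G hi, smul_add, Finset.smul_sum (s := Finset.univ)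
    (f := fun q => (G.D i q * H.E h l - H.E h l * G.D i q) * _), e1, hip,
    ← eq_sub_iff_add_eq] at h0
  have h1 := congrArg (c • ·) h0
  simp only [smul_sub] at h1
  rw [smul_comm c (d * _), e2] at h1
  simp only [mul_smul_comm, mul_sub, Finset.sum_sub_distrib, ← Finset.smul_sum]
  rw [h1, smul_sub, smul_smul, smul_smul, smul_smul, Matrix.mul_apply, Matrix.mul_apply,
    mul_comm c (d * _), mul_assoc c]
  congr 2
  · simp only [Finset.sum_mul, mul_assoc]
  · simp only [Finset.sum_mul, mul_assoc]

end RTTPair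

end SuperRTT

/-! ### Transfer from the first block row to an arbitrary one by truncation. -/

namespace SuperRTT

open Matrix

namespace RTTPair

variable {ι : Type} [Fintype ι] [DecidableEq ι] {B : Type} [Ring B] {K : Type} [CommRing K]
  [Algebra K B] {β : ι → ℕ} {P : ℕ → ℕ} {c d : K} {G H : LDU β B}

theorem lie_hat_res {a : ℕ} (i j h k : {x // a ≤ β x}) (x : B) (M : Matrix ι ι B) :
    ⁅hat (P ∘ fun x : {x // a ≤ β x} => β x) i j x, LDU.res β a M⁆ h k
      = ⁅hat (P ∘ β) (i : ι) j x, M⁆ h k := by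
  simp only [Ring.lie_def, Matrix.sub_apply, hat_apply_mul, mul_hat_apply]
  rfl

theorem comm_D_D (R : RTTPair P c d G H) {i j h k : ι} (hij : β i = β j) (hh : β h = β i)
    (hk : β k = β i) :
    c • (G.D i j * H.D h k - H.D h k * G.D i j)
      = (d * (-1) ^ P (β i)) • (G.D h j * H.D i k - H.D h j * G.D i k) :=
  (R.sub (β i)).first_comm_D_D (i := ⟨i, le_rfl⟩) (j := ⟨j, hij.le⟩) (fun x => x.2) hij
    ⟨h, hh.ge⟩ ⟨k, hk.ge⟩

theorem comm_D_D_of_lt (R : RTTPair P c d G H) {i j h k : ι} (hij : β i = β j) (hh : β i < β h)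
    (hk : β i < β k) : G.D i j * H.D h k = H.D h k * G.D i j :=
  (R.sub (β i)).first_comm_D_D_of_lt (i := ⟨i, le_rfl⟩) (j := ⟨j, hij.le⟩) (fun x => x.2) hij
    (h := ⟨h, hh.le⟩) (k := ⟨k, hk.le⟩) hh

theorem comm_D_E (R : RTTPair P c d G H) {i j h k : ι} (hij : β i = β j) (hh : β h = β i)
    (hk : β i ≤ β k) :
    c • (G.D i j * H.E h k - H.E h k * G.D i j)
      = (d * (-1) ^ P (β i)) • (if h = j then (G.D * (H.E - G.E)) i k else 0) := by
  have h0 := (R.sub (β i)).first_comm_D_E (i := ⟨i, le_rfl⟩) (j := ⟨j, hij.le⟩) (fun x => x.2) hij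
    ⟨h, hh.ge⟩ ⟨k, hk⟩
  have h1 : (G.sub (β i)).D * ((H.sub (β i)).E - (G.sub (β i)).E)
      = LDU.res β (β i) (G.D * (H.E - G.E)) := by
    rw [LDU.res_mul_upper (G.D_tri.mono fun _ _ h => h.le)]; rfl
  rw [h1] at h0
  exact h0.trans (by simp)

theorem comm_D_E_of_lt (R : RTTPair P c d G H) {i j h k : ι} (hij : β i = β j) (hh : β i < β h)
    (hk : β i ≤ β k) : G.D i j * H.E h k = H.E h k * G.D i j :=
  (R.sub (β i)).first_comm_D_E_of_lt (i := ⟨i, le_rfl⟩) (j := ⟨j, hij.le⟩) (fun x => x.2) hij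
    (h := ⟨h, hh.le⟩) (k := ⟨k, hk⟩) hh

theorem lie_E_D (R : RTTPair P c d G H) {p j h k : ι} (hk : β p < β k) (hhk : β h = β k)
    (hpj : β p ≤ β j) (hj : β j ≤ β h) :
    c • ⁅hat (P ∘ β) p j (G.E p j), H.D⁆ h k
      = -((d * (-1) ^ (P (β p) * P (β j))) • (H.D h j * (G.E * H.E') p k)) := by
  have h0 := (R.sub (β p)).first_lie_E_D (p := ⟨p, le_rfl⟩) (j := ⟨j, hpj⟩)
    (h := ⟨h, hhk ▸ hk.le⟩) (k := ⟨k, hk.le⟩) (fun x => x.2) hk hhk hj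
  have h1 : (G.sub (β p)).E * (H.sub (β p)).E' = LDU.res β (β p) (G.E * H.E') := by
    rw [LDU.res_mul_upper G.E_tri]; rfl
  rw [h1] at h0
  rw [← lie_hat_res (a := β p) ⟨p, le_rfl⟩ ⟨j, hpj⟩ ⟨h, hhk ▸ hk.le⟩ ⟨k, hk.le⟩]
  exact h0

theorem lie_E_E' (R : RTTPair P c d G H) {p j h k : ι} (hpj : β p ≤ β j) (hk : β j < β k)
    (hh : β p < β h) :
    c • ⁅hat (P ∘ β) p j (G.E p j), H.E'⁆ h k
      = (d * (-1) ^ (P (β p) * P (β j))) • (if h = j then (G.E * H.E') p k else 0) := by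
  have h0 := (R.sub (β p)).first_lie_E_E' (p := ⟨p, le_rfl⟩) (j := ⟨j, hpj⟩)
    (h := ⟨h, hh.le⟩) (k := ⟨k, hpj.trans hk.le⟩) (fun x => x.2) hk hh
  have h1 : (G.sub (β p)).E * (H.sub (β p)).E' = LDU.res β (β p) (G.E * H.E') := by
    rw [LDU.res_mul_upper G.E_tri]; rfl
  rw [h1] at h0
  rw [← lie_hat_res (a := β p) ⟨p, le_rfl⟩ ⟨j, hpj⟩ ⟨h, hh.le⟩ ⟨k, hpj.trans hk.le⟩]
  exact h0.trans (by simp)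

theorem lie_E_F_eq_zero (R : RTTPair P c d G H) {p j h k : ι} (hpj : β p ≤ β j)
    (hk : β p < β k) (hj : β j ≤ β k) (hhk : β k < β h) :
    ⁅hat (P ∘ β) p j (G.E p j), H.F⁆ h k = 0 := by
  rw [← lie_hat_res (a := β p) ⟨p, le_rfl⟩ ⟨j, hpj⟩ ⟨h, by omega⟩ ⟨k, hk.le⟩]
  exact (R.sub (β p)).first_lie_E_F_eq_zero (p := ⟨p, le_rfl⟩) (j := ⟨j, hpj⟩)
    (h := ⟨h, by omega⟩) (k := ⟨k, hk.le⟩) (fun x => x.2) hk hj hhk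

theorem lie_E_F (R : RTTPair P c d G H) {p j h k : ι}
    (hk : β k = β p) (hph : β p < β h) (hhj : β h = β j) (hadj : ∀ x, β p < β x → β h ≤ β x) :
    c • ⁅hat (P ∘ β) p j (G.E p j), H.F⁆ h k
      = (d * (-1) ^ (P (β p) * P (β j))) • (G.D' p k * G.D h j - H.D h j * H.D' p k) := by
  rw [← lie_hat_res (a := β p) ⟨p, le_rfl⟩ ⟨j, by omega⟩ ⟨h, by omega⟩ ⟨k, hk.ge⟩]
  exact (R.sub (β p)).first_lie_E_F (p := ⟨p, le_rfl⟩) (j := ⟨j, by omega⟩)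
    (h := ⟨h, by omega⟩) (k := ⟨k, hk.ge⟩) (fun x => x.2) hk hph hhj fun x hx => hadj x hx

theorem lie_E_E (R : RTTPair P c d G H) {p j h l : ι} (hpj : β p ≤ β j) (hpl : β p ≤ β l)
    (hh : β h = β p) :
    c • c • ⁅hat (P ∘ β) p j (G.E p j), H.E⁆ h l
      = (c * (d * (-1) ^ (P (β p) * P (β j)))) • (H.E h j * (H.E - G.E) p l)
        - (d * (-1) ^ (P (β p) * P (β j)) * (d * (-1) ^ P (β p))) •
          ((H.E - G.E) p j * (H.E - G.E) h l)
        - (c * (d * (-1) ^ P (β p)) * (-1) ^ ((P (β p) + P (β j)) * P (β l))) •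
          ((H.E - G.E) p l * G.E h j) := by
  rw [← lie_hat_res (a := β p) ⟨p, le_rfl⟩ ⟨j, by omega⟩ ⟨h, by omega⟩ ⟨l, by omega⟩]
  exact (R.sub (β p)).first_lie_E_E (p := ⟨p, le_rfl⟩) (j := ⟨j, by omega⟩)
    (h := ⟨h, by omega⟩) (l := ⟨l, by omega⟩) (fun x => x.2) hh

end RTTPair

end SuperRTT

/-! ### Series in two variables -/

namespace SuperRTT

open Matrix PowerSeries

section Center

variable {A : Type} [Ring A]

theorem X_mem_center : (X : A⟦X⟧) ∈ Subring.center A⟦X⟧ := by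
  rw [Subring.mem_center_iff]
  exact fun g => (PowerSeries.commute_X g).eq

theorem C_mem_center {a : A} (h : a ∈ Subring.center A) :
    (C a : A⟦X⟧) ∈ Subring.center A⟦X⟧ := by
  rw [Subring.mem_center_iff] at h ⊢
  intro g
  ext n
  rw [coeff_mul_C, coeff_C_mul, h]

/-- The element `v⁻¹ - u⁻¹` of the series in `v⁻¹` (inner variable) and `u⁻¹` (outer variable). -/
noncomputable def diffC (A : Type) [Ring A] : Subring.center A⟦X⟧⟦X⟧ :=
  ⟨C X - X, Subring.sub_mem _ (C_mem_center X_mem_center) X_mem_center⟩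

/-- The element `κ u⁻¹ v⁻¹`. -/
noncomputable def prodC (A : Type) [Ring A] (κ : ℤ) : Subring.center A⟦X⟧⟦X⟧ :=
  κ • (⟨X * C X, Subring.mul_mem _ X_mem_center (C_mem_center X_mem_center)⟩ :
    Subring.center A⟦X⟧⟦X⟧)

/-- The series in `u⁻¹`. -/
noncomputable abbrev outer (A : Type) [Ring A] : A⟦X⟧ →+* A⟦X⟧⟦X⟧ := PowerSeries.map C

/-- The series in `v⁻¹`. -/
noncomputable abbrev inner (A : Type) [Ring A] : A⟦X⟧ →+* A⟦X⟧⟦X⟧ := C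

theorem diffC_smul (Z : A⟦X⟧⟦X⟧) : diffC A • Z = C X * Z - X * Z := by
  rw [← sub_mul]; rfl

theorem prodC_smul (κ : ℤ) (W : A⟦X⟧⟦X⟧) : prodC A κ • W = κ • (X * (C X * W)) := by
  rw [← mul_assoc]
  change (κ • (X * C X)) * W = _
  rw [smul_mul_assoc]

theorem coeff_X_mul (r : ℕ) (Z : A⟦X⟧) : coeff r (X * Z) = if r = 0 then 0 else coeff (r - 1) Z := by
  rcases r with _ | r
  · simp
  · simp [coeff_succ_X_mul]

theorem coeff_diffC_smul (r s : ℕ) (Z : A⟦X⟧⟦X⟧) : coeff s (coeff r (diffC A • Z))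
    = (if s = 0 then 0 else coeff (s - 1) (coeff r Z))
      - (if r = 0 then 0 else coeff s (coeff (r - 1) Z)) := by
  rw [diffC_smul, map_sub, map_sub, coeff_C_mul, coeff_X_mul, coeff_X_mul]
  split_ifs <;> simp

theorem coeff_prodC_smul (κ : ℤ) (r s : ℕ) (W : A⟦X⟧⟦X⟧) : coeff s (coeff r (prodC A κ • W))
    = κ • if r = 0 ∨ s = 0 then 0 else coeff (s - 1) (coeff (r - 1) W) := by
  rw [prodC_smul, map_zsmul, map_zsmul, coeff_X_mul]
  congr 1
  split_ifs with h1 h2 h2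
  · simp
  · omega
  · rw [coeff_C_mul, coeff_X_mul, if_pos (h2.resolve_left h1)]
  · rw [coeff_C_mul, coeff_X_mul, if_neg (by tauto)]

/-- Coefficientwise a relation with factor v⁻¹ - u⁻¹ is a difference equation along the lines r + s
= const. The factor u⁻¹v⁻¹ on the right has no terms with r = 0 or s = 0, whence the two boundary
conditions. -/
theorem diffC_smul_eq_iff (κ : ℤ) (Z W : A⟦X⟧⟦X⟧) : diffC A • Z = prodC A κ • W ↔
    (∀ s, coeff s (coeff 0 Z) = 0) ∧ (∀ r, coeff 0 (coeff r Z) = 0) ∧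
      ∀ r s, coeff s (coeff (r + 1) Z) - coeff (s + 1) (coeff r Z)
        = κ • coeff s (coeff r W) := by
  have e : diffC A • Z = prodC A κ • W ↔
      ∀ r s, coeff s (coeff r (diffC A • Z)) = coeff s (coeff r (prodC A κ • W)) :=
    ⟨fun h => by simp [h], fun h => PowerSeries.ext fun r => PowerSeries.ext fun s => h r s⟩
  rw [e]
  simp only [coeff_diffC_smul, coeff_prodC_smul]
  constructor
  · intro h
    refine ⟨fun s => ?_, fun r => ?_, fun r s => ?_⟩
    · simpa using h 0 (s + 1)
    · simpa using h (r + 1) 0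
    · simpa using h (r + 1) (s + 1)
  · rintro ⟨h1, h2, h3⟩ r s
    rcases r with _ | r <;> rcases s with _ | s
    · simp
    · simpa using h1 s
    · simpa using h2 r
    · simpa using h3 r s

/-- Induction on the power of u⁻¹: once the lower coefficients vanish, the next one is annihilated
by v⁻¹, which is regular. -/
theorem diffC_smul_eq_zero {Z : A⟦X⟧⟦X⟧} (h : diffC A • Z = 0) : Z = 0 := by
  rw [diffC_smul, sub_eq_zero] at h
  have : ∀ r, coeff r Z = 0 := by
    intro r
    induction r with
    | zero =>
      have := congrArg (coeff 0) h
      rw [coeff_C_mul] at this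
      ext s
      simpa [coeff_succ_X_mul] using congrArg (coeff (s + 1)) this
    | succ r ih =>
      have := congrArg (coeff (r + 1)) h
      rw [coeff_C_mul, coeff_succ_X_mul, ih] at this
      ext s
      simpa [coeff_succ_X_mul] using congrArg (coeff (s + 1)) this
  ext r s
  simp [this]

theorem coeff_outer_mul_inner (r s : ℕ) (f g : A⟦X⟧) :
    coeff s (coeff r (outer A f * inner A g)) = coeff r f * coeff s g := by
  rw [coeff_mul_C, coeff_map, coeff_C_mul]

theorem coeff_inner_mul_outer (r s : ℕ) (f g : A⟦X⟧) :
    coeff s (coeff r (inner A g * outer A f)) = coeff s g * coeff r f := by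
  rw [coeff_C_mul, coeff_map, coeff_mul_C]

theorem neg_one_pow_mul_eq_smul {R : Type} [Ring R] (n : ℕ) (x : R) :
    (-1) ^ n * x = ((-1 : ℤ) ^ n) • x := (neg_one_pow_smul n x).symm

theorem coeff_neg_one_pow_mul (n r : ℕ) (f : A⟦X⟧) :
    coeff r ((-1) ^ n * f) = (-1) ^ n * coeff r f := by
  rw [neg_one_pow_mul_eq_smul, neg_one_pow_mul_eq_smul, map_zsmul]

theorem coeff_sc_outer_inner (e r s : ℕ) (f g : A⟦X⟧) :
    coeff s (coeff r (sc e (outer A f) (inner A g))) = sc e (coeff r f) (coeff s g) := by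
  rw [sc, map_sub, map_sub, coeff_outer_mul_inner, coeff_neg_one_pow_mul, coeff_neg_one_pow_mul,
    coeff_inner_mul_outer, sc]

theorem coeff_sc_inner_outer (e r s : ℕ) (f g : A⟦X⟧) :
    coeff s (coeff r (sc e (inner A g) (outer A f))) = sc e (coeff s g) (coeff r f) := by
  rw [sc, map_sub, map_sub, coeff_inner_mul_outer, coeff_neg_one_pow_mul, coeff_neg_one_pow_mul,
    coeff_outer_mul_inner, sc]

end Center

variable {ι : Type} [Fintype ι] [DecidableEq ι] {A : Type} [Ring A]

/-- The `RTT` relation with parameter `κ` for the coefficients of a matrix of series. -/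
structure Rel (p : ι → ℕ) (κ : ℤ) (T : Matrix ι ι A⟦X⟧) : Prop where
  zero_left : ∀ i j h k s,
    sc ((p i + p j) * (p h + p k)) (coeff 0 (T i j)) (coeff s (T h k)) = 0
  zero_right : ∀ i j h k r,
    sc ((p i + p j) * (p h + p k)) (coeff r (T i j)) (coeff 0 (T h k)) = 0
  comm : ∀ i j h k r s,
    sc ((p i + p j) * (p h + p k)) (coeff (r + 1) (T i j)) (coeff s (T h k))
      - sc ((p i + p j) * (p h + p k)) (coeff r (T i j)) (coeff (s + 1) (T h k))
    = κ • ((-1) ^ (p i * p j + p i * p h + p j * p h)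
      * (coeff r (T h j) * coeff s (T i k) - coeff s (T h j) * coeff r (T i k)))

theorem RTT.entries {B K : Type} [Ring B] [CommRing K] [Algebra K B] {p : ι → ℕ}
    (hp : ∀ i, p i = 0 ∨ p i = 1) {c d : K} {T U : Matrix ι ι B} (H : RTT p c d T U)
    (i j h k : ι) : c • sc ((p i + p j) * (p h + p k)) (T i j) (U h k)
      = d • ((-1) ^ (p i * p j + p i * p h + p j * p h) * (T h j * U i k - U h j * T i k)) := by
  have h0 := congrFun (congrFun (H i j) h) k
  rw [Matrix.smul_apply, Matrix.smul_apply, Matrix.sub_apply, mul_unit_mul_apply,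
    mul_unit_mul_apply, mul_smul, neg_one_pow_smul] at h0
  rw [sc_eq_lie_hat hp, ← mul_smul_comm, h0, mul_smul_comm, ← mul_assoc, ← pow_add]
  congr 2
  rcases hp i with hi | hi <;> rcases hp j with hj | hj <;> rcases hp h with hh | hh <;>
    simp [hi, hj, hh, neg_one_pow_three, neg_one_pow_five]

theorem Rel.rtt {p : ι → ℕ} (hp : ∀ i, p i = 0 ∨ p i = 1) {κ : ℤ} {T : Matrix ι ι A⟦X⟧}
    (H : Rel p κ T) :
    RTT p (diffC A) (prodC A κ) (T.map (outer A)) (T.map (inner A)) := by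
  refine RTT.of_entries hp fun i j h k => (diffC_smul_eq_iff _ _ _).2 ⟨fun s => ?_, fun r => ?_,
    fun r s => ?_⟩
  · exact (coeff_sc_outer_inner _ _ _ _ _).trans (H.zero_left i j h k s)
  · exact (coeff_sc_outer_inner _ _ _ _ _).trans (H.zero_right i j h k r)
  · simp only [Matrix.map_apply, coeff_sc_outer_inner]
    rw [H.comm, coeff_neg_one_pow_mul, coeff_neg_one_pow_mul, map_sub, map_sub,
      coeff_outer_mul_inner, coeff_inner_mul_outer]

theorem Rel.rtt_swap {p : ι → ℕ} (hp : ∀ i, p i = 0 ∨ p i = 1) {κ : ℤ} {T : Matrix ι ι A⟦X⟧}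
    (H : Rel p κ T) :
    RTT p (-diffC A) (prodC A κ) (T.map (inner A)) (T.map (outer A)) := by
  refine RTT.of_entries hp fun i j h k => ?_
  rw [neg_smul, ← smul_neg]
  refine (diffC_smul_eq_iff _ _ _).2 ⟨fun s => ?_, fun r => ?_, fun r s => ?_⟩
  · simp only [Matrix.map_apply, map_neg, coeff_sc_inner_outer, H.zero_right, neg_zero]
  · simp only [Matrix.map_apply, map_neg, coeff_sc_inner_outer, H.zero_left, neg_zero]
  · simp only [Matrix.map_apply, map_neg, coeff_sc_inner_outer]
    rw [neg_sub_neg, H.comm, coeff_neg_one_pow_mul, coeff_neg_one_pow_mul, map_sub, map_sub,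
      coeff_outer_mul_inner, coeff_inner_mul_outer]

/-- The inverse matrix satisfies the relation with the opposite parameter. -/
theorem Rel.inv {p : ι → ℕ} (hp : ∀ i, p i = 0 ∨ p i = 1) {κ : ℤ} {T T' : Matrix ι ι A⟦X⟧}
    (H : Rel p κ T) (h1 : T * T' = 1) (h2 : T' * T = 1) : Rel p (-κ) T' := by
  have m1 : ∀ f : A⟦X⟧ →+* A⟦X⟧⟦X⟧, T.map f * T'.map f = 1 := fun f => by
    rw [← Matrix.map_mul, h1, Matrix.map_one _ (map_zero f) (map_one f)]
  have m2 : ∀ f : A⟦X⟧ →+* A⟦X⟧⟦X⟧, T'.map f * T.map f = 1 := fun f => by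
    rw [← Matrix.map_mul, h2, Matrix.map_one _ (map_zero f) (map_one f)]
  have key := fun i j h k => (diffC_smul_eq_iff _ _ _).1
    (((H.rtt hp).inv hp (m1 _) (m2 _) (m1 _) (m2 _)).entries hp i j h k)
  refine ⟨fun i j h k s => ?_, fun i j h k r => ?_, fun i j h k r s => ?_⟩
  · have := (key i j h k).2.1 s
    simpa only [Matrix.map_apply, coeff_sc_inner_outer] using this
  · have := (key i j h k).1 r
    simpa only [Matrix.map_apply, coeff_sc_inner_outer] using this
  -- Inversion exchanges u and v. Hence r and s are interchanged here, and κ becomes -κ.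
  · have := (key i j h k).2.2 s r
    simp only [Matrix.map_apply, coeff_sc_inner_outer] at this
    rw [coeff_neg_one_pow_mul, coeff_neg_one_pow_mul, map_sub, map_sub,
      coeff_outer_mul_inner, coeff_inner_mul_outer] at this
    rw [← neg_sub, this, neg_smul]

theorem Rel.rttPair {β : ι → ℕ} {P : ℕ → ℕ} (hP : ∀ n, P n = 0 ∨ P n = 1) {κ : ℤ}
    {G : LDU β A⟦X⟧} (H : Rel (P ∘ β) κ G.T) :
    RTTPair P (diffC A) (prodC A κ) (G.map (outer A)) (G.map (inner A)) where
  parity := hP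
  rtt := by rw [LDU.map_T, LDU.map_T]; exact H.rtt fun _ => hP _
  rtt_swap := by rw [LDU.map_T, LDU.map_T]; exact H.rtt_swap fun _ => hP _
  reg _ := diffC_smul_eq_zero

end SuperRTT

/-! ### Relations between the coefficients of the factors -/

namespace SuperRTT

open Matrix PowerSeries

theorem sc_zero {A : Type} [Ring A] (x y : A) : sc 0 x y = x * y - y * x := by
  simp [sc]

theorem telescope_left {A : Type} [AddCommGroup A] {z w : ℕ → ℕ → A} (h0 : ∀ s, z 0 s = 0)
    (h : ∀ r s, z (r + 1) s - z r (s + 1) = w r s) (r s : ℕ) :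
    z r s = ∑ t ∈ Finset.range r, w t (r + s - 1 - t) := by
  induction r generalizing s with
  | zero => simp [h0]
  | succ r ih =>
    rw [sub_eq_iff_eq_add.1 (h r s), ih, Finset.sum_range_succ, add_comm]
    congr 1
    · refine Finset.sum_congr rfl fun t _ => ?_
      congr 1; omega
    · congr 1; omega

theorem telescope_right {A : Type} [AddCommGroup A] {z w : ℕ → ℕ → A} (h0 : ∀ r, z r 0 = 0)
    (h : ∀ r s, z (r + 1) s - z r (s + 1) = w r s) (r s : ℕ) :
    z r s = -∑ t ∈ Finset.range s, w (r + s - 1 - t) t := by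
  rw [telescope_left (z := fun s r => z r s) (w := fun s r => -w r s) h0
    (fun s r => by rw [← h r s, neg_sub]) s r, Finset.sum_neg_distrib, add_comm]

/-- Telescoping runs towards the nearer of the two boundaries; antisymmetry of w brings both
resulting sums to the same form. -/
theorem telescope_min {A : Type} [AddCommGroup A] {z w : ℕ → ℕ → A} (h0 : ∀ s, z 0 s = 0)
    (h0' : ∀ r, z r 0 = 0) (h : ∀ r s, z (r + 1) s - z r (s + 1) = w r s)
    (hw : ∀ r s, w r s = -w s r) (r s : ℕ) :
    z r s = ∑ t ∈ Finset.range (min r s), w t (r + s - 1 - t) := by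
  rcases le_total r s with hrs | hrs
  · rw [min_eq_left hrs, telescope_left h0 h]
  · rw [min_eq_right hrs, telescope_right h0' h, ← Finset.sum_neg_distrib]
    exact Finset.sum_congr rfl fun t _ => (hw _ _).symm

/-- Induction on m + n. On a given antidiagonal the recursion kills all the entries with m ≥ 2,
because σ is applied to entries of smaller degree. For m = 1, σ(g 1 n) equals f 2 n, which lies on
the next antidiagonal; there f is constant for m ≥ 2 by what was just shown, and its last value has
second index 0, hence vanishes. Injectivity of σ ends the argument. -/
theorem double_seq_eq_zero {A : Type} [AddCommGroup A] {σ : A →+ A} (hσ : ∀ x, σ x = 0 → x = 0)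
    {f g : ℕ → ℕ → A} (hf0 : ∀ n, f 0 n = 0) (hf0' : ∀ m, f m 0 = 0) (hf2 : ∀ n, f 2 n = σ (g 1 n))
    (hf : ∀ m n, f (m + 3) n = f (m + 2) (n + 1) + σ (g (m + 2) n))
    (hg0 : ∀ n, g 0 n = 0) (hg0' : ∀ m, g m 0 = 0) (hg2 : ∀ n, g 2 n = σ (f 1 n))
    (hg : ∀ m n, g (m + 3) n = g (m + 2) (n + 1) + σ (f (m + 2) n)) (m n : ℕ) : f m n = 0 := by
  have key : ∀ N, ∀ m n, m + n = N → f m n = 0 ∧ g m n = 0 := by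
    intro N
    induction N with
    | zero =>
      intro m n h
      obtain ⟨rfl, rfl⟩ : m = 0 ∧ n = 0 := by omega
      exact ⟨hf0 0, hg0 0⟩
    | succ N ih =>
      have big : ∀ m n, m + n = N + 1 → 2 ≤ m → f m n = 0 ∧ g m n = 0 := by
        intro m
        induction m with
        | zero => omega
        | succ m ihm =>
          intro n hmn hm
          rcases m with _ | _ | m
          · omega
          · rw [hf2, hg2, (ih 1 n (by omega)).1, (ih 1 n (by omega)).2, map_zero]
            exact ⟨rfl, rfl⟩
          · rw [hf, hg, (ihm (n + 1) (by omega) (by omega)).1,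
              (ihm (n + 1) (by omega) (by omega)).2, (ih (m + 2) n (by omega)).1,
              (ih (m + 2) n (by omega)).2, map_zero, add_zero]
            exact ⟨rfl, rfl⟩
      -- On the next antidiagonal the correction terms have degree N + 1 and first index at least 2,
      -- so `big` removes them.
      have chain : ∀ m n, m + n = N → f (m + 2) n = f 2 N ∧ g (m + 2) n = g 2 N := by
        intro m
        induction m with
        | zero => intro n h; obtain rfl : n = N := by omega
                  exact ⟨rfl, rfl⟩
        | succ m ihm =>
          intro n h
          rw [hf, hg, (big (m + 2) n (by omega) (by omega)).1,
            (big (m + 2) n (by omega) (by omega)).2, map_zero, add_zero, add_zero]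
          exact ihm _ (by omega)
      intro m n hmn
      rcases m with _ | _ | m
      · exact ⟨hf0 n, hg0 n⟩
      · obtain rfl : n = N := by omega
        refine ⟨hσ _ ?_, hσ _ ?_⟩
        · rw [← hg2, ← (chain n 0 rfl).2, hg0']
        · rw [← hf2, ← (chain n 0 rfl).1, hf0']
      · exact big _ _ hmn (by omega)
  exact (key _ m n rfl).1

variable {ι : Type} [Fintype ι] [DecidableEq ι] {A : Type} [Ring A]

theorem coeff_of_sc {κ : ℤ} {e n : ℕ} {f g : A⟦X⟧} {W : A⟦X⟧⟦X⟧}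
    (H : diffC A • sc e (outer A f) (inner A g) = (prodC A κ * (-1) ^ n) • W) :
    (∀ s, sc e (coeff 0 f) (coeff s g) = 0) ∧ (∀ r, sc e (coeff r f) (coeff 0 g) = 0) ∧
      ∀ r s, sc e (coeff (r + 1) f) (coeff s g) - sc e (coeff r f) (coeff (s + 1) g)
        = κ • ((-1) ^ n * coeff s (coeff r W)) := by
  rw [mul_smul, neg_one_pow_smul] at H
  simpa only [coeff_sc_outer_inner, coeff_neg_one_pow_mul] using (diffC_smul_eq_iff _ _ _).1 H

theorem smul_sc_of_lie {B K : Type} [Ring B] [CommRing K] [Algebra K B] {p : ι → ℕ}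
    (hp : ∀ i, p i = 0 ∨ p i = 1) {i j h k : ι} {x : B} {M : Matrix ι ι B} {W : B} {c d : K}
    (H : c • ⁅hat p i j x, M⁆ h k = d • W) :
    c • sc ((p i + p j) * (p h + p k)) x (M h k) = (d * (-1) ^ ((p i + p j) * p h)) • W := by
  rw [sc_eq_lie_hat hp, ← mul_smul_comm, H, mul_smul_comm, mul_smul, neg_one_pow_smul]

variable {β : ι → ℕ} {P : ℕ → ℕ} (hP : ∀ n, P n = 0 ∨ P n = 1) {κ : ℤ} {G : LDU β A⟦X⟧}
  (H : Rel (P ∘ β) κ G.T)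

include hP H

theorem Rel.D_D {i j h k : ι} (hij : β i = β j) (hh : β h = β i) (hk : β k = β i) (r s : ℕ) :
    sc 0 (coeff r (G.D i j)) (coeff s (G.D h k))
      = κ • ((-1) ^ P (β i) * ∑ t ∈ Finset.range (min r s),
          (coeff t (G.D h j) * coeff (r + s - 1 - t) (G.D i k)
            - coeff (r + s - 1 - t) (G.D h j) * coeff t (G.D i k))) := by
  have h0 := (H.rttPair hP).comm_D_D hij hh hk
  have h1 : diffC A • sc 0 (outer A (G.D i j)) (inner A (G.D h k)) = (prodC A κ * (-1) ^ P (β i)) •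
      (outer A (G.D h j) * inner A (G.D i k) - inner A (G.D h j) * outer A (G.D i k)) := by
    rw [sc_zero]; exact h0
  obtain ⟨z1, z2, z3⟩ := coeff_of_sc h1
  simp only [map_sub, coeff_outer_mul_inner, coeff_inner_mul_outer] at z3
  rw [telescope_min (z := fun r s => sc 0 (coeff r (G.D i j)) (coeff s (G.D h k))) z1 z2 z3,
    ← Finset.smul_sum, ← Finset.mul_sum]
  intro r s
  rw [← smul_neg, ← mul_neg, neg_sub]

theorem Rel.D_D_of_ne {i j h k : ι} (hij : β i = β j) (hhk : β h = β k) (hh : β i ≠ β h)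
    (r s : ℕ) : coeff r (G.D i j) * coeff s (G.D h k) = coeff s (G.D h k) * coeff r (G.D i j) := by
  rcases lt_or_gt_of_ne hh with hh | hh
  · have h0 := (H.rttPair hP).comm_D_D_of_lt hij hh (hhk ▸ hh)
    have := congrArg (fun Z => coeff s (coeff r Z)) h0
    change coeff s (coeff r (outer A _ * inner A _)) = coeff s (coeff r (inner A _ * outer A _))
      at this
    rwa [coeff_outer_mul_inner, coeff_inner_mul_outer] at this
  · have h0 := (H.rttPair hP).comm_D_D_of_lt hhk hh (hij ▸ hh)
    have := congrArg (fun Z => coeff r (coeff s Z)) h0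
    change coeff r (coeff s (outer A _ * inner A _)) = coeff r (coeff s (inner A _ * outer A _))
      at this
    rw [coeff_outer_mul_inner, coeff_inner_mul_outer] at this
    exact this.symm

theorem Rel.D_E_of_lt {i j h k : ι} (hij : β i = β j) (hh : β i < β h) (hk : β i ≤ β k)
    (r s : ℕ) : coeff r (G.D i j) * coeff s (G.E h k) = coeff s (G.E h k) * coeff r (G.D i j) := by
  have h0 := (H.rttPair hP).comm_D_E_of_lt hij hh hk
  have := congrArg (fun Z => coeff s (coeff r Z)) h0
  change coeff s (coeff r (outer A _ * inner A _)) = coeff s (coeff r (inner A _ * outer A _))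
    at this
  rwa [coeff_outer_mul_inner, coeff_inner_mul_outer] at this

theorem Rel.D_E {i j h k : ι} (hij : β i = β j) (hh : β h = β i) (hk : β i < β k) (r s : ℕ)
    (hs : 1 ≤ s) :
    sc 0 (coeff r (G.D i j)) (coeff s (G.E h k))
      = if h = j then κ • ((-1) ^ P (β i) * ∑ t ∈ Finset.range r, ∑ p,
          coeff t (G.D i p) * coeff (r + s - 1 - t) (G.E p k)) else 0 := by
  have h0 := (H.rttPair hP).comm_D_E hij hh hk.le
  have h1 : diffC A • sc 0 (outer A (G.D i j)) (inner A (G.E h k)) = (prodC A κ * (-1) ^ P (β i)) •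
      (if h = j then ∑ p, outer A (G.D i p) * (inner A (G.E p k) - outer A (G.E p k)) else 0) := by
    rw [sc_zero]; exact h0
  obtain ⟨z1, z2, z3⟩ := coeff_of_sc h1
  rw [telescope_left (z := fun r s => sc 0 (coeff r (G.D i j)) (coeff s (G.E h k))) z1 z3]
  split_ifs
  · rw [Finset.mul_sum, Finset.smul_sum]
    refine Finset.sum_congr rfl fun t ht => ?_
    have ht := Finset.mem_range.1 ht
    rw [map_sum, map_sum]
    congr 2
    refine Finset.sum_congr rfl fun p _ => ?_
    -- The product D(u)E(u) has only a v⁰ term, and r + s - 1 - t ≥ s ≥ 1 for t < r.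
    rw [mul_sub, map_sub, map_sub, coeff_outer_mul_inner, ← map_mul, coeff_map, coeff_C,
      if_neg (by omega), sub_zero]
  · simp

theorem Rel.sc_E_D {i j h k : ι} (hij : β i = β j) (hh : β h < β i) (hk : β h ≤ β k)
    (hki : β k ≤ β i) :
    diffC A • sc ((P (β h) + P (β k)) * (P (β i) + P (β j))) (outer A (G.E h k))
        (inner A (G.D i j))
      = (prodC A κ * (-1) ^ (P (β h) * P (β k) + (P (β h) + P (β k)) * P (β i))) •
        (-(inner A (G.D i k) * (G.E.map (outer A) * G.E'.map (inner A)) h j)) := by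
  have h0 := (H.rttPair hP).lie_E_D (p := h) (j := k) (h := i) (k := j) (by omega) hij hk hki
  rw [← smul_neg] at h0
  have h1 := smul_sc_of_lie (p := P ∘ β) (fun _ => hP _) h0
  rw [mul_assoc, ← pow_add] at h1
  exact h1

-- With no block in between, the entry (h, k) of EE' = 1 has only two terms.
omit hP H in
theorem _root_.SuperRTT.LDU.E'_apply_of_adjacent (G : LDU β A) {h k : ι} (hk : β k = β h + 1) :
    G.E' h k = -G.E h k := by
  have h0 := congrFun (congrFun G.mul_E' h) k
  rw [Matrix.mul_apply, Matrix.one_apply_ne (by rintro rfl; omega),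
    Finset.sum_eq_add (a := h) (b := k) (by rintro rfl; omega) ?_ (by simp) (by simp)] at h0
  · rw [G.triE h h le_rfl, G.triE' k k le_rfl, Matrix.one_apply_eq, Matrix.one_apply_eq, one_mul,
      mul_one] at h0
    exact eq_neg_of_add_eq_zero_left h0
  · rintro q - ⟨h1, h2⟩
    rcases le_or_gt (β q) (β h) with hq | hq
    · rw [G.triE h q hq, Matrix.one_apply_ne (Ne.symm h1), zero_mul]
    · rw [G.triE' q k (by omega), Matrix.one_apply_ne h2, mul_zero]

omit hP H in
theorem E_mul_E'_of_adjacent {B : Type} [Ring B] (G H : LDU β B) {h k : ι}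
    (hk : β k = β h + 1) : (G.E * H.E') h k = G.E h k - H.E h k := by
  rw [Matrix.mul_apply,
    Finset.sum_eq_add (a := h) (b := k) (by rintro rfl; omega) ?_ (by simp) (by simp)]
  · rw [G.triE h h le_rfl, H.triE' k k le_rfl, Matrix.one_apply_eq, Matrix.one_apply_eq, one_mul,
      mul_one, H.E'_apply_of_adjacent hk]
    abel
  · rintro q - ⟨h1, h2⟩
    rcases le_or_gt (β q) (β h) with hq | hq
    · rw [G.triE h q hq, Matrix.one_apply_ne (Ne.symm h1), zero_mul]
    · rw [H.triE' q k (by omega), Matrix.one_apply_ne h2, mul_zero]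

theorem Rel.D_E_of_gt {i j h k : ι} (hij : β i = β j) (hh : β h ≤ β k) (hki : β k < β i)
    (r s : ℕ) :
    sc ((P (β h) + P (β k)) * (P (β i) + P (β j))) (coeff s (G.E h k)) (coeff r (G.D i j)) = 0 := by
  have h0 := H.sc_E_D hP hij (by omega) hh hki.le
  rw [G.triD i k hki.ne', map_zero, zero_mul, neg_zero, smul_zero] at h0
  have h1 := congrArg (fun Z => coeff r (coeff s Z)) (diffC_smul_eq_zero h0)
  simpa only [coeff_sc_outer_inner, map_zero] using h1

theorem Rel.D_E_next {i j h k : ι} (hij : β i = β j) (hk : β k = β h + 1) (hki : β k = β i)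
    (r s : ℕ) (hs : 1 ≤ s) :
    sc ((P (β h) + P (β k)) * (P (β i) + P (β j))) (coeff s (G.E h k)) (coeff r (G.D i j))
      = κ • ((-1) ^ P (β k) * ∑ t ∈ Finset.range r,
          coeff t (G.D i k) * coeff (r + s - 1 - t) (G.E h j)) := by
  obtain ⟨z1, z2, z3⟩ := coeff_of_sc (H.sc_E_D hP (h := h) (k := k) hij (by omega) (by omega) hki.le)
  refine (telescope_right (z := fun r s => sc ((P (β h) + P (β k)) * (P (β i) + P (β j)))
    (coeff r (G.E h k)) (coeff s (G.D i j))) z2 z3 s r).trans ?_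
  rw [Finset.mul_sum, Finset.smul_sum, ← Finset.sum_neg_distrib]
  refine Finset.sum_congr rfl fun t ht => ?_
  have ht := Finset.mem_range.1 ht
  have e := E_mul_E'_of_adjacent (G.map (outer A)) (G.map (inner A)) (h := h) (k := j) (by omega)
  have e' : (G.E.map (outer A) * G.E'.map (inner A)) h j
    = outer A (G.E h j) - inner A (G.E h j) := e
  -- The product D(v)E(v) has only a u⁰ term, while the exponent of u⁻¹ is at least s ≥ 1.
  rw [e', ← smul_neg, ← mul_neg, map_neg, map_neg, neg_neg, mul_sub, map_sub, map_sub,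
    coeff_inner_mul_outer, ← map_mul, coeff_C, if_neg (by omega), map_zero, sub_zero,
    ← hki, add_comm s r]
  congr 2
  rcases hP (β h) with h1 | h1 <;> rcases hP (β k) with h2 | h2 <;> simp [h1, h2, neg_one_pow_three]

theorem Rel.sc_E_E' {p j h k : ι} (hpj : β p ≤ β j) (hk : β j < β k) (hh : β p < β h) :
    diffC A • sc ((P (β p) + P (β j)) * (P (β h) + P (β k))) (outer A (G.E p j))
        (inner A (G.E' h k))
      = (prodC A κ * (-1) ^ (P (β p) * P (β j) + (P (β p) + P (β j)) * P (β h))) •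
        (if h = j then (G.E.map (outer A) * G.E'.map (inner A)) p k else 0) := by
  have h0 := (H.rttPair hP).lie_E_E' hpj hk hh
  have h1 := smul_sc_of_lie (p := P ∘ β) (fun _ => hP _) h0
  rw [mul_assoc, ← pow_add] at h1
  exact h1

theorem Rel.sc_E_F_of_gt {p j h k : ι} (hpj : β p ≤ β j) (hk : β p < β k) (hj : β j ≤ β k)
    (hhk : β k < β h) (r s : ℕ) :
    sc ((P (β p) + P (β j)) * (P (β h) + P (β k))) (coeff r (G.E p j)) (coeff s (G.F h k)) = 0 := by
  have h0 := (H.rttPair hP).lie_E_F_eq_zero hpj hk hj hhk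
  have h1 := sc_eq_lie_hat (p := P ∘ β) (fun _ => hP _) p j (outer A (G.E p j))
    (G.F.map (inner A)) h k
  have h2 : sc ((P (β p) + P (β j)) * (P (β h) + P (β k))) (outer A (G.E p j))
      (inner A (G.F h k)) = 0 := by
    refine h1.trans ?_
    rw [show ⁅hat (P ∘ β) p j (outer A (G.E p j)), G.F.map (inner A)⁆ h k = 0 from h0, mul_zero]
  have h3 := congrArg (fun Z => coeff s (coeff r Z)) h2
  simpa only [coeff_sc_outer_inner, map_zero] using h3

theorem Rel.sc_E_F {p j h k : ι} (hk : β k = β p) (hph : β h = β p + 1) (hhj : β h = β j)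
    (r s : ℕ) (hs : 1 ≤ s) :
    sc ((P (β p) + P (β j)) * (P (β h) + P (β k))) (coeff r (G.E p j)) (coeff s (G.F h k))
      = if r = 0 then 0 else -(κ • ((-1) ^ P (β h) * ∑ t ∈ Finset.range (r + s),
          coeff (r + s - 1 - t) (G.D h j) * coeff t (G.D' p k))) := by
  have h0 := (H.rttPair hP).lie_E_F (j := j) hk (by omega) hhj (fun x hx => by omega)
  have h1 := smul_sc_of_lie (p := P ∘ β) (fun _ => hP _) h0
  rw [mul_assoc, ← pow_add] at h1
  obtain ⟨z1, z2, z3⟩ := coeff_of_sc (f := G.E p j) (g := G.F h k) h1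
  refine (telescope_left (z := fun r s => sc ((P (β p) + P (β j)) * (P (β h) + P (β k)))
    (coeff r (G.E p j)) (coeff s (G.F h k))) z1 z3 r s).trans ?_
  rcases r with _ | r
  · simp
  -- D'(u)D(u) has no positive power of v⁻¹ and D(v)D'(v) none of u⁻¹, so only t = 0 survives in the
  -- telescoped sum; the coefficient of D(v)D'(v) is the full convolution of relation 8.
  have e : ∀ t n, 1 ≤ n → coeff n (coeff t ((G.map (outer A)).D' p k * (G.map (outer A)).D h j
      - (G.map (inner A)).D h j * (G.map (inner A)).D' p k))
      = if t = 0 then -coeff n (G.D h j * G.D' p k) else 0 := by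
    intro t n hn
    change coeff n (coeff t (outer A _ * outer A _ - inner A _ * inner A _)) = _
    rw [← map_mul, ← map_mul, map_sub, map_sub, coeff_map, coeff_C, if_neg (by omega), coeff_C]
    split_ifs <;> simp
  rw [if_neg (by omega), Finset.sum_eq_single 0]
  · rw [e _ _ (by omega), if_pos rfl, mul_neg, smul_neg, coeff_mul,
      ← Finset.Nat.sum_antidiagonal_swap, Finset.Nat.sum_antidiagonal_eq_sum_range_succ_mk,
      show (r + 1 + s - 1 - 0).succ = r + 1 + s by omega]
    congr 3
    simp only [Function.comp_apply, ← hhj]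
    rcases hP (β h) with h1 | h1 <;> rcases hP (β p) with h2 | h2 <;>
      simp [h1, h2, neg_one_pow_three]
  · intro t ht ht0
    have := Finset.mem_range.1 ht
    rw [e _ _ (by omega), if_neg ht0, mul_zero, smul_zero]
  · simp

end SuperRTT

/-! ### The bracket of E with itself: removing the surplus factor c. -/

namespace SuperRTT

open Matrix PowerSeries

variable {ι : Type} [Fintype ι] [DecidableEq ι] {A : Type} [Ring A]
  {β : ι → ℕ} {P : ℕ → ℕ} (hP : ∀ n, P n = 0 ∨ P n = 1) {κ : ℤ} {G : LDU β A⟦X⟧}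
  (H : Rel (P ∘ β) κ G.T)

/-- Z depends on v only, so after multiplication by u⁻¹v⁻¹(v⁻¹ - u⁻¹) it contributes only to the
coefficients of u⁻¹ and u⁻². -/
theorem coeff_of_smul_system {κ : ℤ} {n : ℕ} {Z : A⟦X⟧} {K₁ K₂ : A⟦X⟧⟦X⟧}
    (h : diffC A • K₁ = (prodC A κ * (-1) ^ n) • K₂ + (prodC A κ * diffC A) • inner A Z) (r s : ℕ) :
    (if s = 0 then 0 else coeff (s - 1) (coeff r K₁))
      - (if r = 0 then 0 else coeff s (coeff (r - 1) K₁))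
    = κ • (if r = 0 ∨ s = 0 then 0 else (-1) ^ n * coeff (s - 1) (coeff (r - 1) K₂))
      + κ • (if r = 0 ∨ s = 0 then 0 else
          (if s = 1 then 0 else if r = 1 then coeff (s - 2) Z else 0)
          - (if r = 2 then coeff (s - 1) Z else 0)) := by
  have h0 := congrArg (fun Z => coeff s (coeff r Z)) h
  simp only [mul_smul, neg_one_pow_smul, map_add, coeff_diffC_smul, coeff_prodC_smul,
    coeff_neg_one_pow_mul] at h0
  rw [h0]
  by_cases h1 : r = 0 ∨ s = 0
  · simp [h1]
  · simp only [if_neg h1]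
    congr 2
    push Not at h1
    obtain ⟨r, rfl⟩ := Nat.exists_eq_add_of_le' (Nat.one_le_iff_ne_zero.2 h1.1)
    obtain ⟨s, rfl⟩ := Nat.exists_eq_add_of_le' (Nat.one_le_iff_ne_zero.2 h1.2)
    rcases r with _ | _ | r <;> rcases s with _ | s <;> simp [coeff_C]

/-- The unknown series Z drops out when the equations at u⁻¹ and u⁻² are added, and what remains are
the hypotheses of `double_seq_eq_zero`. The map σ there is multiplication by κ and a sign, injective
because κ = ±1. -/
theorem eq_zero_of_smul_system {κ : ℤ} (hκ : κ = 1 ∨ κ = -1) {n : ℕ} {Z₁ Z₂ : A⟦X⟧}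
    {K₁ K₂ : A⟦X⟧⟦X⟧}
    (h1 : diffC A • K₁ = (prodC A κ * (-1) ^ n) • K₂ + (prodC A κ * diffC A) • inner A Z₁)
    (h2 : diffC A • K₂ = (prodC A κ * (-1) ^ n) • K₁ + (prodC A κ * diffC A) • inner A Z₂) :
    K₁ = 0 := by
  have key : ∀ {Z₁ : A⟦X⟧} {K₁ K₂ : A⟦X⟧⟦X⟧},
      diffC A • K₁ = (prodC A κ * (-1) ^ n) • K₂ + (prodC A κ * diffC A) • inner A Z₁ →
      (∀ s, coeff s (coeff 0 K₁) = 0) ∧ (∀ r, coeff 0 (coeff r K₁) = 0) ∧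
      ((∀ s, coeff s (coeff 0 K₂) = 0) → ∀ s, coeff s (coeff 2 K₁)
        = κ • ((-1) ^ n * coeff s (coeff 1 K₂))) ∧
      (∀ r s, coeff s (coeff (r + 3) K₁) = coeff (s + 1) (coeff (r + 2) K₁)
        + κ • ((-1) ^ n * coeff s (coeff (r + 2) K₂))) := by
    intro Z₁ K₁ K₂ h
    have e := coeff_of_smul_system h
    refine ⟨fun s => ?_, fun r => ?_, fun h3 s => ?_, fun r s => ?_⟩
    · simpa using e 0 (s + 1)
    · simpa using e (r + 1) 0
    · have e1 := e 2 (s + 1)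
      have e2 := e 1 (s + 2)
      have e3 : coeff (s + 2) (coeff 0 K₁) = 0 := by simpa using e 0 (s + 3)
      have e4 := h3 (s + 1)
      simp [-coeff_zero_eq_constantCoeff] at e1 e2
      rw [e3, e4] at e2
      -- Inserting `e2` into `e1` eliminates the coefficient of Z.
      rw [sub_eq_iff_eq_add.1 e1, ← sub_zero (coeff (s + 1) (coeff 1 K₁)), e2]
      simp
    · have e1 := e (r + 3) (s + 1)
      simp at e1
      rw [sub_eq_iff_eq_add.1 e1, add_comm, zsmul_eq_mul]
  obtain ⟨a1, a2, a3, a4⟩ := key h1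
  obtain ⟨b1, b2, b3, b4⟩ := key h2
  let σ : A →+ A := (zsmulAddGroupHom κ).comp (AddMonoidHom.mulLeft ((-1) ^ n))
  ext r s
  refine double_seq_eq_zero (σ := σ) ?_ (f := fun r s => coeff s (coeff r K₁))
    (g := fun r s => coeff s (coeff r K₂)) a1 a2 (a3 b1) a4 b1 b2 (b3 a1) b4 r s
  intro x hx
  change κ • ((-1) ^ n * x) = 0 at hx
  rcases hκ with rfl | rfl <;> rcases neg_one_pow_eq_or A n with h | h <;> simpa [h] using hx

include hP H

/-- A rearrangement of `RTTPair.lie_E_E`: the defect of the expected formula, times c, is d up to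
sign times the defect with j and l exchanged, up to a term in v alone. Applied also with j and l
exchanged, it gives the system of `eq_zero_of_smul_system`. -/
theorem Rel.sc_E_E_aux {p j h l : ι} (hpj : β p ≤ β j) (hpl : β p ≤ β l) (hh : β h = β p) :
    diffC A • (diffC A • sc ((P (β p) + P (β j)) * (P (β p) + P (β l))) (outer A (G.E p j))
        (inner A (G.E h l))
      - (prodC A κ * (-1) ^ (P (β p) * P (β j) + P (β p) * P (β l) + P (β j) * P (β l))) •
        ((inner A (G.E p l) - outer A (G.E p l)) * (inner A (G.E h j) - outer A (G.E h j))))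
    = (prodC A κ * (-1) ^ (P (β p) * P (β j) + P (β p) * P (β l) + P (β j) * P (β l))) •
        (diffC A • sc ((P (β p) + P (β l)) * (P (β p) + P (β j))) (outer A (G.E p l))
          (inner A (G.E h j))
        - (prodC A κ * (-1) ^ (P (β p) * P (β l) + P (β p) * P (β j) + P (β l) * P (β j))) •
        ((inner A (G.E p j) - outer A (G.E p j)) * (inner A (G.E h l) - outer A (G.E h l))))
      + (prodC A κ * diffC A) • inner A ((-1) ^ P (β p) * (G.E h j * G.E p l)
          - (-1) ^ (P (β p) * P (β j) + P (β p) * P (β l) + P (β j) * P (β l)) *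
            (G.E p l * G.E h j)) := by
  have h0 := (H.rttPair hP).lie_E_E hpj hpl hh
  have h1 := sc_eq_lie_hat (p := P ∘ β) (fun _ => hP _) p j (outer A (G.E p j))
    (G.E.map (inner A)) h l
  have h2 : diffC A • diffC A • ⁅hat (P ∘ β) p j (outer A (G.E p j)), G.E.map (inner A)⁆ h l
      = (diffC A * (prodC A κ * (-1) ^ (P (β p) * P (β j)))) •
          (inner A (G.E h j) * (inner A (G.E p l) - outer A (G.E p l)))
        - (prodC A κ * (-1) ^ (P (β p) * P (β j)) * (prodC A κ * (-1) ^ P (β p))) •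
          ((inner A (G.E p j) - outer A (G.E p j)) * (inner A (G.E h l) - outer A (G.E h l)))
        - (diffC A * (prodC A κ * (-1) ^ P (β p)) * (-1) ^ ((P (β p) + P (β j)) * P (β l))) •
          ((inner A (G.E p l) - outer A (G.E p l)) * outer A (G.E h j)) := h0
  have h3 : sc ((P (β p) + P (β j)) * (P (β p) + P (β l))) (outer A (G.E p j)) (inner A (G.E h l))
      = (-1) ^ ((P (β p) + P (β j)) * P (β p)) *
        ⁅hat (P ∘ β) p j (outer A (G.E p j)), G.E.map (inner A)⁆ h l := by
    simpa only [Function.comp_apply, hh, Matrix.map_apply] using h1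
  rw [h3, map_sub, map_mul (inner A), map_mul (inner A), map_mul (inner A), map_mul (inner A),
    map_pow, map_pow, map_neg, map_one]
  generalize ⁅hat (P ∘ β) p j (outer A (G.E p j)), G.E.map (inner A)⁆ h l = L at *
  rcases hP (β p) with ha | ha <;> rcases hP (β j) with hj | hj <;> rcases hP (β l) with hl | hl <;>
    simp only [ha, hj, hl, sc, mul_zero, mul_one, pow_zero, pow_one, add_zero, zero_add,
      neg_one_pow_three, one_mul, neg_mul, Nat.reduceAdd, Nat.reduceMul, mul_sub, sub_mul,
      neg_one_sq, Even.neg_one_pow (show Even 4 by decide)] at h2 ⊢ <;>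
    first
    | linear_combination (norm := module) h2
    | linear_combination (norm := module) -h2

theorem Rel.sc_E_E (hκ : κ = 1 ∨ κ = -1) {p j h l : ι} (hpj : β p ≤ β j) (hpl : β p ≤ β l)
    (hh : β h = β p) :
    diffC A • sc ((P (β p) + P (β j)) * (P (β p) + P (β l))) (outer A (G.E p j))
        (inner A (G.E h l))
      = (prodC A κ * (-1) ^ (P (β p) * P (β j) + P (β p) * P (β l) + P (β j) * P (β l))) •
        ((inner A (G.E p l) - outer A (G.E p l)) * (inner A (G.E h j) - outer A (G.E h j))) := by
  have h1 := H.sc_E_E_aux hP hpj hpl hh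
  have h2 := H.sc_E_E_aux hP hpl hpj hh
  rw [show P (β p) * P (β l) + P (β p) * P (β j) + P (β l) * P (β j)
    = P (β p) * P (β j) + P (β p) * P (β l) + P (β j) * P (β l) by ring] at h1 h2
  exact sub_eq_zero.1 (eq_zero_of_smul_system hκ h1 h2)

end SuperRTT

/-! ### Coefficient relations for E: same block, neighbouring blocks, quartic. -/

namespace SuperRTT

open Matrix PowerSeries

theorem sc_neg_right {A : Type} [Ring A] (e : ℕ) (x y : A) : sc e x (-y) = -sc e x y := by
  simp only [sc, mul_neg, neg_mul]; abel

theorem sc_smul_left {A : Type} [Ring A] (e : ℕ) (n : ℤ) (x y : A) :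
    sc e (n • x) y = n • sc e x y := by
  simp only [sc, smul_mul_assoc, mul_smul_comm, smul_sub]

theorem sc_smul_right {A : Type} [Ring A] (e : ℕ) (n : ℤ) (x y : A) :
    sc e x (n • y) = n • sc e x y := by
  simp only [sc, smul_mul_assoc, mul_smul_comm, smul_sub]

theorem sc_zero_right {A : Type} [Ring A] (e : ℕ) (x : A) : sc e x 0 = 0 := by simp [sc]

theorem sc_congr {A : Type} [Ring A] {e e' : ℕ} (h : e % 2 = e' % 2) (x y : A) :
    sc e x y = sc e' x y := by
  rw [sc, sc, neg_one_pow_eq_pow_mod_two, h, ← neg_one_pow_eq_pow_mod_two]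

variable {ι : Type} [Fintype ι] [DecidableEq ι] {A : Type} [Ring A]
  {β : ι → ℕ} {P : ℕ → ℕ} {κ : ℤ} {G : LDU β A⟦X⟧}

theorem coeff_mul_outer_inner (M N : Matrix ι ι A⟦X⟧) (p k : ι) (r s : ℕ) :
    coeff s (coeff r ((M.map (outer A) * N.map (inner A) : Matrix ι ι A⟦X⟧⟦X⟧) p k))
      = ∑ q, coeff r (M p q) * coeff s (N q k) := by
  rw [Matrix.mul_apply, map_sum, map_sum]
  exact Finset.sum_congr rfl fun q _ => coeff_outer_mul_inner _ _ _ _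

/-- The product in v alone contributes a full convolution at t = 0, from which the cross terms b(u)
remove the superscripts t ≥ s. The two remaining sums, over t < s and t < r, share the term t = 0;
hence both start at 1. -/
theorem sum_range_quadratic (a b : A⟦X⟧) {r s : ℕ} (hr : 1 ≤ r) (hs : 1 ≤ s) :
    ∑ t ∈ Finset.range r, coeff (r + s - 1 - t) (coeff t
      ((inner A a - outer A a) * (inner A b - outer A b)))
    = ∑ t ∈ Finset.Ico 1 s, coeff t a * coeff (r + s - 1 - t) b
      - ∑ t ∈ Finset.Ico 1 r, coeff t a * coeff (r + s - 1 - t) b := by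
  have e : ∀ t ∈ Finset.range r, coeff (r + s - 1 - t) (coeff t
      ((inner A a - outer A a) * (inner A b - outer A b)))
      = (if t = 0 then coeff (r + s - 1) (a * b) else 0)
        - coeff (r + s - 1 - t) a * coeff t b - coeff t a * coeff (r + s - 1 - t) b := by
    intro t ht
    have := Finset.mem_range.1 ht
    have : (inner A a - outer A a) * (inner A b - outer A b)
        = inner A (a * b) - inner A a * outer A b - outer A a * inner A b + outer A (a * b) := by
      rw [map_mul, map_mul]; noncomm_ring
    rw [this, map_add, map_add, map_sub, map_sub, map_sub, map_sub, coeff_inner_mul_outer,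
      coeff_outer_mul_inner, coeff_map, coeff_C, coeff_C,
      if_neg (show ¬ (r + s - 1 - t = 0) by omega), add_zero]
    split_ifs with h
    · rw [h]; rfl
    · rw [map_zero]
  rw [Finset.sum_congr rfl e, Finset.sum_sub_distrib, Finset.sum_sub_distrib,
    Finset.sum_ite_eq' (Finset.range r) 0, if_pos (Finset.mem_range.2 hr), coeff_mul,
    Finset.Nat.sum_antidiagonal_eq_sum_range_succ_mk,
    show (r + s - 1).succ = s + r by omega, Finset.sum_range_add]
  have e2 : ∑ t ∈ Finset.range r, coeff (s + t) a * coeff (r + s - 1 - (s + t)) b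
      = ∑ t ∈ Finset.range r, coeff (r + s - 1 - t) a * coeff t b := by
    rw [← Finset.sum_range_reflect]
    refine Finset.sum_congr rfl fun t ht => ?_
    have := Finset.mem_range.1 ht
    rw [show s + (r - 1 - t) = r + s - 1 - t by omega,
      show r + s - 1 - (r + s - 1 - t) = t by omega]
  rw [e2, add_sub_cancel_right, Finset.range_eq_Ico, Finset.range_eq_Ico,
    Finset.sum_eq_sum_Ico_succ_bot (by omega), Finset.sum_eq_sum_Ico_succ_bot (by omega : 0 < r)]
  abel

variable (hP : ∀ n, P n = 0 ∨ P n = 1) (H : Rel (P ∘ β) κ G.T)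

include hP H

theorem Rel.E_E (hκ : κ = 1 ∨ κ = -1) {p j h l : ι} (hpj : β p ≤ β j) (hjl : β l = β j)
    (hh : β h = β p) {r s : ℕ} (hr : 1 ≤ r) (hs : 1 ≤ s) :
    sc ((P (β p) + P (β j)) * (P (β h) + P (β l))) (coeff r (G.E p j)) (coeff s (G.E h l))
      = κ • ((-1) ^ P (β j) * (∑ t ∈ Finset.Ico 1 s, coeff t (G.E p l) * coeff (r + s - 1 - t) (G.E h j)
      - ∑ t ∈ Finset.Ico 1 r, coeff t (G.E p l) * coeff (r + s - 1 - t) (G.E h j))) := by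
  obtain ⟨z1, z2, z3⟩ := coeff_of_sc (H.sc_E_E hP hκ hpj (hpj.trans hjl.ge) hh)
  rw [hh]
  refine (telescope_left (z := fun r s => sc ((P (β p) + P (β j)) * (P (β p) + P (β l)))
    (coeff r (G.E p j)) (coeff s (G.E h l))) z1 z3 r s).trans ?_
  rw [← Finset.smul_sum, ← Finset.mul_sum, sum_range_quadratic _ _ hr hs, hjl]
  congr 2
  rcases hP (β p) with h1 | h1 <;> rcases hP (β j) with h2 | h2 <;> simp [h1, h2, neg_one_pow_three]

theorem Rel.coeff_E_E' {p j h k : ι} (hpj : β p ≤ β j) (hk : β j < β k) (hh : β p < β h) :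
    (∀ s, sc ((P (β p) + P (β j)) * (P (β h) + P (β k))) (coeff 0 (G.E p j))
      (coeff s (G.E' h k)) = 0) ∧
    (∀ r, sc ((P (β p) + P (β j)) * (P (β h) + P (β k))) (coeff r (G.E p j))
      (coeff 0 (G.E' h k)) = 0) ∧
    ∀ r s, sc ((P (β p) + P (β j)) * (P (β h) + P (β k))) (coeff (r + 1) (G.E p j))
        (coeff s (G.E' h k))
      - sc ((P (β p) + P (β j)) * (P (β h) + P (β k))) (coeff r (G.E p j))
        (coeff (s + 1) (G.E' h k))
      = κ • ((-1) ^ (P (β p) * P (β j) + (P (β p) + P (β j)) * P (β h)) *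
        (if h = j then ∑ q, coeff r (G.E p q) * coeff s (G.E' q k) else 0)) := by
  obtain ⟨z1, z2, z3⟩ := coeff_of_sc (H.sc_E_E' hP hpj hk hh)
  refine ⟨z1, z2, fun r s => (z3 r s).trans ?_⟩
  split_ifs
  · rw [coeff_mul_outer_inner]
  · simp

theorem Rel.E_E'_eq_zero {p j h k : ι} (hpj : β p ≤ β j) (hk : β j < β k) (hh : β p < β h)
    (hhj : h ≠ j) (r s : ℕ) :
    sc ((P (β p) + P (β j)) * (P (β h) + P (β k))) (coeff r (G.E p j)) (coeff s (G.E' h k)) = 0 := by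
  obtain ⟨z1, z2, z3⟩ := H.coeff_E_E' hP hpj hk hh
  rw [telescope_left (z := fun r s => sc ((P (β p) + P (β j)) * (P (β h) + P (β k)))
    (coeff r (G.E p j)) (coeff s (G.E' h k))) z1 z3 r s]
  simp [hhj]

theorem Rel.E_E_eq_zero {p j h k : ι} (hpj : β p ≤ β j) (hk : β k = β h + 1) (hjh : β j ≤ β h)
    (hh : β p < β h) (hhj : h ≠ j) (r s : ℕ) :
    sc ((P (β p) + P (β j)) * (P (β h) + P (β k))) (coeff r (G.E p j)) (coeff s (G.E h k)) = 0 := by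
  have h0 := H.E_E'_eq_zero hP hpj (h := h) (k := k) (by omega) hh hhj r s
  rw [G.E'_apply_of_adjacent hk, map_neg, sc_neg_right, neg_eq_zero] at h0
  exact h0

-- As r, s ≥ 1, the identity blocks contribute nothing, and only the middle block is left, where E'
-- = -E.
omit hP H in
theorem coeff_sum_E_E' {p k : ι} (hk : β k = β p + 2) {r s : ℕ} (hr : 1 ≤ r) (hs : 1 ≤ s) :
    ∑ q, coeff r (G.E p q) * coeff s (G.E' q k)
      = -∑ q, if β q = β p + 1 then coeff r (G.E p q) * coeff s (G.E q k) else 0 := by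
  have hr0 : r ≠ 0 := by omega
  have hs0 : s ≠ 0 := by omega
  rw [← Finset.sum_neg_distrib]
  refine Finset.sum_congr rfl fun q _ => ?_
  split_ifs with h
  · rw [G.E'_apply_of_adjacent (by omega), map_neg, mul_neg]
  · rw [neg_zero]
    rcases le_or_gt (β q) (β p) with h1 | h1
    · rw [G.triE _ _ h1, Matrix.one_apply]
      split_ifs <;> simp [coeff_one, hr0]
    · rw [G.triE' _ _ (by omega), Matrix.one_apply]
      split_ifs <;> simp [coeff_one, hs0]

theorem Rel.E_E_next {p j h k : ι} (hj : β j = β p + 1) (hh : β h = β j) (hk : β k = β h + 1)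
    {r s : ℕ} (hr : 1 ≤ r) (hs : 1 ≤ s) :
    sc ((P (β p) + P (β j)) * (P (β h) + P (β k))) (coeff (r + 1) (G.E p j)) (coeff s (G.E h k))
      - sc ((P (β p) + P (β j)) * (P (β h) + P (β k))) (coeff r (G.E p j))
        (coeff (s + 1) (G.E h k))
      = if h = j then κ • ((-1) ^ P (β j) *
        ∑ q, if β q = β j then coeff r (G.E p q) * coeff s (G.E q k) else 0) else 0 := by
  have h0 := (H.coeff_E_E' hP (p := p) (j := j) (h := h) (k := k) (by omega) (by omega)
    (by omega)).2.2 r s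
  rw [G.E'_apply_of_adjacent hk, map_neg, map_neg, sc_neg_right, sc_neg_right,
    coeff_sum_E_E' (by omega) hr hs, neg_sub_neg, ← neg_sub, neg_eq_iff_eq_neg] at h0
  rw [h0]
  split_ifs
  · rw [mul_neg, smul_neg, neg_neg, hj, hh, hj]
    congr 2
    rcases hP (β p) with h1 | h1 <;> rcases hP (β p + 1) with h2 | h2 <;>
      simp [h1, h2, neg_one_pow_three]
  · simp

/-- In the recursion at s = 0 one bracket vanishes, and the constant term of E' is the identity,
which collapses the sum to one coefficient of E. -/
theorem Rel.E_E_one (hE' : ∀ i j, coeff 0 (G.E' i j) = (1 : Matrix ι ι A) i j) {p j h k : ι}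
    (hj : β j = β p + 1) (hh : β h = β j) (hk : β k = β h + 1) (r : ℕ) :
    ∃ n : ℤ, sc ((P (β p) + P (β j)) * (P (β h) + P (β k))) (coeff r (G.E p j)) (coeff 1 (G.E h k))
      = n • coeff r (G.E p k) := by
  obtain ⟨-, z2, z3⟩ := (H.coeff_E_E' hP (p := p) (j := j) (h := h) (k := k) (by omega) (by omega)
    (by omega))
  have h0 := z3 r 0
  rw [z2, zero_sub, zero_add, G.E'_apply_of_adjacent hk, map_neg, sc_neg_right, neg_neg] at h0
  rw [h0]
  split_ifs
  · simp only [hE', Matrix.one_apply, mul_ite, mul_one, mul_zero, Finset.sum_ite_eq',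
      Finset.mem_univ, if_true]
    rw [neg_one_pow_mul_eq_smul, smul_smul]
    exact ⟨_, rfl⟩
  · exact ⟨0, by simp⟩

/-- At r = 0 the constant term of E collapses the sum instead, and a coefficient of the inverse E'
is left. This asymmetry is what `Rel.quartic` exploits. -/
theorem Rel.one_E_E (hE : ∀ i j, coeff 0 (G.E i j) = (1 : Matrix ι ι A) i j) {p j h k : ι}
    (hj : β j = β p + 1) (hh : β h = β j) (hk : β k = β h + 1) (s : ℕ) :
    ∃ n : ℤ, sc ((P (β p) + P (β j)) * (P (β h) + P (β k))) (coeff 1 (G.E p j)) (coeff s (G.E h k))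
      = n • coeff s (G.E' p k) := by
  obtain ⟨z1, -, z3⟩ := (H.coeff_E_E' hP (p := p) (j := j) (h := h) (k := k) (by omega) (by omega)
    (by omega))
  have h0 := z3 0 s
  rw [z1, sub_zero, zero_add, G.E'_apply_of_adjacent hk, map_neg, sc_neg_right,
    neg_eq_iff_eq_neg] at h0
  rw [h0]
  split_ifs
  · simp only [hE, Matrix.one_apply, ite_mul, one_mul, zero_mul, Finset.sum_ite_eq,
      Finset.mem_univ, if_true]
    rw [neg_one_pow_mul_eq_smul, smul_smul, ← neg_smul]
    exact ⟨_, rfl⟩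
  · exact ⟨0, by simp⟩

/-- The inner brackets are integer multiples of an entry (i, k) of E and an entry (h₀, g) of E'.
Since k and h₀ lie in different blocks, these supercommute by `Rel.E_E'_eq_zero`. -/
theorem Rel.quartic (hE : ∀ i j, coeff 0 (G.E i j) = (1 : Matrix ι ι A) i j)
    (hE' : ∀ i j, coeff 0 (G.E' i j) = (1 : Matrix ι ι A) i j) {i j h k h₀ k₀ f g : ι}
    (hj : β j = β i + 1) (hh : β h = β j) (hk : β k = β h + 1) (hh₀ : β h₀ = β h)
    (hk₀ : β k₀ = β k) (hf : β f = β k) (hg : β g = β f + 1) (r s : ℕ) :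
    sc ((P (β i) + P (β j) + (P (β h) + P (β k))) * (P (β h₀) + P (β k₀) + (P (β f) + P (β g))))
      (sc ((P (β i) + P (β j)) * (P (β h) + P (β k))) (coeff r (G.E i j)) (coeff 1 (G.E h k)))
      (sc ((P (β h₀) + P (β k₀)) * (P (β f) + P (β g))) (coeff 1 (G.E h₀ k₀))
        (coeff s (G.E f g))) = 0 := by
  obtain ⟨n, hn⟩ := H.E_E_one hP hE' hj hh hk r
  obtain ⟨n', hn'⟩ := H.one_E_E hP hE (p := h₀) (j := k₀) (by omega) (hf.trans hk₀.symm) hg s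
  have h0 := H.E_E'_eq_zero hP (p := i) (j := k) (h := h₀) (k := g) (by omega) (by omega)
    (by omega) (by rintro rfl; omega) r s
  rw [hn, hn', sc_smul_left, sc_smul_right, sc_congr (e' := (P (β i) + P (β k)) *
    (P (β h₀) + P (β g))), h0, smul_zero, smul_zero]
  rw [hh₀, hk₀, hf, hh, Nat.mul_mod, Nat.mul_mod (P (β i) + P (β k))]
  congr 2 <;> omega

end SuperRTT

/-! ### Serre relations -/

namespace SuperRTT

open Matrix PowerSeries

theorem neg_one_pow_four (R : Type) [Ring R] : (-1 : R) ^ 4 = 1 := Even.neg_one_pow (by decide)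

theorem neg_one_pow_seven (R : Type) [Ring R] : (-1 : R) ^ 7 = -1 := Odd.neg_one_pow (by decide)

theorem neg_one_pow_nine (R : Type) [Ring R] : (-1 : R) ^ 9 = -1 := Odd.neg_one_pow (by decide)

theorem lie_mul_left {B : Type} [Ring B] (x y z : B) : ⁅x, y * z⁆ = ⁅x, y⁆ * z + y * ⁅x, z⁆ := by
  simp only [Ring.lie_def]; noncomm_ring

theorem sc_swap {A : Type} [Ring A] (e : ℕ) (x y : A) :
    sc e x y = -((-1) ^ e * sc e y x) := by
  rcases neg_one_pow_eq_or A e with h | h <;> simp only [sc, h] <;> noncomm_ring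

theorem coeff_quadratic_symm {A : Type} [Ring A] (a b : A⟦X⟧) (r s : ℕ) :
    coeff s (coeff r ((inner A a - outer A a) * (inner A b - outer A b)))
      = coeff r (coeff s ((inner A a - outer A a) * (inner A b - outer A b))) := by
  have : (inner A a - outer A a) * (inner A b - outer A b)
      = inner A (a * b) - inner A a * outer A b - outer A a * inner A b + outer A (a * b) := by
    rw [map_mul, map_mul]; noncomm_ring
  rw [this]
  simp only [map_add, map_sub, coeff_inner_mul_outer, coeff_outer_mul_inner, coeff_map, coeff_C]
  by_cases hr : r = 0 <;> by_cases hs : s = 0 <;> simp [hr, hs] <;> abel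

variable {ι : Type} [Fintype ι] [DecidableEq ι]

section Core

variable {B : Type} [Ring B] {K : Type} [CommRing K] [Algebra K B] {β : ι → ℕ} {p : ι → ℕ}

/-- Leibniz rule for E(v)E'(w), bracketed with an entry x of E(u): `hv` and `hw` describe the
brackets of x with E at v and w, and `hw'` the bracket with E' at w, known only for rows beyond the
block of i. -/
theorem lie_E_mul_E' {U V W : LDU β B} {cv cw dv dw : K} {i j h g : ι} {x : B}
    (hih : β h = β i) (hij : β i < β j) (hjg : β j < β g)
    (hv : ∀ q, cv • ⁅hat p i j x, V.E⁆ h q = dv • ((V.E - U.E) h j * (V.E - U.E) i q))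
    (hw : ∀ q, cw • ⁅hat p i j x, W.E⁆ h q = dw • ((W.E - U.E) h j * (W.E - U.E) i q))
    (hw' : ∀ q, β i < β q →
      cw • ⁅hat p i j x, W.E'⁆ q g = dw • (if q = j then (U.E * W.E') i g else 0)) :
    (cv * cw) • ⁅hat p i j x, V.E * W.E'⁆ h g
      = (cw * dv) • ((V.E - U.E) h j * ((V.E * W.E') i g - (U.E * W.E') i g))
        + (cv * dw) • ((V.E - U.E) h j * (U.E * W.E') i g) := by
  set L := hat p i j x with hL
  have key : ∀ {Z : LDU β B} {c d : K},
      (∀ q, c • ⁅L, Z.E⁆ h q = d • ((Z.E - U.E) h j * (Z.E - U.E) i q)) →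
      c • (⁅L, Z.E⁆ * W.E') h g = d • ((Z.E - U.E) h j * ((Z.E - U.E) * W.E') i g) := by
    intro Z c d hz
    rw [Matrix.mul_apply, Matrix.mul_apply, Finset.mul_sum, Finset.smul_sum, Finset.smul_sum]
    refine Finset.sum_congr rfl fun q _ => ?_
    rw [← smul_mul_assoc, hz, smul_mul_assoc, mul_assoc]
  -- Subtracting [x, E(w)E'(w)] = 0 replaces E(v) by E(v) - E(w) in front of [x, E'(w)]. Row h of
  -- this difference vanishes in the blocks up to that of i, exactly where `hw'` says nothing.
  have e : ⁅L, V.E * W.E'⁆ = ⁅L, V.E⁆ * W.E' - ⁅L, W.E⁆ * W.E' + (V.E - W.E) * ⁅L, W.E'⁆ := by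
    have h1 : ⁅L, W.E * W.E'⁆ = 0 := by rw [W.mul_E', Ring.lie_def]; simp
    rw [lie_mul_left] at h1 ⊢
    have h2 : ⁅L, W.E⁆ * W.E' = -(W.E * ⁅L, W.E'⁆) := eq_neg_of_add_eq_zero_left h1
    rw [h2]; noncomm_ring
  have s1 := key hv
  have s2 := key hw
  have s3 : cw • ((V.E - W.E) * ⁅L, W.E'⁆) h g
      = dw • ((V.E - W.E) h j * (U.E * W.E') i g) := by
    rw [Matrix.mul_apply, Finset.smul_sum, Finset.sum_eq_single j]
    · rw [← mul_smul_comm, hw' j hij, if_pos rfl, mul_smul_comm]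
    · intro q _ hq
      rcases le_or_gt (β q) (β i) with h1 | h1
      · rw [Matrix.sub_apply, V.triE h q (by omega), W.triE h q (by omega), sub_self, zero_mul,
          smul_zero]
      · rw [← mul_smul_comm, hw' q h1, if_neg hq, smul_zero, mul_zero]
    · simp
  have e1 : ((V.E - U.E) * W.E') i g = (V.E * W.E') i g - (U.E * W.E') i g := by
    rw [sub_mul, Matrix.sub_apply]
  have e2 : ((W.E - U.E) * W.E') i g = -(U.E * W.E') i g := by
    rw [sub_mul, Matrix.sub_apply, W.mul_E', LDU.one_ne (β := β) (by omega), zero_sub]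
  rw [e1] at s1
  rw [e2] at s2
  rw [e, Matrix.add_apply, Matrix.sub_apply]
  generalize (⁅L, V.E⁆ * W.E') h g = a1 at *
  generalize (⁅L, W.E⁆ * W.E') h g = a2 at *
  generalize ((V.E - W.E) * ⁅L, W.E'⁆) h g = a3 at *
  generalize (V.E * W.E') i g = y1 at *
  generalize (U.E * W.E') i g = y2 at *
  simp only [Matrix.sub_apply, sub_mul, mul_sub, mul_neg] at *
  linear_combination (norm := module) cw • s1 - cv • s2 + cv • s3

theorem map_lie_hat {C : Type} [Ring C] (f : B →+* C) (i j h k : ι) (x : B) (M : Matrix ι ι B) :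
    f (⁅hat p i j x, M⁆ h k) = ⁅hat p i j (f x), M.map f⁆ h k := by
  simp only [Ring.lie_def, Matrix.sub_apply, hat_apply_mul, mul_hat_apply, map_sub, map_mul,
    map_pow, map_neg, map_one, Matrix.map_apply]

end Core

variable {A : Type} [Ring A] {β : ι → ℕ} {P : ℕ → ℕ} {κ : ℤ} {G : LDU β A⟦X⟧}
  (hP : ∀ n, P n = 0 ∨ P n = 1) (H : Rel (P ∘ β) κ G.T) (hκ : κ = 1 ∨ κ = -1)

include hP H hκ

/-- `Rel.sc_E_E` with its two entries interchanged. The factor with column j now stands on the left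
and the one with column l on the right, so the identity can be multiplied on the right by a matrix
and summed over l. -/
theorem Rel.sc_E_E_flip {p j h l : ι} (hpj : β p ≤ β j) (hpl : β p ≤ β l) (hh : β h = β p) :
    diffC A • sc ((P (β p) + P (β j)) * (P (β p) + P (β l))) (outer A (G.E p j))
        (inner A (G.E h l))
      = (prodC A κ * (-1) ^ P (β p)) •
        ((inner A (G.E h j) - outer A (G.E h j)) * (inner A (G.E p l) - outer A (G.E p l))) := by
  have h0 := H.sc_E_E hP hκ (p := h) (j := l) (h := p) (l := j) (by omega) (by omega) hh.symm
  rw [hh] at h0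
  obtain ⟨z1, z2, z3⟩ := coeff_of_sc h0
  have e : (P (β p) + P (β l)) * (P (β p) + P (β j))
    = (P (β p) + P (β j)) * (P (β p) + P (β l)) := mul_comm _ _
  rw [e] at z1 z2 z3
  rw [mul_smul, neg_one_pow_smul]
  refine (diffC_smul_eq_iff _ _ _).2 ⟨fun s => ?_, fun r => ?_, fun r s => ?_⟩
  · rw [coeff_sc_outer_inner, sc_swap, z2, mul_zero, neg_zero]
  · rw [coeff_sc_outer_inner, sc_swap, z1, mul_zero, neg_zero]
  · rw [coeff_sc_outer_inner, coeff_sc_outer_inner, sc_swap, sc_swap _ (coeff r _),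
      neg_sub_neg, ← mul_sub, z3, coeff_neg_one_pow_mul, coeff_neg_one_pow_mul,
      coeff_quadratic_symm, mul_smul_comm, ← mul_assoc, ← pow_add]
    congr 2
    rcases hP (β p) with h1 | h1 <;> rcases hP (β j) with h2 | h2 <;>
      rcases hP (β l) with h3 | h3 <;> simp [h1, h2, h3, neg_one_pow_three, neg_one_pow_four,
        neg_one_pow_five, neg_one_pow_seven, neg_one_pow_nine]

/-- Columns q before the block of i are covered too, both sides being zero there; this is needed to
sum over all q. -/
theorem Rel.lie_E_E {i j h : ι} (hij : β i ≤ β j) (hh : β h = β i) (q : ι) :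
    diffC A • ⁅hat (P ∘ β) i j (outer A (G.E i j)), G.E.map (inner A)⁆ h q
      = (prodC A κ * (-1) ^ (P (β i) * P (β j))) •
        ((inner A (G.E h j) - outer A (G.E h j)) * (inner A (G.E i q) - outer A (G.E i q))) := by
  rcases lt_or_ge (β q) (β i) with hq | hq
  · have h0 : ⁅hat (P ∘ β) i j (outer A (G.E i j)), G.E.map (inner A)⁆ h q = 0 :=
      RTTPair.lie_tri ((G.map (inner A)).E_tri) h q (by omega)
    rw [h0, G.triE i q hq.le, Matrix.one_apply_ne (by rintro rfl; omega)]
    simp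
  · have h0 := H.sc_E_E_flip hP hκ hij hq hh
    rw [lie_hat_apply (p := P ∘ β) (fun _ => hP _), ← mul_smul_comm]
    simp only [Function.comp_apply, Matrix.map_apply, hh]
    rw [h0, mul_smul_comm, mul_smul, mul_smul, neg_one_pow_smul, neg_one_pow_smul, ← mul_smul_comm,
      mul_smul_comm, ← mul_assoc, ← pow_add]
    congr 2
    rcases hP (β i) with h1 | h1 <;> rcases hP (β j) with h2 | h2 <;>
      simp [h1, h2, neg_one_pow_three]

theorem Rel.lie_E_E_swap {i j h : ι} (hij : β i ≤ β j) (hh : β h = β i) (q : ι) :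
    -diffC A • ⁅hat (P ∘ β) i j (inner A (G.E i j)), G.E.map (outer A)⁆ h q
      = (prodC A κ * (-1) ^ (P (β i) * P (β j))) •
        ((outer A (G.E h j) - inner A (G.E h j)) * (outer A (G.E i q) - inner A (G.E i q))) := by
  rcases lt_or_ge (β q) (β i) with hq | hq
  · have h0 : ⁅hat (P ∘ β) i j (inner A (G.E i j)), G.E.map (outer A)⁆ h q = 0 :=
      RTTPair.lie_tri ((G.map (outer A)).E_tri) h q (by omega)
    rw [h0, G.triE i q hq.le, Matrix.one_apply_ne (by rintro rfl; omega)]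
    simp
  · have h0 := H.sc_E_E hP hκ (p := h) (j := q) (h := i) (l := j) (by omega) (by omega) hh.symm
    rw [lie_hat_apply (p := P ∘ β) (fun _ => hP _), ← mul_smul_comm]
    simp only [Function.comp_apply, Matrix.map_apply]
    rw [hh] at h0 ⊢
    rw [sc_swap, mul_comm (P (β i) + P (β j)) (P (β i) + P (β q)), neg_smul, smul_neg, neg_neg,
      ← mul_smul_comm, h0, mul_smul_comm, mul_smul_comm, mul_smul, mul_smul, neg_one_pow_smul,
      neg_one_pow_smul, ← mul_assoc, ← mul_assoc, ← pow_add, ← pow_add,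
      ← neg_sub (inner A (G.E h j)), ← neg_sub (inner A (G.E i q)), neg_mul_neg]
    congr 2
    rcases hP (β i) with h1 | h1 <;> rcases hP (β j) with h2 | h2 <;>
      rcases hP (β q) with h3 | h3 <;> simp [h1, h2, h3, neg_one_pow_three, neg_one_pow_four,
        neg_one_pow_five, neg_one_pow_seven, neg_one_pow_nine]

end SuperRTT

/-! ### Series in three variables and the generating form of the cubic relation. -/

namespace SuperRTT

open Matrix PowerSeries

theorem sc_smul_right' {B K : Type} [Ring B] [CommRing K] [Algebra K B] (e : ℕ) (c : K) (x y : B) :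
    sc e x (c • y) = c • sc e x y := by
  simp only [sc, smul_mul_assoc, mul_smul_comm, smul_sub]

section ThreeVariables

variable {A : Type} [Ring A]

/-- The variables `u⁻¹`, `v⁻¹`, `w⁻¹` of a series in three variables, from the outer to the inner
one. -/
noncomputable def varU (A : Type) [Ring A] : Subring.center A⟦X⟧⟦X⟧⟦X⟧ := ⟨X, X_mem_center⟩

/-- See `varU`. -/
noncomputable def varV (A : Type) [Ring A] : Subring.center A⟦X⟧⟦X⟧⟦X⟧ :=
  ⟨C X, C_mem_center X_mem_center⟩

/-- See `varU`. -/
noncomputable def varW (A : Type) [Ring A] : Subring.center A⟦X⟧⟦X⟧⟦X⟧ :=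
  ⟨C (C X), C_mem_center (C_mem_center X_mem_center)⟩

/-- The inclusion of the series in `u⁻¹`, `v⁻¹`. -/
noncomputable def inclUV (A : Type) [Ring A] : A⟦X⟧⟦X⟧ →+* A⟦X⟧⟦X⟧⟦X⟧ :=
  PowerSeries.map (PowerSeries.map C)

/-- The inclusion of the series in `u⁻¹`, `w⁻¹`. -/
noncomputable def inclUW (A : Type) [Ring A] : A⟦X⟧⟦X⟧ →+* A⟦X⟧⟦X⟧⟦X⟧ := PowerSeries.map C

/-- The inclusion of the series in `v⁻¹`, `w⁻¹`. -/
noncomputable def inclVW (A : Type) [Ring A] : A⟦X⟧⟦X⟧ →+* A⟦X⟧⟦X⟧⟦X⟧ := C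

theorem inclUV_smul (Z : A⟦X⟧⟦X⟧) : inclUV A (diffC A • Z) = (varV A - varU A) • inclUV A Z := by
  rw [diffC_smul, ← sub_mul, map_mul, map_sub]
  change (inclUV A (C X) - inclUV A X) * _ = (C X - X) * _
  rw [inclUV, PowerSeries.map_C, PowerSeries.map_X, PowerSeries.map_X]

theorem inclUW_smul (Z : A⟦X⟧⟦X⟧) : inclUW A (diffC A • Z) = (varW A - varU A) • inclUW A Z := by
  rw [diffC_smul, ← sub_mul, map_mul, map_sub]
  change (inclUW A (C X) - inclUW A X) * _ = (C (C X) - X) * _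
  rw [inclUW, PowerSeries.map_C, PowerSeries.map_X]

theorem inclVW_smul (Z : A⟦X⟧⟦X⟧) : inclVW A (diffC A • Z) = (varW A - varV A) • inclVW A Z := by
  rw [diffC_smul, ← sub_mul, map_mul, map_sub]
  rfl

theorem inclUV_prodC (κ : ℤ) (Z : A⟦X⟧⟦X⟧) :
    inclUV A (prodC A κ • Z) = (κ • (varU A * varV A)) • inclUV A Z := by
  rw [prodC_smul, map_zsmul, map_mul, map_mul, smul_assoc, mul_smul]
  change κ • (inclUV A X * (inclUV A (C X) * _)) = κ • (X * (C X * _))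
  rw [inclUV, PowerSeries.map_C, PowerSeries.map_X, PowerSeries.map_X]

theorem inclUW_prodC (κ : ℤ) (Z : A⟦X⟧⟦X⟧) :
    inclUW A (prodC A κ • Z) = (κ • (varU A * varW A)) • inclUW A Z := by
  rw [prodC_smul, map_zsmul, map_mul, map_mul, smul_assoc, mul_smul]
  change κ • (inclUW A X * (inclUW A (C X) * _)) = κ • (X * (C (C X) * _))
  rw [inclUW, PowerSeries.map_C, PowerSeries.map_X]

theorem inclVW_prodC (κ : ℤ) (Z : A⟦X⟧⟦X⟧) :
    inclVW A (prodC A κ • Z) = (κ • (varV A * varW A)) • inclVW A Z := by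
  rw [prodC_smul, map_zsmul, map_mul, map_mul, smul_assoc, mul_smul]
  rfl

/-- The series in `u⁻¹` inside the series in three variables. -/
noncomputable def serU (A : Type) [Ring A] : A⟦X⟧ →+* A⟦X⟧⟦X⟧⟦X⟧ := PowerSeries.map (C.comp C)

/-- The series in `v⁻¹` inside the series in three variables. -/
noncomputable def serV (A : Type) [Ring A] : A⟦X⟧ →+* A⟦X⟧⟦X⟧⟦X⟧ := C.comp (PowerSeries.map C)

/-- The series in `w⁻¹` inside the series in three variables. -/
noncomputable def serW (A : Type) [Ring A] : A⟦X⟧ →+* A⟦X⟧⟦X⟧⟦X⟧ := C.comp C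

theorem inclUV_outer : (inclUV A).comp (outer A) = serU A := by
  ext f : 1
  ext n : 1
  simp [inclUV, serU]

theorem inclUV_inner : (inclUV A).comp (inner A) = serV A := by
  ext f : 1
  simp [inclUV, serV]

theorem inclUW_outer : (inclUW A).comp (outer A) = serU A := by
  ext f : 1
  ext n : 1
  simp [inclUW, serU]

theorem inclUW_inner : (inclUW A).comp (inner A) = serW A := by
  ext f : 1
  simp [inclUW, serW]

theorem inclVW_outer : (inclVW A).comp (outer A) = serV A := rfl

theorem inclVW_inner : (inclVW A).comp (inner A) = serW A := rfl

theorem C_mul_eq_zero {a : A} (ha : ∀ x, a * x = 0 → x = 0) {Z : A⟦X⟧} (h : C a * Z = 0) :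
    Z = 0 := by
  ext n
  have := congrArg (coeff n) h
  rw [coeff_C_mul, map_zero] at this
  rw [ha _ this, map_zero]

theorem X_mul_eq_zero {Z : A⟦X⟧} (h : X * Z = 0) : Z = 0 := by
  ext n
  have := congrArg (coeff (n + 1)) h
  rwa [coeff_succ_X_mul, map_zero] at this

/-- Induction on the degree: once the lower coefficients are zero, the next one is annihilated by
the regular element a. -/
theorem C_sub_X_mul_eq_zero {a : A} (ha : ∀ x, a * x = 0 → x = 0) {Z : A⟦X⟧}
    (h : (C a - X) * Z = 0) : Z = 0 := by
  rw [sub_mul, sub_eq_zero] at h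
  have : ∀ r, coeff r Z = 0 := by
    intro r
    induction r with
    | zero =>
      have := congrArg (coeff 0) h
      rw [coeff_C_mul] at this
      exact ha _ (by simpa using this)
    | succ r ih =>
      have := congrArg (coeff (r + 1)) h
      rw [coeff_C_mul, coeff_succ_X_mul, ih] at this
      exact ha _ this
  ext r
  simp [this]

theorem smul_eq_zero_of_three {Z : A⟦X⟧⟦X⟧⟦X⟧}
    (h : ((varV A - varU A) * (varW A - varU A) * (varW A - varV A)) • Z = 0) : Z = 0 := by
  rw [mul_assoc, mul_smul, mul_smul] at h
  have h1 := C_sub_X_mul_eq_zero (a := (X : A⟦X⟧⟦X⟧)) (fun _ => X_mul_eq_zero) h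
  have h2 := C_sub_X_mul_eq_zero (a := (C X : A⟦X⟧⟦X⟧))
    (fun _ => C_mul_eq_zero (fun _ => X_mul_eq_zero)) h1
  have h3 : (C (C X) - C X : A⟦X⟧⟦X⟧⟦X⟧) * Z = 0 := h2
  rw [← map_sub] at h3
  exact C_mul_eq_zero (fun _ => C_sub_X_mul_eq_zero (fun _ => X_mul_eq_zero)) h3

theorem coeff_sc_C_left (e n : ℕ) (a : A) (Z : A⟦X⟧) :
    coeff n (sc e (C a) Z) = sc e a (coeff n Z) := by
  rw [sc, map_sub, coeff_C_mul, coeff_neg_one_pow_mul, coeff_mul_C, sc]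

theorem coeff_sc_C_right (e n : ℕ) (a : A) (Z : A⟦X⟧) :
    coeff n (sc e Z (C a)) = sc e (coeff n Z) a := by
  rw [sc, map_sub, coeff_mul_C, coeff_neg_one_pow_mul, coeff_C_mul, sc]

theorem coeff_sc_serU_sc (e e' r s l : ℕ) (a b c : A⟦X⟧) :
    coeff l (coeff s (coeff r (sc e (serU A a) (sc e' (serV A b) (serW A c)))))
      = sc e (coeff r a) (sc e' (coeff s b) (coeff l c)) := by
  have : sc e' (serV A b) (serW A c) = C (sc e' (PowerSeries.map C b) (C c)) := by
    simp [sc, serV, serW]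
  rw [this, coeff_sc_C_right, serU, coeff_map, RingHom.comp_apply, coeff_sc_C_left,
    coeff_sc_C_right, coeff_map, coeff_sc_C_left, coeff_sc_C_left]

theorem coeff_sc_serV_sc (e e' r s l : ℕ) (a b c : A⟦X⟧) :
    coeff l (coeff s (coeff r (sc e (serV A a) (sc e' (serU A b) (serW A c)))))
      = sc e (coeff s a) (sc e' (coeff r b) (coeff l c)) := by
  rw [serV, serW, RingHom.comp_apply, RingHom.comp_apply, coeff_sc_C_left, coeff_sc_C_right, serU,
    coeff_map, RingHom.comp_apply]
  have : sc e' (C (C (coeff r b))) (C c) = C (sc e' (C (coeff r b)) c) := by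
    simp [sc]
  rw [this, coeff_sc_C_right, coeff_map, coeff_sc_C_left, coeff_sc_C_left]

end ThreeVariables

variable {ι : Type} [Fintype ι] [DecidableEq ι]

/-- By `hin` the inner bracket is, up to scalars, an entry of E(v)E'(w), so the double bracket is
computed by `lie_E_mul_E'`. -/
theorem triple_bracket {B : Type} [Ring B] {K : Type} [CommRing K] [Algebra K B] {β : ι → ℕ}
    {p : ι → ℕ} (hp : ∀ i, p i = 0 ∨ p i = 1) {U V W : LDU β B} {cv cw dv dw c d : K}
    {i j h k g : ι} {x : B} {e : ℕ} (hih : β h = β i) (hij : β i < β j) (hjg : β j < β g)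
    (hv : ∀ q, cv • ⁅hat p i j x, V.E⁆ h q = dv • ((V.E - U.E) h j * (V.E - U.E) i q))
    (hw : ∀ q, cw • ⁅hat p i j x, W.E⁆ h q = dw • ((W.E - U.E) h j * (W.E - U.E) i q))
    (hw' : ∀ q, β i < β q →
      cw • ⁅hat p i j x, W.E'⁆ q g = dw • (if q = j then (U.E * W.E') i g else 0))
    (hin : c • sc e (V.E h k) (W.E k g) = d • (V.E * W.E') h g) :
    (cv * cw * c) • sc ((p i + p j) * (p h + p g)) x (sc e (V.E h k) (W.E k g))
      = ((-1) ^ ((p i + p j) * p h) * d) •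
        ((cw * dv) • ((V.E - U.E) h j * ((V.E * W.E') i g - (U.E * W.E') i g))
        + (cv * dw) • ((V.E - U.E) h j * (U.E * W.E') i g)) := by
  rw [← lie_E_mul_E' hih hij hjg hv hw hw', mul_smul _ c, ← sc_smul_right', hin, sc_smul_right',
    sc_eq_lie_hat hp, mul_smul ((-1 : K) ^ _), neg_one_pow_smul]
  simp only [mul_smul_comm]
  rw [smul_comm (cv * cw)]

variable {A : Type} [Ring A] {β : ι → ℕ} {P : ℕ → ℕ} {κ : ℤ} {G : LDU β A⟦X⟧}
  (hP : ∀ n, P n = 0 ∨ P n = 1) (H : Rel (P ∘ β) κ G.T) (hκ : κ = 1 ∨ κ = -1)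

/-! ### Two-variable identities carried along a ring homomorphism, later one of the three inclusions
into series in three variables. -/

section Transport

variable {B : Type} [Ring B] {K : Type} [CommRing K] [Algebra K B] {ψ : A⟦X⟧⟦X⟧ →+* B}
  {φ φ' : A⟦X⟧ →+* B} {c d : K} (hc : ∀ Z, ψ (diffC A • Z) = c • ψ Z)
  (hd : ∀ Z, ψ (prodC A κ • Z) = d • ψ Z) (ho : ψ.comp (outer A) = φ) (hi : ψ.comp (inner A) = φ')

include hP H hc hd ho hi

include hκ in
theorem Rel.map_lie_E_E {i j h : ι} (hij : β i ≤ β j) (hh : β h = β i) (q : ι) :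
    c • ⁅hat (P ∘ β) i j ((G.map φ).E i j), (G.map φ').E⁆ h q
      = (d * (-1) ^ (P (β i) * P (β j))) •
        (((G.map φ').E - (G.map φ).E) h j * ((G.map φ').E - (G.map φ).E) i q) := by
  have h0 := congrArg ψ (H.lie_E_E hP hκ hij hh q)
  rw [hc, mul_smul, hd, neg_one_pow_smul, map_lie_hat] at h0
  subst ho hi
  rw [mul_smul, neg_one_pow_smul]
  simp only [map_mul, map_sub, map_pow, map_neg, map_one, Matrix.map_map] at h0
  exact h0

include hκ in
theorem Rel.map_lie_E_E_swap {i j h : ι} (hij : β i ≤ β j) (hh : β h = β i) (q : ι) :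
    (-c) • ⁅hat (P ∘ β) i j ((G.map φ').E i j), (G.map φ).E⁆ h q
      = (d * (-1) ^ (P (β i) * P (β j))) •
        (((G.map φ).E - (G.map φ').E) h j * ((G.map φ).E - (G.map φ').E) i q) := by
  have h0 := congrArg ψ (H.lie_E_E_swap hP hκ hij hh q)
  rw [neg_smul, map_neg, hc, mul_smul, hd, neg_one_pow_smul, map_lie_hat] at h0
  subst ho hi
  rw [mul_smul, neg_one_pow_smul, neg_smul]
  simp only [map_mul, map_sub, map_pow, map_neg, map_one, Matrix.map_map] at h0
  exact h0

theorem Rel.map_lie_E_E' {i j g : ι} (hij : β i ≤ β j) (hg : β j < β g) (q : ι) (hq : β i < β q) :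
    c • ⁅hat (P ∘ β) i j ((G.map φ).E i j), (G.map φ').E'⁆ q g
      = (d * (-1) ^ (P (β i) * P (β j))) •
        (if q = j then ((G.map φ).E * (G.map φ').E') i g else 0) := by
  have h0 := congrArg ψ ((H.rttPair hP).lie_E_E' hij hg hq)
  rw [hc, mul_smul, hd, neg_one_pow_smul, map_lie_hat] at h0
  subst ho hi
  rw [mul_smul, neg_one_pow_smul]
  refine h0.trans ?_
  rw [map_mul, map_pow, map_neg, map_one]
  congr 2
  split_ifs
  · rw [Matrix.mul_apply, Matrix.mul_apply, map_sum]
    exact Finset.sum_congr rfl fun _ _ => map_mul _ _ _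
  · exact map_zero ψ

theorem Rel.map_sc_E_E_next {h k g : ι} (hk : β k = β h + 1) (hg : β g = β k + 1) :
    c • sc ((P (β h) + P (β k)) * (P (β k) + P (β g))) ((G.map φ).E h k) ((G.map φ').E k g)
      = -(d * (-1) ^ P (β k)) • ((G.map φ).E * (G.map φ').E') h g := by
  have h0 := congrArg ψ (H.sc_E_E' hP (p := h) (j := k) (h := k) (k := g) (by omega) (by omega)
    (by omega))
  rw [hc, mul_smul, hd, neg_one_pow_smul, if_pos rfl, G.E'_apply_of_adjacent hg, map_neg,
    sc_neg_right, map_neg, smul_neg, neg_eq_iff_eq_neg] at h0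
  subst ho hi
  rw [neg_smul, mul_smul, neg_one_pow_smul]
  have e1 : ψ (sc ((P (β h) + P (β k)) * (P (β k) + P (β g))) (outer A (G.E h k))
      (inner A (G.E k g))) = sc ((P (β h) + P (β k)) * (P (β k) + P (β g)))
        ((G.map (ψ.comp (outer A))).E h k) ((G.map (ψ.comp (inner A))).E k g) := by
    simp only [sc, map_sub, map_mul, map_pow, map_neg, map_one]
    rfl
  rw [← e1, h0, map_mul, map_pow, map_neg, map_one]
  congr 3
  · rcases hP (β h) with h1 | h1 <;> rcases hP (β k) with h2 | h2 <;>
      simp [h1, h2, neg_one_pow_three]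
  · rw [Matrix.mul_apply, Matrix.mul_apply, map_sum]
    exact Finset.sum_congr rfl fun _ _ => map_mul _ _ _

end Transport

include hP H hκ

/-- Put y₁ = (E(v)E'(w))_ig and y₂ = (E(u)E'(w))_ig. Multiplied by (v⁻¹ - u⁻¹)(w⁻¹ - u⁻¹)(w⁻¹ -
v⁻¹), the first bracket becomes a sign times u⁻¹v⁻¹w⁻¹ (E(v) - E(u))_hj (v⁻¹(w⁻¹ - u⁻¹) y₁ - u⁻¹(w⁻¹
- v⁻¹) y₂). This is symmetric in u and v while the multiplier is antisymmetric and regular, so the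
two brackets add up to zero. -/
theorem Rel.cubic_series {i j h k g : ι} (hh : β h = β i) (hj : β j = β i + 1)
    (hk : β k = β j) (hg : β g = β k + 1) :
    sc ((P (β i) + P (β j)) * (P (β h) + P (β g))) (serU A (G.E i j))
        (sc ((P (β h) + P (β k)) * (P (β k) + P (β g))) (serV A (G.E h k)) (serW A (G.E k g)))
      + sc ((P (β i) + P (β j)) * (P (β h) + P (β g))) (serV A (G.E i j))
        (sc ((P (β h) + P (β k)) * (P (β k) + P (β g))) (serU A (G.E h k)) (serW A (G.E k g)))
      = 0 := by
  have hij : β i ≤ β j := by omega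
  have hjg : β j < β g := by omega
  have t1 := triple_bracket (p := P ∘ β) (fun _ => hP _) (U := G.map (serU A))
    (V := G.map (serV A)) (W := G.map (serW A)) hh (by omega) hjg
    (H.map_lie_E_E hP hκ inclUV_smul (inclUV_prodC κ) inclUV_outer inclUV_inner hij hh)
    (H.map_lie_E_E hP hκ inclUW_smul (inclUW_prodC κ) inclUW_outer inclUW_inner hij hh)
    (H.map_lie_E_E' hP inclUW_smul (inclUW_prodC κ) inclUW_outer inclUW_inner hij hjg)
    (H.map_sc_E_E_next hP inclVW_smul (inclVW_prodC κ) inclVW_outer inclVW_inner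
      (h := h) (k := k) (by omega) hg)
  have t2 := triple_bracket (p := P ∘ β) (fun _ => hP _) (U := G.map (serV A))
    (V := G.map (serU A)) (W := G.map (serW A)) hh (by omega) hjg
    (H.map_lie_E_E_swap hP hκ inclUV_smul (inclUV_prodC κ) inclUV_outer inclUV_inner hij hh)
    (H.map_lie_E_E hP hκ inclVW_smul (inclVW_prodC κ) inclVW_outer inclVW_inner hij hh)
    (H.map_lie_E_E' hP inclVW_smul (inclVW_prodC κ) inclVW_outer inclVW_inner hij hjg)
    (H.map_sc_E_E_next hP inclUW_smul (inclUW_prodC κ) inclUW_outer inclUW_inner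
      (h := h) (k := k) (by omega) hg)
  refine smul_eq_zero_of_three ?_
  simp only [Matrix.sub_apply, Function.comp_apply] at t1 t2
  generalize ((G.map (serV A)).E * (G.map (serW A)).E') i g = y1 at *
  generalize ((G.map (serU A)).E * (G.map (serW A)).E') i g = y2 at *
  change ((varV A - varU A) * (varW A - varU A) * (varW A - varV A)) • sc _ (serU A (G.E i j))
    (sc _ (serV A (G.E h k)) (serW A (G.E k g))) = _ at t1
  change (-(varV A - varU A) * (varW A - varV A) * (varW A - varU A)) • sc _ (serV A (G.E i j))
    (sc _ (serU A (G.E h k)) (serW A (G.E k g))) = _ at t2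
  simp only [sub_mul, mul_sub] at t1 t2
  linear_combination (norm := module) t1 - t2

end SuperRTT

namespace SuperRTT

open Matrix PowerSeries MulOpposite

variable {ι : Type} [Fintype ι] [DecidableEq ι] {A : Type} [Ring A]

/-! ### The opposite algebra and the inverse matrix -/

/-- A series regarded as a series over the opposite ring. -/
noncomputable def opSeries (f : A⟦X⟧) : Aᵐᵒᵖ⟦X⟧ := PowerSeries.mk fun n => op (coeff n f)

theorem coeff_opSeries (n : ℕ) (f : A⟦X⟧) : coeff n (opSeries f) = op (coeff n f) :=
  coeff_mk _ _

theorem opSeries_mul (f g : A⟦X⟧) : opSeries (f * g) = opSeries g * opSeries f := by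
  ext n
  rw [coeff_opSeries, coeff_mul, coeff_mul, ← Finset.Nat.sum_antidiagonal_swap, Finset.op_sum]
  simp [coeff_opSeries]

theorem opSeries_zero : opSeries (0 : A⟦X⟧) = 0 := by ext; simp [coeff_opSeries]

theorem opSeries_one : opSeries (1 : A⟦X⟧) = 1 := by
  ext n; rw [coeff_opSeries, coeff_one, coeff_one]; split_ifs <;> rfl

theorem opSeries_sum {α : Type} (s : Finset α) (f : α → A⟦X⟧) :
    opSeries (∑ x ∈ s, f x) = ∑ x ∈ s, opSeries (f x) := by
  ext n; simp [coeff_opSeries]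

/-- The transpose of a matrix of series, with entries in the opposite ring. -/
noncomputable def opMatrix (M : Matrix ι ι A⟦X⟧) : Matrix ι ι Aᵐᵒᵖ⟦X⟧ :=
  Matrix.of fun i j => opSeries (M j i)

theorem opMatrix_apply (M : Matrix ι ι A⟦X⟧) (i j : ι) : opMatrix M i j = opSeries (M j i) := rfl

theorem opMatrix_mul (M N : Matrix ι ι A⟦X⟧) : opMatrix (M * N) = opMatrix N * opMatrix M := by
  ext1 i j
  rw [opMatrix_apply, Matrix.mul_apply, Matrix.mul_apply, opSeries_sum]
  exact Finset.sum_congr rfl fun _ _ => opSeries_mul _ _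

theorem opMatrix_one : opMatrix (1 : Matrix ι ι A⟦X⟧) = 1 := by
  ext1 i j
  rw [opMatrix_apply, Matrix.one_apply, Matrix.one_apply]
  by_cases h : i = j
  · simp [h, opSeries_one]
  · simp [h, Ne.symm h, opSeries_zero]

/-- The decomposition of the transpose over the opposite ring. -/
noncomputable def LDU.opposite {β : ι → ℕ} (G : LDU β A⟦X⟧) : LDU β Aᵐᵒᵖ⟦X⟧ where
  F := opMatrix G.E
  D := opMatrix G.D
  E := opMatrix G.F
  F' := opMatrix G.E'
  D' := opMatrix G.D'
  E' := opMatrix G.F'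
  mul_F' := by rw [← opMatrix_mul, G.E'_mul, opMatrix_one]
  F'_mul := by rw [← opMatrix_mul, G.mul_E', opMatrix_one]
  mul_D' := by rw [← opMatrix_mul, G.D'_mul, opMatrix_one]
  D'_mul := by rw [← opMatrix_mul, G.mul_D', opMatrix_one]
  mul_E' := by rw [← opMatrix_mul, G.F'_mul, opMatrix_one]
  E'_mul := by rw [← opMatrix_mul, G.mul_F', opMatrix_one]
  triF i j h := by rw [opMatrix_apply, G.triE _ _ h, ← opMatrix_apply, opMatrix_one]
  triF' i j h := by rw [opMatrix_apply, G.triE' _ _ h, ← opMatrix_apply, opMatrix_one]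
  triD i j h := by rw [opMatrix_apply, G.triD _ _ h.symm, opSeries_zero]
  triD' i j h := by rw [opMatrix_apply, G.triD' _ _ h.symm, opSeries_zero]
  triE i j h := by rw [opMatrix_apply, G.triF _ _ h, ← opMatrix_apply, opMatrix_one]
  triE' i j h := by rw [opMatrix_apply, G.triF' _ _ h, ← opMatrix_apply, opMatrix_one]

theorem LDU.opposite_T {β : ι → ℕ} (G : LDU β A⟦X⟧) : G.opposite.T = opMatrix G.T := by
  unfold LDU.T
  rw [opMatrix_mul, opMatrix_mul, ← mul_assoc]
  rfl

theorem sc_op (e : ℕ) (x y : A) : sc e (op x) (op y) = op (sc e y x) := by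
  rcases neg_one_pow_eq_or A e with h | h <;> rcases Nat.even_or_odd e with h' | h' <;>
    simp [sc, h'.neg_one_pow]

/-- Reversing products exchanges the two terms on the right, which compensates for the minus sign
from reversing the supercommutator. The parameter κ is therefore unchanged. -/
theorem Rel.opposite {p : ι → ℕ} {κ : ℤ} {T : Matrix ι ι A⟦X⟧} (hp : ∀ i, p i = 0 ∨ p i = 1)
    (H : Rel p κ T) : Rel p κ (opMatrix T) where
  zero_left i j h k s := by
    rw [opMatrix_apply, opMatrix_apply, coeff_opSeries, coeff_opSeries, sc_op,
      show (p i + p j) * (p h + p k) = (p k + p h) * (p j + p i) by ring, H.zero_right, op_zero]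
  zero_right i j h k r := by
    rw [opMatrix_apply, opMatrix_apply, coeff_opSeries, coeff_opSeries, sc_op,
      show (p i + p j) * (p h + p k) = (p k + p h) * (p j + p i) by ring, H.zero_left, op_zero]
  comm i j h k r s := by
    have h1 : ∀ a b : A, sc ((p i + p j) * (p h + p k)) (op a) (op b)
        = -((-1 : ℤ) ^ ((p i + p j) * (p h + p k))) •
          op (sc ((p j + p i) * (p k + p h)) a b) := by
      intro a b
      rw [sc_swap, sc_op, neg_one_pow_mul_eq_smul, neg_smul,
        show (p i + p j) * (p h + p k) = (p j + p i) * (p k + p h) by ring]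
    simp only [opMatrix_apply, coeff_opSeries]
    rw [h1, h1, ← smul_sub, ← op_sub, H.comm, neg_one_pow_mul_eq_smul, neg_one_pow_mul_eq_smul,
      ← op_mul, ← op_mul, ← op_sub, op_smul, op_smul, smul_smul, smul_smul, smul_smul,
      show ∀ a b : A, op (a - b) = (-1 : ℤ) • op (b - a) by intro a b; simp, smul_smul]
    congr 1
    rcases hp i with e1 | e1 <;> rcases hp j with e2 | e2 <;> rcases hp h with e3 | e3 <;>
      rcases hp k with e4 | e4 <;> simp [e1, e2, e3, e4, pow_succ]

end SuperRTT

namespace SuperRTT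

open Matrix PowerSeries MulOpposite

variable {ι : Type} [Fintype ι] [DecidableEq ι] {A : Type} [Ring A]

/-- The decomposition of the inverse matrix, with the order of the blocks reversed. -/
def LDU.rev {β : ι → ℕ} {B : Type} [Ring B] (G : LDU β B) (L : ℕ) (hL : ∀ x, β x ≤ L) :
    LDU (fun x => L - β x) B where
  F := G.E'
  D := G.D'
  E := G.F'
  F' := G.E
  D' := G.D
  E' := G.F
  mul_F' := G.E'_mul
  F'_mul := G.mul_E'
  mul_D' := G.D'_mul
  D'_mul := G.mul_D'
  mul_E' := G.F'_mul
  E'_mul := G.mul_F'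
  triF i j h := G.triE' i j (by have := hL i; have := hL j; omega)
  triF' i j h := G.triE i j (by have := hL i; have := hL j; omega)
  triD i j h := G.triD' i j fun e => h (by rw [e])
  triD' i j h := G.triD i j fun e => h (by rw [e])
  triE i j h := G.triF' i j (by have := hL i; have := hL j; omega)
  triE' i j h := G.triF i j (by have := hL i; have := hL j; omega)

theorem sc_op_sc (e e' : ℕ) (x y z : A) :
    sc e (op x) (sc e' (op y) (op z)) = ((-1 : ℤ) ^ (e + e')) • op (sc e x (sc e' y z)) := by
  rw [sc_op, sc_op, sc_swap e' z y, sc_swap e _ x, neg_one_pow_mul_eq_smul,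
    neg_one_pow_mul_eq_smul, sc_neg_right, sc_smul_right, smul_neg, neg_neg, smul_smul, ← pow_add,
    op_smul]

theorem smul_neg_one_pow_eq_zero {M : Type} [AddCommGroup M] {n : ℕ} {x : M}
    (h : ((-1 : ℤ) ^ n) • x = 0) : x = 0 := by
  rcases neg_one_pow_eq_or ℤ n with e | e <;> simpa [e] using h

theorem sc_eq_zero_of_swap {e : ℕ} {x y : A} (h : sc e y x = 0) : sc e x y = 0 := by
  rw [sc_swap, h, mul_zero, neg_zero]

variable {β : ι → ℕ} {P : ℕ → ℕ} (hP : ∀ n, P n = 0 ∨ P n = 1) {κ : ℤ}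

section op

variable (G : LDU β A⟦X⟧) (r : ℕ) (i j : ι)

theorem LDU.coeff_op_E : coeff r (G.opposite.E i j) = op (coeff r (G.F j i)) := coeff_opSeries _ _
theorem LDU.coeff_op_F : coeff r (G.opposite.F i j) = op (coeff r (G.E j i)) := coeff_opSeries _ _
theorem LDU.coeff_op_D : coeff r (G.opposite.D i j) = op (coeff r (G.D j i)) := coeff_opSeries _ _
theorem LDU.coeff_op_E' : coeff r (G.opposite.E' i j) = op (coeff r (G.F' j i)) := coeff_opSeries _ _
theorem LDU.coeff_op_F' : coeff r (G.opposite.F' i j) = op (coeff r (G.E' j i)) := coeff_opSeries _ _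

end op

variable {G : LDU β A⟦X⟧} (H : Rel (P ∘ β) κ G.T)

include hP H

theorem Rel.op_T : Rel (P ∘ β) κ G.opposite.T := by
  rw [G.opposite_T]; exact H.opposite fun _ => hP _

/-- Reversing the block order makes E' lower and F' upper, so T' = E'D'F' is again of the form FDE.
Its parameter is -κ, which is why the earlier relations are proved for κ = ±1. -/
theorem Rel.rev_T (L : ℕ) (hL : ∀ x, β x ≤ L) :
    Rel ((fun n => P (L - n)) ∘ fun x => L - β x) (-κ) (G.rev L hL).T := by
  have : ((fun n => P (L - n)) ∘ fun x => L - β x) = P ∘ β := by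
    funext x
    simp [Nat.sub_sub_self (hL x)]
  rw [this]
  exact H.inv (fun _ => hP _) G.mul_T' G.T'_mul

/-! ### Cubic relations -/

/-- For f ≠ k the inner brackets vanish; for f = k this is the coefficient form of
`Rel.cubic_series`. -/
theorem Rel.cubic_next (hκ : κ = 1 ∨ κ = -1) {i j h k f g : ι} (hh : β h = β i)
    (hj : β j = β i + 1) (hk : β k = β j) (hf : β f = β k) (hg : β g = β f + 1) (r s l : ℕ) :
    sc ((P (β i) + P (β j)) * (P (β h) + P (β k) + (P (β f) + P (β g)))) (coeff r (G.E i j))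
        (sc ((P (β h) + P (β k)) * (P (β f) + P (β g))) (coeff s (G.E h k)) (coeff l (G.E f g)))
      + sc ((P (β i) + P (β j)) * (P (β h) + P (β k) + (P (β f) + P (β g)))) (coeff s (G.E i j))
        (sc ((P (β h) + P (β k)) * (P (β f) + P (β g))) (coeff r (G.E h k)) (coeff l (G.E f g)))
      = 0 := by
  by_cases hfk : f = k
  · subst hfk
    have h0 := congrArg (fun x => coeff l (coeff s (coeff r x))) (H.cubic_series hP hκ hh hj hk hg)
    simp only [map_add, map_zero, coeff_sc_serU_sc, coeff_sc_serV_sc] at h0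
    -- In the sum of the parities of the two inner generators the common index is counted twice.
    have he : ∀ a b c d e : ℕ, (a + b) * (c + d + (d + e)) % 2 = (a + b) * (c + e) % 2 := by
      intro a b c d e
      rw [show (a + b) * (c + d + (d + e)) = (a + b) * (c + e) + (a + b) * d * 2 by ring,
        Nat.add_mul_mod_self_right]
    rw [sc_congr (he _ _ _ _ _), sc_congr (he _ _ _ _ _)]
    exact h0
  · rw [H.E_E_eq_zero hP (by omega) hg (by omega) (by omega) hfk,
      H.E_E_eq_zero hP (by omega) hg (by omega) (by omega) hfk, sc_zero_right, sc_zero_right,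
      add_zero]

/-- The transpose over the opposite ring, inverted and with blocks reversed, turns the block before
into the block after. Its E-entries between adjacent blocks are those of E' transposed, that is, -E;
the three minus signs give a common factor. -/
theorem Rel.cubic_prev (hκ : κ = 1 ∨ κ = -1) {i j h k f g : ι} (hh : β h = β i)
    (hj : β j = β i + 1) (hk : β k = β j) (hf : β i = β f + 1) (hg : β g = β i) (r s l : ℕ) :
    sc ((P (β i) + P (β j)) * (P (β h) + P (β k) + (P (β f) + P (β g)))) (coeff r (G.E i j))
        (sc ((P (β h) + P (β k)) * (P (β f) + P (β g))) (coeff s (G.E h k)) (coeff l (G.E f g)))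
      + sc ((P (β i) + P (β j)) * (P (β h) + P (β k) + (P (β f) + P (β g)))) (coeff s (G.E i j))
        (sc ((P (β h) + P (β k)) * (P (β f) + P (β g))) (coeff r (G.E h k)) (coeff l (G.E f g)))
      = 0 := by
  have hL : ∀ x, β x ≤ Finset.univ.sup β := fun x => Finset.le_sup (Finset.mem_univ x)
  generalize Finset.univ.sup β = L at hL
  have Li := hL i; have Lj := hL j; have Lh := hL h; have Lk := hL k
  have Lf := hL f; have Lg := hL g
  have h0 := ((H.op_T hP).rev_T hP L hL).cubic_next (fun n => hP _) (i := j) (j := i) (h := k)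
    (k := h) (f := g) (g := f) (by rcases hκ with h | h <;> simp [h]) (by rw [hk])
    (by omega) (by rw [hh]) (by rw [hg, hh]) (by omega) r s l
  have hE : ∀ {x y : ι} (n : ℕ), β y = β x + 1 →
      coeff n ((G.opposite.rev L hL).E y x) = -op (coeff n (G.E x y)) := by
    intro x y n hxy
    change coeff n (G.opposite.F' y x) = _
    rw [G.coeff_op_F', G.E'_apply_of_adjacent hxy, map_neg, op_neg]
  simp only [hE _ hj, hE _ (show β k = β h + 1 by omega), hE _ (show β g = β f + 1 by omega),
    Nat.sub_sub_self Li, Nat.sub_sub_self Lj, Nat.sub_sub_self Lh, Nat.sub_sub_self Lk,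
    Nat.sub_sub_self Lf, Nat.sub_sub_self Lg] at h0
  have hn : ∀ (e e' : ℕ) (x y z : Aᵐᵒᵖ), sc e (-x) (sc e' (-y) (-z)) = -sc e x (sc e' y z) := by
    intro e e' x y z
    simp only [sc, mul_neg, neg_mul, mul_sub, sub_mul, neg_neg]
    abel
  simp only [hn, sc_op_sc] at h0
  rw [← neg_add, neg_eq_zero, ← smul_add, ← op_add] at h0
  have h1 := op_injective ((smul_neg_one_pow_eq_zero h0).trans op_zero.symm)
  rw [add_comm (P (β i)), add_comm (P (β h)), add_comm (P (β f))]
  exact h1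

theorem Rel.cubic (hκ : κ = 1 ∨ κ = -1) {i j h k f g : ι} (hh : β h = β i) (hj : β j = β i + 1)
    (hk : β k = β j) (hf : β f ≠ β i) (hg : β g = β f + 1) (r s l : ℕ) :
    sc ((P (β i) + P (β j)) * (P (β h) + P (β k) + (P (β f) + P (β g)))) (coeff r (G.E i j))
        (sc ((P (β h) + P (β k)) * (P (β f) + P (β g))) (coeff s (G.E h k)) (coeff l (G.E f g)))
      + sc ((P (β i) + P (β j)) * (P (β h) + P (β k) + (P (β f) + P (β g)))) (coeff s (G.E i j))
        (sc ((P (β h) + P (β k)) * (P (β f) + P (β g))) (coeff r (G.E h k)) (coeff l (G.E f g)))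
      = 0 := by
  rcases lt_trichotomy (β f) (β i + 1) with h1 | h1 | h1
  · rcases (show β f + 1 < β i ∨ β i = β f + 1 by omega) with h2 | h2
    · have hz : ∀ n, sc ((P (β h) + P (β k)) * (P (β f) + P (β g))) (coeff n (G.E h k))
          (coeff l (G.E f g)) = 0 := fun n => by
        rw [mul_comm]
        exact sc_eq_zero_of_swap (H.E_E_eq_zero hP (by omega) (by omega) (by omega) (by omega)
          (fun e => by rw [e] at hh; omega) _ _)
      rw [hz, hz, sc_zero_right, sc_zero_right, add_zero]
    · exact H.cubic_prev hP hκ hh hj hk h2 (by omega) r s l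
  · exact H.cubic_next hP hκ hh hj hk (by omega) hg r s l
  · have hz : ∀ n, sc ((P (β h) + P (β k)) * (P (β f) + P (β g))) (coeff n (G.E h k))
          (coeff l (G.E f g)) = 0 := fun n =>
        H.E_E_eq_zero hP (by omega) (by omega) (by omega) (by omega)
          (fun e => by rw [e] at h1; omega) _ _
    rw [hz, hz, sc_zero_right, sc_zero_right, add_zero]

/-! ### Relations for `F` -/

theorem Rel.cubic_F (hκ : κ = 1 ∨ κ = -1) {i j h k f g : ι} (hk : β k = β j) (hi : β i = β j + 1)
    (hh : β h = β i) (hg : β g ≠ β j) (hf : β f = β g + 1) (r s l : ℕ) :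
    sc ((P (β i) + P (β j)) * (P (β h) + P (β k) + (P (β f) + P (β g)))) (coeff r (G.F i j))
        (sc ((P (β h) + P (β k)) * (P (β f) + P (β g))) (coeff s (G.F h k)) (coeff l (G.F f g)))
      + sc ((P (β i) + P (β j)) * (P (β h) + P (β k) + (P (β f) + P (β g)))) (coeff s (G.F i j))
        (sc ((P (β h) + P (β k)) * (P (β f) + P (β g))) (coeff r (G.F h k)) (coeff l (G.F f g)))
      = 0 := by
  have h0 := (H.op_T hP).cubic hP hκ hk hi hh hg hf r s l
  simp only [LDU.coeff_op_E, sc_op_sc] at h0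
  rw [← smul_add, ← op_add] at h0
  have h1 := op_injective ((smul_neg_one_pow_eq_zero h0).trans op_zero.symm)
  rw [add_comm (P (β i)), add_comm (P (β h)), add_comm (P (β f))]
  exact h1

theorem Rel.quartic_F (hF : ∀ i j, coeff 0 (G.F i j) = (1 : Matrix ι ι A) i j)
    (hF' : ∀ i j, coeff 0 (G.F' i j) = (1 : Matrix ι ι A) i j) {i j h k h₀ k₀ f g : ι}
    (hi : β i = β j + 1) (hk : β k = β i) (hh : β h = β k + 1) (hk₀ : β k₀ = β k)
    (hh₀ : β h₀ = β h) (hg : β g = β h) (hf : β f = β g + 1) (r s : ℕ) :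
    sc ((P (β i) + P (β j) + (P (β h) + P (β k))) * (P (β h₀) + P (β k₀) + (P (β f) + P (β g))))
      (sc ((P (β i) + P (β j)) * (P (β h) + P (β k))) (coeff r (G.F i j)) (coeff 1 (G.F h k)))
      (sc ((P (β h₀) + P (β k₀)) * (P (β f) + P (β g))) (coeff 1 (G.F h₀ k₀))
        (coeff s (G.F f g))) = 0 := by
  have ho : ∀ i j, op ((1 : Matrix ι ι A) j i) = (1 : Matrix ι ι Aᵐᵒᵖ) i j := by
    intro i j
    rw [Matrix.one_apply, Matrix.one_apply]
    by_cases e : i = j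
    · simp [e]
    · simp [e, Ne.symm e]
  have h0 := (H.op_T hP).quartic hP (fun i j => by rw [LDU.coeff_op_E, hF, ho])
    (fun i j => by rw [LDU.coeff_op_E', hF', ho]) hi hk hh hk₀ hh₀ hg hf r s
  simp only [LDU.coeff_op_E, sc_op] at h0
  have h1 := op_injective (h0.trans op_zero.symm)
  rw [sc_swap _ _ (coeff r (G.F i j)), sc_swap _ _ (coeff 1 (G.F h₀ k₀)),
    neg_one_pow_mul_eq_smul, neg_one_pow_mul_eq_smul, ← neg_smul, ← neg_smul, sc_smul_left,
    sc_smul_right, neg_smul, neg_smul, neg_eq_zero] at h1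
  have h2 := sc_eq_zero_of_swap (smul_neg_one_pow_eq_zero (neg_eq_zero.1 (smul_neg_one_pow_eq_zero h1)))
  rw [add_comm (P (β i)), add_comm (P (β h)), add_comm (P (β f)), add_comm (P (β h₀))]
  exact h2

theorem Rel.D_F {i j h k : ι} (hij : β i = β j) (hk : β k = β i) (hh : β k < β h) (r : ℕ) {s : ℕ}
    (hs : 1 ≤ s) :
    sc 0 (coeff r (G.D i j)) (coeff s (G.F h k))
      = if k = i then -(κ • ((-1) ^ P (β i) * ∑ t ∈ Finset.range r, ∑ p,
          coeff (r + s - 1 - t) (G.F h p) * coeff t (G.D p j))) else 0 := by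
  have h0 := (H.op_T hP).D_E hP hij.symm (hk.trans hij) (by omega : β j < β h) r s hs
  simp only [LDU.coeff_op_E, LDU.coeff_op_D, sc_op] at h0
  rw [sc_swap, pow_zero, one_mul, ← unop_op (sc 0 _ _), h0]
  split_ifs
  · rw [neg_one_pow_mul_eq_smul, neg_one_pow_mul_eq_smul, hij]
    simp only [unop_smul, Finset.unop_sum, unop_mul, unop_op]
  · simp

theorem Rel.D_F_next {i j h k : ι} (hij : β i = β j) (hh : β h = β k + 1) (hi : β h = β i) (r : ℕ)
    {s : ℕ} (hs : 1 ≤ s) :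
    sc ((P (β i) + P (β j)) * (P (β h) + P (β k))) (coeff r (G.D i j)) (coeff s (G.F h k))
      = κ • ((-1) ^ P (β h) * ∑ t ∈ Finset.range r,
          coeff (r + s - 1 - t) (G.F i k) * coeff t (G.D h j)) := by
  have h0 := (H.op_T hP).D_E_next hP hij.symm hh (hi.trans hij) r s hs
  simp only [LDU.coeff_op_E, LDU.coeff_op_D, sc_op] at h0
  rw [show (P (β i) + P (β j)) * (P (β h) + P (β k))
    = (P (β k) + P (β h)) * (P (β j) + P (β i)) by ring, ← unop_op (sc _ _ _), h0,
    neg_one_pow_mul_eq_smul, neg_one_pow_mul_eq_smul]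
  simp only [unop_smul, Finset.unop_sum, unop_mul, unop_op]

theorem Rel.D_E_eq_zero {i j h k : ι} (hij : β i = β j) (hk : β k = β h + 1) (hih : β i ≠ β h)
    (hik : β i ≠ β k) (r s : ℕ) :
    sc ((P (β i) + P (β j)) * (P (β h) + P (β k))) (coeff r (G.D i j)) (coeff s (G.E h k)) = 0 := by
  rcases lt_or_gt_of_ne hih with h1 | h1
  · rw [hij, ← two_mul, mul_assoc, sc_congr (e' := 0) (by omega)]
    rw [sc, pow_zero, one_mul, H.D_E_of_lt hP hij h1 (by omega : β i ≤ β k) r s, sub_self]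
  · rw [mul_comm]
    exact sc_eq_zero_of_swap (H.D_E_of_gt hP hij (by omega) (by omega) r s)

theorem Rel.D_F_eq_zero {i j h k : ι} (hij : β i = β j) (hh : β h = β k + 1) (hik : β i ≠ β k)
    (hih : β i ≠ β h) (r s : ℕ) :
    sc ((P (β i) + P (β j)) * (P (β h) + P (β k))) (coeff r (G.D i j)) (coeff s (G.F h k)) = 0 := by
  have h0 := (H.op_T hP).D_E_eq_zero hP hij.symm hh (by omega) (by omega) r s
  simp only [LDU.coeff_op_E, LDU.coeff_op_D, sc_op] at h0
  rw [add_comm (P (β i)), add_comm (P (β h))]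
  exact sc_eq_zero_of_swap (op_injective (h0.trans op_zero.symm))

theorem Rel.E_F_eq_zero {p j h k : ι} (hj : β j = β p + 1) (hh : β h = β k + 1) (hpk : β p ≠ β k)
    (r s : ℕ) :
    sc ((P (β p) + P (β j)) * (P (β h) + P (β k))) (coeff r (G.E p j)) (coeff s (G.F h k)) = 0 := by
  rcases lt_or_gt_of_ne hpk with h1 | h1
  · exact H.sc_E_F_of_gt hP (by omega) h1 (by omega) (by omega) r s
  · have h0 := (H.op_T hP).sc_E_F_of_gt hP (p := k) (j := h) (h := j) (k := p) (by omega) h1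
      (by omega) (by omega) s r
    simp only [LDU.coeff_op_E, LDU.coeff_op_F, sc_op] at h0
    rw [show (P (β p) + P (β j)) * (P (β h) + P (β k))
      = (P (β k) + P (β h)) * (P (β j) + P (β p)) by ring]
    exact op_injective (h0.trans op_zero.symm)

theorem Rel.F_F (hκ : κ = 1 ∨ κ = -1) {i j h k : ι} (hij : β j ≤ β i) (hhi : β h = β i)
    (hk : β k = β j) {r s : ℕ} (hr : 1 ≤ r) (hs : 1 ≤ s) :
    sc ((P (β i) + P (β j)) * (P (β h) + P (β k))) (coeff r (G.F i j)) (coeff s (G.F h k))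
      = κ • ((-1) ^ P (β j) *
        (∑ t ∈ Finset.Ico 1 r, coeff (r + s - 1 - t) (G.F i k) * coeff t (G.F h j)
        - ∑ t ∈ Finset.Ico 1 s, coeff (r + s - 1 - t) (G.F i k) * coeff t (G.F h j))) := by
  have h0 := (H.op_T hP).E_E hP hκ hij hhi hk hr hs
  simp only [LDU.coeff_op_E, sc_op] at h0
  rw [sc_swap, show (P (β i) + P (β j)) * (P (β h) + P (β k))
    = (P (β j) + P (β i)) * (P (β k) + P (β h)) by ring, ← unop_op (sc _ _ _), h0,
    neg_one_pow_mul_eq_smul, neg_one_pow_mul_eq_smul, neg_one_pow_mul_eq_smul]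
  simp only [unop_smul, unop_sub, Finset.unop_sum, unop_mul, unop_op, smul_smul]
  rw [hhi, hk, ← neg_sub, smul_neg, neg_neg]
  congr 1
  rcases hP (β i) with e1 | e1 <;> rcases hP (β j) with e2 | e2 <;> simp [e1, e2]

theorem Rel.F_F_eq_zero {i j h k : ι} (hij : β j ≤ β i) (hh : β h = β k + 1) (hik : β i ≤ β k)
    (hjk : β j < β k) (hki : k ≠ i) (r s : ℕ) :
    sc ((P (β i) + P (β j)) * (P (β h) + P (β k))) (coeff r (G.F i j)) (coeff s (G.F h k)) = 0 := by
  have h0 := (H.op_T hP).E_E_eq_zero hP hij hh hik hjk hki r s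
  simp only [LDU.coeff_op_E, sc_op] at h0
  rw [add_comm (P (β i)), add_comm (P (β h))]
  exact sc_eq_zero_of_swap (op_injective (h0.trans op_zero.symm))

/-- Going back from the opposite ring multiplies the bracket by -(-1)^e with e the product of the
parities. The hypothesis `he` makes this a plain minus sign. -/
theorem Rel.F_F_next {i j h k : ι} (hi : β i = β j + 1) (hk : β k = β i) (hh : β h = β k + 1)
    (he : (P (β i) + P (β j)) * (P (β h) + P (β k)) % 2 = 0) {r s : ℕ} (hr : 1 ≤ r) (hs : 1 ≤ s) :
    sc ((P (β i) + P (β j)) * (P (β h) + P (β k))) (coeff (r + 1) (G.F i j)) (coeff s (G.F h k))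
      - sc ((P (β i) + P (β j)) * (P (β h) + P (β k))) (coeff r (G.F i j))
        (coeff (s + 1) (G.F h k))
      = if k = i then -(κ • ((-1) ^ P (β i) *
        ∑ q, if β q = β i then coeff s (G.F h q) * coeff r (G.F q j) else 0)) else 0 := by
  have h0 := (H.op_T hP).E_E_next hP hi hk hh hr hs
  simp only [LDU.coeff_op_E, sc_op] at h0
  have he' : (P (β j) + P (β i)) * (P (β k) + P (β h)) % 2 = 0 := by
    rw [add_comm (P (β j)), add_comm (P (β k))]; exact he
  have hs : ∀ x y : A, sc 0 x y = -sc 0 y x := fun x y => by rw [sc_swap]; simp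
  rw [sc_congr (e' := 0) he', sc_congr (e' := 0) he', ← op_sub, hs, hs _ (coeff r _)] at h0
  rw [sc_congr (e' := 0) he, sc_congr (e' := 0) he, ← neg_inj, neg_sub', ← unop_op (- _ - _), h0,
    neg_one_pow_mul_eq_smul, neg_one_pow_mul_eq_smul]
  split_ifs
  · simp only [unop_smul, Finset.unop_sum, unop_mul, unop_op, apply_ite unop, unop_zero, neg_neg]
  · simp

end SuperRTT

namespace SuperRTT

open Matrix PowerSeries

variable {ι : Type} [Fintype ι] [DecidableEq ι] {A : Type} [Ring A]

/-! ### Inverses of unitriangular matrices -/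

/-- Forward substitution: row i of XY = 1 involves, besides row i of Y, only rows of Y in earlier
blocks, already known to be trivial in column j. -/
theorem apply_eq_one_of_mul_eq_one {B : Type} [Ring B] {β : ι → ℕ} {X Y : Matrix ι ι B}
    (hX : ∀ i j, β i ≤ β j → X i j = (1 : Matrix ι ι B) i j) (h : X * Y = 1) (i j : ι)
    (hij : β i ≤ β j) : Y i j = (1 : Matrix ι ι B) i j := by
  induction hn : β i using Nat.strong_induction_on generalizing i with
  | _ n ih =>
    have h0 := congrFun (congrFun h i) j
    rw [Matrix.mul_apply, Finset.sum_eq_single i, hX i i le_rfl, Matrix.one_apply_eq, one_mul] at h0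
    · exact h0
    · intro k _ hki
      rcases le_or_gt (β i) (β k) with hk | hk
      · rw [hX i k hk, Matrix.one_apply_ne hki.symm, zero_mul]
      · rw [ih (β k) (by omega) k (by omega) rfl, Matrix.one_apply_ne, mul_zero]
        rintro rfl
        omega
    · simp

theorem apply_eq_one_of_mul_eq_one' {B : Type} [Ring B] {β : ι → ℕ} {X Y : Matrix ι ι B}
    (hX : ∀ i j, β j ≤ β i → X i j = (1 : Matrix ι ι B) i j) (h : X * Y = 1) (i j : ι)
    (hij : β j ≤ β i) : Y i j = (1 : Matrix ι ι B) i j := by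
  have hL : ∀ x, β x ≤ Finset.univ.sup β := fun x => Finset.le_sup (Finset.mem_univ x)
  -- The upper triangular case is the lower one for the reversed block order.
  refine apply_eq_one_of_mul_eq_one (β := fun x => Finset.univ.sup β - β x) (fun i j hij => ?_) h i j
    (Nat.sub_le_sub_left hij _)
  have := hL i
  have := hL j
  exact hX i j (by omega)

/-! ### Series of matrices as matrices of series -/

/-- The matrix of series whose coefficients are the coefficients of a series of matrices. -/
noncomputable def toMatrix (f : PowerSeries (Matrix ι ι A)) : Matrix ι ι A⟦X⟧ :=
  Matrix.of fun i j => PowerSeries.mk fun r => coeff r f i j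

theorem coeff_toMatrix (f : PowerSeries (Matrix ι ι A)) (r : ℕ) (i j : ι) :
    coeff r (toMatrix f i j) = coeff r f i j := by
  rw [toMatrix, Matrix.of_apply, coeff_mk]

theorem toMatrix_mul (f g : PowerSeries (Matrix ι ι A)) :
    toMatrix (f * g) = toMatrix f * toMatrix g := by
  ext i j r
  rw [coeff_toMatrix, coeff_mul, Matrix.mul_apply, map_sum, Matrix.sum_apply]
  simp only [coeff_mul, coeff_toMatrix, Matrix.mul_apply]
  exact Finset.sum_comm

theorem toMatrix_one : toMatrix (1 : PowerSeries (Matrix ι ι A)) = 1 := by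
  ext i j r
  rw [coeff_toMatrix, coeff_one, Matrix.one_apply]
  by_cases h : i = j <;> by_cases hr : r = 0 <;> simp [h, hr, coeff_one, Matrix.one_apply]

theorem toMatrix_apply_eq_one {f : PowerSeries (Matrix ι ι A)} {i j : ι}
    (h : ∀ r, coeff r f i j = coeff r (1 : PowerSeries (Matrix ι ι A)) i j) :
    toMatrix f i j = (1 : Matrix ι ι A⟦X⟧) i j := by
  ext r
  rw [coeff_toMatrix, h, ← toMatrix_one, coeff_toMatrix]

theorem toMatrix_apply_eq_zero {f : PowerSeries (Matrix ι ι A)} {i j : ι}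
    (h : ∀ r, coeff r f i j = 0) : toMatrix f i j = 0 := by
  ext r
  rw [coeff_toMatrix, h, map_zero]

theorem isUnit_of_coeff_zero {S : Type} [Ring S] {f : PowerSeries S} (h : coeff 0 f = 1) :
    IsUnit f := by
  rw [isUnit_iff_constantCoeff, ← coeff_zero_eq_constantCoeff_apply, h]
  exact isUnit_one

theorem coeff_zero_inverse {S : Type} [Ring S] {f : PowerSeries S} (h : coeff 0 f = 1) :
    coeff 0 (Ring.inverse f) = 1 := by
  have h0 := congrArg (coeff 0) (Ring.mul_inverse_cancel f (isUnit_of_coeff_zero h))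
  simpa [coeff_mul, h] using h0

/-! ### Relations between the coefficients from their summed form -/

/-- The two sums have the same total superscript r + s. They differ only by the term with l = min r
s, or not at all when r = s, where the right-hand side is zero as well. -/
theorem Rel.of_sum {p : ι → ℕ} {T : Matrix ι ι A⟦X⟧}
    (H : ∀ i j h k r s, sc ((p i + p j) * (p h + p k)) (coeff r (T i j)) (coeff s (T h k))
      = (-1) ^ (p i * p j + p i * p h + p j * p h) * ∑ l ∈ Finset.range (min r s),
        (coeff l (T h j) * coeff (r + s - 1 - l) (T i k)
          - coeff (r + s - 1 - l) (T h j) * coeff l (T i k))) : Rel p 1 T where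
  zero_left i j h k s := by rw [H]; simp
  zero_right i j h k r := by rw [H]; simp
  comm i j h k r s := by
    rw [H, H, ← mul_sub, one_smul]
    congr 1
    rw [show r + 1 + s - 1 = r + s by omega, show r + (s + 1) - 1 = r + s by omega]
    rcases lt_trichotomy r s with h | rfl | h
    · rw [min_eq_left (by omega), min_eq_left (by omega), Finset.sum_range_succ,
        show r + s - r = s by omega]
      abel
    · rw [min_eq_right (by omega), min_eq_left (by omega)]
      simp
    · rw [min_eq_right (by omega), min_eq_right (by omega), Finset.sum_range_succ,
        show r + s - s = r by omega]
      abel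

end SuperRTT

namespace SuperYangian

open Matrix PowerSeries SuperRTT

variable {M N : ℕ}

/-! ### Homogeneous elements -/

theorem neg_one_pow_mod_two {A : Type} [Ring A] (n : ℕ) : (-1 : A) ^ (n % 2) = (-1) ^ n :=
  (neg_one_pow_eq_pow_mod_two n).symm

/-- Only parities modulo 2 matter, so sums of block parities can serve as exponents without being
reduced. -/
theorem sbr_eq_sc {x y : SuperYangian M N} {p q e : ℕ} (hx : parityAut M N x = (-1) ^ p * x)
    (hy : parityAut M N y = (-1) ^ q * y) (he : e % 2 = p * q % 2) : sbr x y = sc e x y := by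
  rw [sbr_eq (p := p % 2) (q := q % 2) (Nat.mod_lt _ two_pos) (Nat.mod_lt _ two_pos)
    (by rw [neg_one_pow_mod_two, hx]) (by rw [neg_one_pow_mod_two, hy]), sc,
    neg_one_pow_eq_pow_mod_two, ← Nat.mul_mod, ← he, neg_one_pow_mod_two]

theorem parityAut_neg_one_pow_mul (n : ℕ) (x : SuperYangian M N) :
    parityAut M N ((-1) ^ n * x) = (-1) ^ n * parityAut M N x := by
  rw [map_mul, map_pow, map_neg, map_one]

theorem neg_one_pow_mul_mul_neg_one_pow_mul {A : Type} [Ring A] (p q : ℕ) (x y : A) :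
    (-1) ^ p * x * ((-1) ^ q * y) = (-1) ^ (p + q) * (x * y) := by
  rcases neg_one_pow_eq_or A p with h | h <;> rcases neg_one_pow_eq_or A q with h' | h' <;>
    simp [pow_add, h, h']

theorem parityAut_sbr {x y : SuperYangian M N} {p q : ℕ} (hx : parityAut M N x = (-1) ^ p * x)
    (hy : parityAut M N y = (-1) ^ q * y) :
    parityAut M N (sbr x y) = (-1) ^ (p + q) * sbr x y := by
  rw [sbr_eq_sc hx hy rfl, sc, map_sub, parityAut_neg_one_pow_mul, map_mul, map_mul, hx, hy,
    neg_one_pow_mul_mul_neg_one_pow_mul, neg_one_pow_mul_mul_neg_one_pow_mul, add_comm q p, mul_sub]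
  congr 1
  rw [← mul_assoc, ← pow_add, ← mul_assoc ((-1) ^ (p + q)), ← pow_add, add_comm]

/-! ### Parities of indices and blocks -/

variable (lam : Composition M) (nu : Composition N)

/-- The parity of the block with number `n`. -/
def blockParity (n : ℕ) : ℕ := if n < lam.length then 0 else 1

theorem blockParity_eq (n : ℕ) : blockParity lam n = 0 ∨ blockParity lam n = 1 := by
  unfold blockParity; split_ifs <;> simp

theorem sizeUpTo_append_length : (lam.append nu).sizeUpTo lam.length = M := by
  simp [Composition.sizeUpTo, Composition.append, Composition.length]

/-- The first blocks, as many as λ has, have total size M, so an index is at most M exactly when its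
block comes from λ. -/
theorem idxParity_blocksFinEquiv (x : BlockIdx lam nu) :
    idxParity M ((lam.append nu).blocksFinEquiv x) = blockParity lam x.1 := by
  have h1 : (((lam.append nu).blocksFinEquiv x : Fin (M + N)) : ℕ)
      = (lam.append nu).sizeUpTo x.1 + x.2 := rfl
  have h2 := (lam.append nu).sizeUpTo_succ' x.1
  have h3 := sizeUpTo_append_length lam nu
  have h4 := x.2.2
  unfold idxParity blockParity
  rw [h1]
  by_cases h : (x.1 : ℕ) < lam.length
  · have := (lam.append nu).monotone_sizeUpTo (show (x.1 : ℕ) + 1 ≤ lam.length by omega)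
    have h4 : (x.2 : ℕ) < (lam.append nu).blocksFun x.1 := x.2.2
    rw [if_pos h, if_pos (by omega)]
  · have := (lam.append nu).monotone_sizeUpTo (show lam.length ≤ (x.1 : ℕ) by omega)
    rw [if_neg h, if_neg (by omega)]

/-! ### Homogeneity of the parabolic generators -/

/-- The parity automorphism applied to a series of matrices, as a map of superspaces. -/
noncomputable def conjParity (f : PowerSeries (Matrix (BlockIdx lam nu) (BlockIdx lam nu)
    (SuperYangian M N))) :
    PowerSeries (Matrix (BlockIdx lam nu) (BlockIdx lam nu) (SuperYangian M N)) :=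
  PowerSeries.mk fun r => Matrix.of fun x y =>
    (-1) ^ (blockParity lam x.1 + blockParity lam y.1) * parityAut M N (coeff r f x y)

theorem coeff_conjParity (f : PowerSeries (Matrix (BlockIdx lam nu) (BlockIdx lam nu)
    (SuperYangian M N))) (r : ℕ) (x y : BlockIdx lam nu) :
    coeff r (conjParity lam nu f) x y
      = (-1) ^ (blockParity lam x.1 + blockParity lam y.1) * parityAut M N (coeff r f x y) := by
  simp only [conjParity, coeff_mk, Matrix.of_apply]

/-- The sign attached to the intermediate index occurs twice and cancels. -/
theorem conjParity_mul (f g : PowerSeries (Matrix (BlockIdx lam nu) (BlockIdx lam nu)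
    (SuperYangian M N))) :
    conjParity lam nu (f * g) = conjParity lam nu f * conjParity lam nu g := by
  ext r x y
  simp only [coeff_conjParity, coeff_mul, Matrix.sum_apply, Matrix.mul_apply, map_sum, map_mul,
    Finset.mul_sum, neg_one_pow_mul_mul_neg_one_pow_mul]
  refine Finset.sum_congr rfl fun _ _ => Finset.sum_congr rfl fun z _ => ?_
  refine congrArg (· * _) ?_
  rw [show blockParity lam x.1 + blockParity lam z.1 + (blockParity lam z.1 + blockParity lam y.1)
    = blockParity lam x.1 + blockParity lam y.1 + 2 * blockParity lam z.1 by ring, pow_add _ _ (2 * _), pow_mul]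
  simp

theorem conjParity_apply_one {f : PowerSeries (Matrix (BlockIdx lam nu) (BlockIdx lam nu)
    (SuperYangian M N))} {r : ℕ} {x y : BlockIdx lam nu}
    (h : coeff r f x y = coeff r (1 : PowerSeries (Matrix (BlockIdx lam nu) (BlockIdx lam nu)
      (SuperYangian M N))) x y) :
    coeff r (conjParity lam nu f) x y = coeff r (1 : PowerSeries (Matrix (BlockIdx lam nu)
      (BlockIdx lam nu) (SuperYangian M N))) x y := by
  rw [coeff_conjParity, h, coeff_one]
  split_ifs
  · rw [Matrix.one_apply]
    split_ifs with hxy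
    · subst hxy
      simp [← two_mul]
    · simp
  · simp

theorem conjParity_apply_zero {f : PowerSeries (Matrix (BlockIdx lam nu) (BlockIdx lam nu)
    (SuperYangian M N))} {r : ℕ} {x y : BlockIdx lam nu} (h : coeff r f x y = 0) :
    coeff r (conjParity lam nu f) x y = 0 := by
  rw [coeff_conjParity, h, map_zero, mul_zero]

theorem conjParity_blockT : conjParity lam nu (blockT lam nu) = blockT lam nu := by
  ext r x y
  rw [coeff_conjParity]
  simp only [blockT, coeff_mk, Matrix.of_apply]
  rw [parityAut_t, idxParity_blocksFinEquiv, idxParity_blocksFinEquiv, ← mul_assoc, ← pow_add,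
    ← two_mul, pow_mul]
  simp

/-- Applying `conjParity` to T = FDE gives another block Gauss decomposition of the same T, so
uniqueness fixes each factor. This is the homogeneity of all the generators. -/
theorem conjParity_gauss : conjParity lam nu (gaussF lam nu) = gaussF lam nu ∧
    conjParity lam nu (gaussD lam nu) = gaussD lam nu ∧
    conjParity lam nu (gaussE lam nu) = gaussE lam nu := by
  have h := isGauss lam nu
  refine BlockGauss.gauss_unique _ _ _ _ _ _ _ _ (coeff_zero_blockT lam nu)
    ⟨?_, fun r i j hij => conjParity_apply_zero lam nu (h.diag r i j hij),
      fun r i j hij => conjParity_apply_zero lam nu (h.upper r i j hij),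
      fun r i j hij => conjParity_apply_one lam nu (h.upper_one r i j hij),
      fun r i j hij => conjParity_apply_zero lam nu (h.lower r i j hij),
      fun r i j hij => conjParity_apply_one lam nu (h.lower_one r i j hij)⟩ h
  rw [← conjParity_mul, ← conjParity_mul, ← h.eq_mul, conjParity_blockT]

theorem parityAut_coeff {f : PowerSeries (Matrix (BlockIdx lam nu) (BlockIdx lam nu)
    (SuperYangian M N))} (h : conjParity lam nu f = f) (r : ℕ) (x y : BlockIdx lam nu) :
    parityAut M N (coeff r f x y)
      = (-1) ^ (blockParity lam x.1 + blockParity lam y.1) * coeff r f x y := by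
  conv_rhs => rw [← h, coeff_conjParity, ← mul_assoc, ← pow_add, ← two_mul, pow_mul]
  simp

theorem parityAut_Dgen (a : Fin (numBlocks lam nu)) (i j : Fin (sz lam nu a)) (r : ℕ) :
    parityAut M N (Dgen lam nu a i j r)
      = (-1) ^ (blockParity lam a + blockParity lam a) * Dgen lam nu a i j r := by
  have := parityAut_coeff lam nu (conjParity_gauss lam nu).2.1 r ⟨a, i⟩ ⟨a, j⟩
  simpa only [Dgen, blockD, coeff_mk, Matrix.of_apply] using this

theorem parityAut_Egen (a b : Fin (numBlocks lam nu)) (i : Fin (sz lam nu a))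
    (j : Fin (sz lam nu b)) (r : ℕ) :
    parityAut M N (Egen lam nu a b i j r)
      = (-1) ^ (blockParity lam a + blockParity lam b) * Egen lam nu a b i j r :=
  parityAut_coeff lam nu (conjParity_gauss lam nu).2.2 r ⟨a, i⟩ ⟨b, j⟩

theorem parityAut_Fgen (b a : Fin (numBlocks lam nu)) (i : Fin (sz lam nu b))
    (j : Fin (sz lam nu a)) (r : ℕ) :
    parityAut M N (Fgen lam nu b a i j r)
      = (-1) ^ (blockParity lam b + blockParity lam a) * Fgen lam nu b a i j r :=
  parityAut_coeff lam nu (conjParity_gauss lam nu).1 r ⟨b, i⟩ ⟨a, j⟩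

/-! ### The decomposition of the matrix of generators -/

theorem toMatrix_gaussF_apply (x y : BlockIdx lam nu) (h : (x.1 : ℕ) ≤ y.1) :
    toMatrix (gaussF lam nu) x y = (1 : Matrix _ _ (SuperYangian M N)⟦X⟧) x y := by
  rcases h.lt_or_eq with h | h
  · rw [toMatrix_apply_eq_zero fun r => (isGauss lam nu).lower r x y h,
      Matrix.one_apply_ne fun e => h.ne (by rw [e])]
  · exact toMatrix_apply_eq_one fun r => (isGauss lam nu).lower_one r x y h

theorem toMatrix_gaussE_apply (x y : BlockIdx lam nu) (h : (y.1 : ℕ) ≤ x.1) :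
    toMatrix (gaussE lam nu) x y = (1 : Matrix _ _ (SuperYangian M N)⟦X⟧) x y := by
  rcases h.lt_or_eq with h | h
  · rw [toMatrix_apply_eq_zero fun r => (isGauss lam nu).upper r x y h,
      Matrix.one_apply_ne fun e => h.ne (by rw [e])]
  · exact toMatrix_apply_eq_one fun r => (isGauss lam nu).upper_one r x y h.symm

theorem const_gauss : coeff 0 (gaussF lam nu) = 1 ∧ coeff 0 (gaussD lam nu) = 1 ∧
    coeff 0 (gaussE lam nu) = 1 :=
  BlockGauss.const_gauss _ _ _ _ _ (coeff_zero_blockT lam nu) (isGauss lam nu)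

theorem toMatrix_mul_inverse {f : PowerSeries (Matrix (BlockIdx lam nu) (BlockIdx lam nu)
    (SuperYangian M N))} (h : coeff 0 f = 1) : toMatrix f * toMatrix (Ring.inverse f) = 1 := by
  rw [← toMatrix_mul, Ring.mul_inverse_cancel _ (isUnit_of_coeff_zero h), toMatrix_one]

theorem toMatrix_inverse_mul {f : PowerSeries (Matrix (BlockIdx lam nu) (BlockIdx lam nu)
    (SuperYangian M N))} (h : coeff 0 f = 1) : toMatrix (Ring.inverse f) * toMatrix f = 1 := by
  rw [← toMatrix_mul, Ring.inverse_mul_cancel _ (isUnit_of_coeff_zero h), toMatrix_one]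

/-- The block Gauss decomposition of `T(u)`, as a decomposition of a matrix of series. -/
noncomputable def gaussLDU : LDU (fun x : BlockIdx lam nu => (x.1 : ℕ)) (SuperYangian M N)⟦X⟧ where
  F := toMatrix (gaussF lam nu)
  -- Assembled from the separate blocks, so that the blocks of D' are literally the inverses of the
  -- series D_a(u).
  D := Matrix.blockDiagonal' fun a => toMatrix (blockD lam nu a)
  E := toMatrix (gaussE lam nu)
  F' := toMatrix (Ring.inverse (gaussF lam nu))
  D' := Matrix.blockDiagonal' fun a => toMatrix (Ring.inverse (blockD lam nu a))
  E' := toMatrix (Ring.inverse (gaussE lam nu))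
  mul_F' := toMatrix_mul_inverse lam nu (const_gauss lam nu).1
  F'_mul := toMatrix_inverse_mul lam nu (const_gauss lam nu).1
  mul_D' := by
    rw [← Matrix.blockDiagonal'_mul]
    simp only [← toMatrix_mul, Ring.mul_inverse_cancel _ (isUnit_blockD lam nu _), toMatrix_one]
    exact Matrix.blockDiagonal'_one
  D'_mul := by
    rw [← Matrix.blockDiagonal'_mul]
    simp only [← toMatrix_mul, Ring.inverse_mul_cancel _ (isUnit_blockD lam nu _), toMatrix_one]
    exact Matrix.blockDiagonal'_one
  mul_E' := toMatrix_mul_inverse lam nu (const_gauss lam nu).2.2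
  E'_mul := toMatrix_inverse_mul lam nu (const_gauss lam nu).2.2
  triF := toMatrix_gaussF_apply lam nu
  triF' := apply_eq_one_of_mul_eq_one (toMatrix_gaussF_apply lam nu)
    (toMatrix_mul_inverse lam nu (const_gauss lam nu).1)
  triD := fun x y h => Matrix.blockDiagonal'_apply_ne _ _ _ fun e => h (congrArg Fin.val e)
  triD' := fun x y h => Matrix.blockDiagonal'_apply_ne _ _ _ fun e => h (congrArg Fin.val e)
  triE := toMatrix_gaussE_apply lam nu
  triE' := apply_eq_one_of_mul_eq_one' (toMatrix_gaussE_apply lam nu)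
    (toMatrix_mul_inverse lam nu (const_gauss lam nu).2.2)

theorem coeff_gaussLDU_E (a b : Fin (numBlocks lam nu)) (i : Fin (sz lam nu a))
    (j : Fin (sz lam nu b)) (r : ℕ) :
    coeff r ((gaussLDU lam nu).E ⟨a, i⟩ ⟨b, j⟩) = Egen lam nu a b i j r := coeff_toMatrix _ _ _ _

theorem coeff_gaussLDU_F (a b : Fin (numBlocks lam nu)) (i : Fin (sz lam nu a))
    (j : Fin (sz lam nu b)) (r : ℕ) :
    coeff r ((gaussLDU lam nu).F ⟨a, i⟩ ⟨b, j⟩) = Fgen lam nu a b i j r := coeff_toMatrix _ _ _ _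

theorem coeff_gaussLDU_D (a : Fin (numBlocks lam nu)) (i j : Fin (sz lam nu a)) (r : ℕ) :
    coeff r ((gaussLDU lam nu).D ⟨a, i⟩ ⟨a, j⟩) = Dgen lam nu a i j r := by
  refine (congrArg (coeff r) (Matrix.blockDiagonal'_apply_eq
    (fun a => toMatrix (blockD lam nu a)) a i j)).trans ?_
  rw [coeff_toMatrix, Dgen]

theorem coeff_gaussLDU_D' (a : Fin (numBlocks lam nu)) (i j : Fin (sz lam nu a)) (r : ℕ) :
    coeff r ((gaussLDU lam nu).D' ⟨a, i⟩ ⟨a, j⟩) = Dgen' lam nu a i j r := by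
  refine (congrArg (coeff r) (Matrix.blockDiagonal'_apply_eq
    (fun a => toMatrix (Ring.inverse (blockD lam nu a))) a i j)).trans ?_
  rw [coeff_toMatrix, Dgen']

theorem gaussLDU_T : (gaussLDU lam nu).T = toMatrix (blockT lam nu) := by
  have hD : (gaussLDU lam nu).D = toMatrix (gaussD lam nu) := by
    ext ⟨a, i⟩ ⟨b, j⟩ r
    by_cases h : a = b
    · subst h
      rw [coeff_gaussLDU_D, coeff_toMatrix]
      simp only [Dgen, blockD, coeff_mk, Matrix.of_apply]
    · rw [(gaussLDU lam nu).triD _ _ fun e => h (Fin.ext e), coeff_toMatrix,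
        (isGauss lam nu).diag r _ _ fun e => h (Fin.ext e), map_zero]
  rw [LDU.T, hD, (isGauss lam nu).eq_mul, toMatrix_mul, toMatrix_mul]
  rfl

theorem rel_gaussLDU :
    Rel (blockParity lam ∘ fun x : BlockIdx lam nu => (x.1 : ℕ)) 1 (gaussLDU lam nu).T := by
  rw [gaussLDU_T]
  refine Rel.of_sum fun x y z w r s => ?_
  simp only [coeff_toMatrix, blockT, coeff_mk, Matrix.of_apply, Function.comp_apply,
    ← idxParity_blocksFinEquiv]
  exact t_comm _ _ _ _ _ _

theorem coeff_zero_gaussLDU_E (x y : BlockIdx lam nu) :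
    coeff 0 ((gaussLDU lam nu).E x y) = (1 : Matrix _ _ (SuperYangian M N)) x y := by
  refine (coeff_toMatrix _ _ _ _).trans ?_
  rw [(const_gauss lam nu).2.2]

theorem coeff_zero_gaussLDU_E' (x y : BlockIdx lam nu) :
    coeff 0 ((gaussLDU lam nu).E' x y) = (1 : Matrix _ _ (SuperYangian M N)) x y := by
  refine (coeff_toMatrix _ _ _ _).trans ?_
  rw [coeff_zero_inverse (const_gauss lam nu).2.2]

theorem coeff_zero_gaussLDU_F (x y : BlockIdx lam nu) :
    coeff 0 ((gaussLDU lam nu).F x y) = (1 : Matrix _ _ (SuperYangian M N)) x y := by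
  refine (coeff_toMatrix _ _ _ _).trans ?_
  rw [(const_gauss lam nu).1]

theorem coeff_zero_gaussLDU_F' (x y : BlockIdx lam nu) :
    coeff 0 ((gaussLDU lam nu).F' x y) = (1 : Matrix _ _ (SuperYangian M N)) x y := by
  refine (coeff_toMatrix _ _ _ _).trans ?_
  rw [coeff_zero_inverse (const_gauss lam nu).1]

theorem sum_blockIdx {A : Type} [AddCommMonoid A] (a : Fin (numBlocks lam nu))
    (f : BlockIdx lam nu → A) (h : ∀ x : BlockIdx lam nu, x.1 ≠ a → f x = 0) :
    ∑ x, f x = ∑ p, f ⟨a, p⟩ := by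
  rw [Fintype.sum_sigma]
  exact Finset.sum_eq_single a (fun b _ hb => Finset.sum_eq_zero fun p _ => h ⟨b, p⟩ hb)
    fun h => absurd (Finset.mem_univ a) h

end SuperYangian

/-! ### The relations for the parabolic generators. -/

namespace SuperYangian

open Matrix PowerSeries SuperRTT

variable {M N : ℕ} (lam : Composition M) (nu : Composition N)

theorem bpar_eq (a : Fin (numBlocks lam nu)) : bpar lam nu a = blockParity lam a := rfl

theorem Dgen_zero (a : Fin (numBlocks lam nu)) (i j : Fin (sz lam nu a)) :
    Dgen lam nu a i j 0 = if i = j then 1 else 0 := by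
  simp only [Dgen, blockD, coeff_mk, Matrix.of_apply]
  rw [(const_gauss lam nu).2.1, Matrix.one_apply]
  simp only [Sigma.mk.injEq, heq_eq_eq, true_and]

theorem sum_Dgen_mul_Dgen' (a : Fin (numBlocks lam nu)) (i j : Fin (sz lam nu a)) (r : ℕ) :
    ∑ t ∈ Finset.range (r + 1), ∑ p, Dgen lam nu a i p t * Dgen' lam nu a p j (r - t)
      = if r = 0 ∧ i = j then 1 else 0 := by
  have h := congrArg (fun f : PowerSeries (Matrix (Fin (sz lam nu a)) (Fin (sz lam nu a))
    (SuperYangian M N)) => coeff r f i j) (Ring.mul_inverse_cancel _ (isUnit_blockD lam nu a))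
  simp only [coeff_mul, Matrix.sum_apply, Matrix.mul_apply] at h
  rw [Finset.Nat.sum_antidiagonal_eq_sum_range_succ_mk] at h
  refine h.trans ?_
  by_cases hr : r = 0 <;> simp [coeff_one, hr, Matrix.one_apply]

theorem sbr_Dgen_Dgen (a : Fin (numBlocks lam nu)) (i j h k : Fin (sz lam nu a)) (r s : ℕ) :
    sbr (Dgen lam nu a i j r) (Dgen lam nu a h k s)
      = (-1) ^ bpar lam nu a * ∑ t ∈ Finset.range (min r s),
          (Dgen lam nu a h j t * Dgen lam nu a i k (r + s - 1 - t)
            - Dgen lam nu a h j (r + s - 1 - t) * Dgen lam nu a i k t) := by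
  have h0 := (rel_gaussLDU lam nu).D_D (blockParity_eq lam) (i := ⟨a, i⟩) (j := ⟨a, j⟩)
    (h := ⟨a, h⟩) (k := ⟨a, k⟩) rfl rfl rfl r s
  simp only [coeff_gaussLDU_D, one_smul] at h0
  rw [sbr_eq_sc (e := 0) (parityAut_Dgen ..) (parityAut_Dgen ..)
    (by rw [← two_mul, mul_assoc, Nat.mul_mod_right])]
  exact h0

theorem sbr_Dgen_Dgen_of_ne (a b : Fin (numBlocks lam nu)) (i j : Fin (sz lam nu a))
    (h k : Fin (sz lam nu b)) (r s : ℕ) (hab : a ≠ b) :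
    sbr (Dgen lam nu a i j r) (Dgen lam nu b h k s) = 0 := by
  have h0 := (rel_gaussLDU lam nu).D_D_of_ne (blockParity_eq lam) (i := ⟨a, i⟩) (j := ⟨a, j⟩)
    (h := ⟨b, h⟩) (k := ⟨b, k⟩) rfl rfl (fun e => hab (Fin.ext e)) r s
  simp only [coeff_gaussLDU_D] at h0
  rw [sbr_eq_sc (e := 0) (parityAut_Dgen ..) (parityAut_Dgen ..)
    (by rw [← two_mul, mul_assoc, Nat.mul_mod_right]), sc, h0]
  simp

theorem sbr_Dgen_Egen (b b' : Fin (numBlocks lam nu)) (hb : (b' : ℕ) = b + 1)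
    (i j h : Fin (sz lam nu b)) (k : Fin (sz lam nu b')) (r s : ℕ) (hs : 1 ≤ s) :
    sbr (Dgen lam nu b i j r) (Egen lam nu b b' h k s)
      = if h = j then (-1) ^ bpar lam nu b * ∑ t ∈ Finset.range r, ∑ p,
          Dgen lam nu b i p t * Egen lam nu b b' p k (r + s - 1 - t) else 0 := by
  have h0 := (rel_gaussLDU lam nu).D_E (blockParity_eq lam) (i := ⟨b, i⟩) (j := ⟨b, j⟩)
    (h := ⟨b, h⟩) (k := ⟨b', k⟩) rfl rfl (by simp only; omega) r s hs
  simp only [coeff_gaussLDU_D, coeff_gaussLDU_E, one_smul, Sigma.mk.injEq, heq_eq_eq,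
    true_and] at h0
  rw [sbr_eq_sc (e := 0) (parityAut_Dgen ..) (parityAut_Egen ..)
    (by rw [← two_mul, mul_assoc, Nat.mul_mod_right]), h0]
  refine if_congr Iff.rfl (congrArg _ (Finset.sum_congr rfl fun t _ => ?_)) rfl
  rw [sum_blockIdx lam nu b _ fun x hx => by
    rw [(gaussLDU lam nu).triD _ _ fun e => hx (Fin.ext e.symm), map_zero, zero_mul]]
  simp only [coeff_gaussLDU_D, coeff_gaussLDU_E]

theorem sbr_Dgen_Egen_next (b b' : Fin (numBlocks lam nu)) (hb : (b' : ℕ) = b + 1)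
    (i j : Fin (sz lam nu b')) (h : Fin (sz lam nu b)) (k : Fin (sz lam nu b')) (r s : ℕ)
    (hs : 1 ≤ s) :
    sbr (Dgen lam nu b' i j r) (Egen lam nu b b' h k s)
      = (if (b : ℕ) + 1 = lam.length then 1 else -(-1) ^ bpar lam nu b)
        * ∑ t ∈ Finset.range r, Dgen lam nu b' i k t * Egen lam nu b b' h j (r + s - 1 - t) := by
  have h0 := (rel_gaussLDU lam nu).D_E_next (blockParity_eq lam) (i := ⟨b', i⟩) (j := ⟨b', j⟩)
    (h := ⟨b, h⟩) (k := ⟨b', k⟩) rfl hb rfl r s hs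
  simp only [coeff_gaussLDU_D, coeff_gaussLDU_E, one_smul] at h0
  rw [sc_congr (e' := 0) (by rw [← two_mul, mul_left_comm, Nat.mul_mod_right])] at h0
  rw [sbr_eq_sc (e := 0) (parityAut_Dgen ..) (parityAut_Egen ..)
    (by rw [← two_mul, mul_assoc, Nat.mul_mod_right]), sc_swap, pow_zero, one_mul,
    h0, ← neg_mul]
  congr 1
  -- The sign comes out as the parity of b'. It differs from that of b exactly when b is the last
  -- block of λ, which is the case b = m of the statement.
  rw [bpar_eq, blockParity, blockParity]
  split_ifs <;> first | omega | simp

theorem sbr_Dgen_Egen_eq_zero (a b b' : Fin (numBlocks lam nu)) (hb : (b' : ℕ) = b + 1)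
    (hab : a ≠ b) (hab' : a ≠ b') (i j : Fin (sz lam nu a)) (h : Fin (sz lam nu b))
    (k : Fin (sz lam nu b')) (r s : ℕ) :
    sbr (Dgen lam nu a i j r) (Egen lam nu b b' h k s) = 0 := by
  have h0 := (rel_gaussLDU lam nu).D_E_eq_zero (blockParity_eq lam) (i := ⟨a, i⟩) (j := ⟨a, j⟩)
    (h := ⟨b, h⟩) (k := ⟨b', k⟩) rfl hb (fun e => hab (Fin.ext e)) (fun e => hab' (Fin.ext e)) r s
  simp only [coeff_gaussLDU_D, coeff_gaussLDU_E] at h0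
  rw [sbr_eq_sc (parityAut_Dgen ..) (parityAut_Egen ..) rfl, h0]

theorem sbr_Dgen_Fgen (b b' : Fin (numBlocks lam nu)) (hb : (b' : ℕ) = b + 1)
    (i j : Fin (sz lam nu b)) (h : Fin (sz lam nu b')) (k : Fin (sz lam nu b)) (r s : ℕ)
    (hs : 1 ≤ s) :
    sbr (Dgen lam nu b i j r) (Fgen lam nu b' b h k s)
      = if k = i then -(-1) ^ bpar lam nu b * ∑ t ∈ Finset.range r, ∑ p,
          Fgen lam nu b' b h p (r + s - 1 - t) * Dgen lam nu b p j t else 0 := by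
  have h0 := (rel_gaussLDU lam nu).D_F (blockParity_eq lam) (i := ⟨b, i⟩) (j := ⟨b, j⟩)
    (h := ⟨b', h⟩) (k := ⟨b, k⟩) rfl rfl (by simp only; omega) r hs
  simp only [coeff_gaussLDU_D, coeff_gaussLDU_F, one_smul, Sigma.mk.injEq, heq_eq_eq,
    true_and, ← neg_mul] at h0
  rw [sbr_eq_sc (e := 0) (parityAut_Dgen ..) (parityAut_Fgen ..)
    (by rw [← two_mul, mul_assoc, Nat.mul_mod_right]), h0]
  refine if_congr Iff.rfl (congrArg _ (Finset.sum_congr rfl fun t _ => ?_)) rfl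
  rw [sum_blockIdx lam nu b _ fun x hx => by
    rw [(gaussLDU lam nu).triD _ _ fun e => hx (Fin.ext e), map_zero, mul_zero]]
  simp only [coeff_gaussLDU_D, coeff_gaussLDU_F]

theorem sbr_Dgen_Fgen_next (b b' : Fin (numBlocks lam nu)) (hb : (b' : ℕ) = b + 1)
    (i j h : Fin (sz lam nu b')) (k : Fin (sz lam nu b)) (r s : ℕ) (hs : 1 ≤ s) :
    sbr (Dgen lam nu b' i j r) (Fgen lam nu b' b h k s)
      = (if (b : ℕ) + 1 = lam.length then -1 else (-1) ^ bpar lam nu b)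
        * ∑ t ∈ Finset.range r, Fgen lam nu b' b i k (r + s - 1 - t) * Dgen lam nu b' h j t := by
  have h0 := (rel_gaussLDU lam nu).D_F_next (blockParity_eq lam) (i := ⟨b', i⟩) (j := ⟨b', j⟩)
    (h := ⟨b', h⟩) (k := ⟨b, k⟩) rfl hb rfl r hs
  simp only [coeff_gaussLDU_D, coeff_gaussLDU_F, one_smul] at h0
  rw [sbr_eq_sc (parityAut_Dgen ..) (parityAut_Fgen ..) rfl, h0]
  congr 1
  rw [bpar_eq, blockParity, blockParity]
  split_ifs <;> first | omega | simp

theorem sbr_Dgen_Fgen_eq_zero (a b b' : Fin (numBlocks lam nu)) (hb : (b' : ℕ) = b + 1)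
    (hab : a ≠ b) (hab' : a ≠ b') (i j : Fin (sz lam nu a)) (h : Fin (sz lam nu b'))
    (k : Fin (sz lam nu b)) (r s : ℕ) :
    sbr (Dgen lam nu a i j r) (Fgen lam nu b' b h k s) = 0 := by
  have h0 := (rel_gaussLDU lam nu).D_F_eq_zero (blockParity_eq lam) (i := ⟨a, i⟩) (j := ⟨a, j⟩)
    (h := ⟨b', h⟩) (k := ⟨b, k⟩) rfl hb (fun e => hab (Fin.ext e)) (fun e => hab' (Fin.ext e)) r s
  simp only [coeff_gaussLDU_D, coeff_gaussLDU_F] at h0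
  rw [sbr_eq_sc (parityAut_Dgen ..) (parityAut_Fgen ..) rfl, h0]

theorem sbr_Egen_Egen (a a' : Fin (numBlocks lam nu)) (ha : (a' : ℕ) = a + 1)
    (i h : Fin (sz lam nu a)) (j k : Fin (sz lam nu a')) (r s : ℕ) (hr : 1 ≤ r) (hs : 1 ≤ s) :
    sbr (Egen lam nu a a' i j r) (Egen lam nu a a' h k s)
      = if (a : ℕ) + 1 = lam.length then
          ∑ t ∈ Finset.Ico 1 r, Egen lam nu a a' i k t * Egen lam nu a a' h j (r + s - 1 - t)
          - ∑ t ∈ Finset.Ico 1 s, Egen lam nu a a' i k t * Egen lam nu a a' h j (r + s - 1 - t)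
        else (-1) ^ bpar lam nu a *
          (∑ t ∈ Finset.Ico 1 s, Egen lam nu a a' i k t * Egen lam nu a a' h j (r + s - 1 - t)
          - ∑ t ∈ Finset.Ico 1 r,
              Egen lam nu a a' i k t * Egen lam nu a a' h j (r + s - 1 - t)) := by
  have h0 := (rel_gaussLDU lam nu).E_E (blockParity_eq lam) (.inl rfl) (p := ⟨a, i⟩) (j := ⟨a', j⟩)
    (h := ⟨a, h⟩) (l := ⟨a', k⟩) (by simp only; omega) rfl rfl hr hs
  simp only [coeff_gaussLDU_E, one_smul] at h0
  rw [sbr_eq_sc (parityAut_Egen ..) (parityAut_Egen ..) rfl, h0, bpar_eq, blockParity, blockParity]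
  split_ifs <;> first | omega | simp

theorem sbr_Fgen_Fgen (a a' : Fin (numBlocks lam nu)) (ha : (a' : ℕ) = a + 1)
    (i h : Fin (sz lam nu a')) (j k : Fin (sz lam nu a)) (r s : ℕ) (hr : 1 ≤ r) (hs : 1 ≤ s) :
    sbr (Fgen lam nu a' a i j r) (Fgen lam nu a' a h k s)
      = if (a : ℕ) + 1 = lam.length then
          ∑ t ∈ Finset.Ico 1 r, Fgen lam nu a' a i k (r + s - 1 - t) * Fgen lam nu a' a h j t
          - ∑ t ∈ Finset.Ico 1 s, Fgen lam nu a' a i k (r + s - 1 - t) * Fgen lam nu a' a h j t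
        else (-1) ^ bpar lam nu a *
          (∑ t ∈ Finset.Ico 1 r, Fgen lam nu a' a i k (r + s - 1 - t) * Fgen lam nu a' a h j t
          - ∑ t ∈ Finset.Ico 1 s,
              Fgen lam nu a' a i k (r + s - 1 - t) * Fgen lam nu a' a h j t) := by
  have h0 := (rel_gaussLDU lam nu).F_F (blockParity_eq lam) (.inl rfl) (i := ⟨a', i⟩) (j := ⟨a, j⟩)
    (h := ⟨a', h⟩) (k := ⟨a, k⟩) (by simp only; omega) rfl rfl hr hs
  simp only [coeff_gaussLDU_F, one_smul] at h0
  rw [sbr_eq_sc (parityAut_Fgen ..) (parityAut_Fgen ..) rfl, h0, bpar_eq, blockParity]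
  split_ifs <;> first | omega | simp

theorem sbr_Egen_Fgen (a a' : Fin (numBlocks lam nu)) (ha : (a' : ℕ) = a + 1)
    (i : Fin (sz lam nu a)) (j h : Fin (sz lam nu a')) (k : Fin (sz lam nu a)) (r s : ℕ)
    (hr : 1 ≤ r) (hs : 1 ≤ s) :
    sbr (Egen lam nu a a' i j r) (Fgen lam nu a' a h k s)
      = -(-1) ^ bpar lam nu a' * ∑ t ∈ Finset.range (r + s),
          Dgen lam nu a' h j (r + s - 1 - t) * Dgen' lam nu a i k t := by
  have h0 := (rel_gaussLDU lam nu).sc_E_F (blockParity_eq lam) (p := ⟨a, i⟩) (j := ⟨a', j⟩)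
    (h := ⟨a', h⟩) (k := ⟨a, k⟩) rfl ha rfl r s hs
  simp only [coeff_gaussLDU_E, coeff_gaussLDU_F, coeff_gaussLDU_D, coeff_gaussLDU_D', one_smul,
    if_neg (Nat.one_le_iff_ne_zero.1 hr), ← neg_mul] at h0
  rw [sbr_eq_sc (parityAut_Egen ..) (parityAut_Fgen ..) rfl, h0]
  rfl

theorem sbr_Egen_Fgen_eq_zero (a a' b b' : Fin (numBlocks lam nu)) (ha : (a' : ℕ) = a + 1)
    (hb : (b' : ℕ) = b + 1) (hab : a ≠ b) (i : Fin (sz lam nu a)) (j : Fin (sz lam nu a'))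
    (h : Fin (sz lam nu b')) (k : Fin (sz lam nu b)) (r s : ℕ) :
    sbr (Egen lam nu a a' i j r) (Fgen lam nu b' b h k s) = 0 := by
  have h0 := (rel_gaussLDU lam nu).E_F_eq_zero (blockParity_eq lam) (p := ⟨a, i⟩) (j := ⟨a', j⟩)
    (h := ⟨b', h⟩) (k := ⟨b, k⟩) ha hb (fun e => hab (Fin.ext e)) r s
  simp only [coeff_gaussLDU_E, coeff_gaussLDU_F] at h0
  rw [sbr_eq_sc (parityAut_Egen ..) (parityAut_Fgen ..) rfl, h0]

theorem sbr_Egen_Egen_next (a a' a'' : Fin (numBlocks lam nu)) (ha : (a' : ℕ) = a + 1)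
    (ha' : (a'' : ℕ) = a' + 1) (i : Fin (sz lam nu a)) (j h : Fin (sz lam nu a'))
    (k : Fin (sz lam nu a'')) (r s : ℕ) (hr : 1 ≤ r) (hs : 1 ≤ s) :
    sbr (Egen lam nu a a' i j (r + 1)) (Egen lam nu a' a'' h k s)
        - sbr (Egen lam nu a a' i j r) (Egen lam nu a' a'' h k (s + 1))
      = if h = j then (-1) ^ bpar lam nu a' *
          ∑ q, Egen lam nu a a' i q r * Egen lam nu a' a'' q k s else 0 := by
  have h0 := (rel_gaussLDU lam nu).E_E_next (blockParity_eq lam) (p := ⟨a, i⟩) (j := ⟨a', j⟩)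
    (h := ⟨a', h⟩) (k := ⟨a'', k⟩) ha rfl ha' hr hs
  rw [sum_blockIdx lam nu a' _ fun x hx => if_neg fun e => hx (Fin.ext e)] at h0
  simp only [coeff_gaussLDU_E, one_smul, Sigma.mk.injEq, heq_eq_eq, true_and, if_true] at h0
  rw [sbr_eq_sc (parityAut_Egen ..) (parityAut_Egen ..) rfl,
    sbr_eq_sc (parityAut_Egen ..) (parityAut_Egen ..) rfl, h0]
  rfl

/-- The parity changes only once along the blocks, so of two consecutive steps at least one is even.
-/
theorem blockParity_mul_even (n : ℕ) :
    (blockParity lam (n + 1) + blockParity lam n)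
      * (blockParity lam (n + 1 + 1) + blockParity lam (n + 1)) % 2 = 0 := by
  unfold blockParity
  split_ifs <;> omega

theorem sbr_Fgen_Fgen_next (a a' a'' : Fin (numBlocks lam nu)) (ha : (a' : ℕ) = a + 1)
    (ha' : (a'' : ℕ) = a' + 1) (i : Fin (sz lam nu a')) (j : Fin (sz lam nu a))
    (h : Fin (sz lam nu a'')) (k : Fin (sz lam nu a')) (r s : ℕ) (hr : 1 ≤ r) (hs : 1 ≤ s) :
    sbr (Fgen lam nu a' a i j (r + 1)) (Fgen lam nu a'' a' h k s)
        - sbr (Fgen lam nu a' a i j r) (Fgen lam nu a'' a' h k (s + 1))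
      = if i = k then -(-1) ^ bpar lam nu a' *
          ∑ q, Fgen lam nu a'' a' h q s * Fgen lam nu a' a q j r else 0 := by
  have h0 := (rel_gaussLDU lam nu).F_F_next (blockParity_eq lam) (i := ⟨a', i⟩) (j := ⟨a, j⟩)
    (h := ⟨a'', h⟩) (k := ⟨a', k⟩) ha rfl ha'
    (by simp only [ha', ha]; exact blockParity_mul_even lam a) hr hs
  rw [sum_blockIdx lam nu a' _ fun x hx => if_neg fun e => hx (Fin.ext e)] at h0
  simp only [coeff_gaussLDU_F, one_smul, Sigma.mk.injEq, heq_eq_eq, true_and, if_true,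
    ← neg_mul, eq_comm (a := k)] at h0
  rw [sbr_eq_sc (parityAut_Fgen ..) (parityAut_Fgen ..) rfl,
    sbr_eq_sc (parityAut_Fgen ..) (parityAut_Fgen ..) rfl, h0]
  rfl

theorem sbr_Egen_Egen_eq_zero (a a' b b' : Fin (numBlocks lam nu)) (ha : (a' : ℕ) = a + 1)
    (hb : (b' : ℕ) = b + 1) (hab : (a : ℕ) + 1 ≤ b) (i : Fin (sz lam nu a))
    (j : Fin (sz lam nu a')) (h : Fin (sz lam nu b)) (k : Fin (sz lam nu b')) (r s : ℕ)
    (hne : (⟨b, h⟩ : BlockIdx lam nu) ≠ ⟨a', j⟩) :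
    sbr (Egen lam nu a a' i j r) (Egen lam nu b b' h k s) = 0 := by
  have h0 := (rel_gaussLDU lam nu).E_E_eq_zero (blockParity_eq lam) (p := ⟨a, i⟩) (j := ⟨a', j⟩)
    (h := ⟨b, h⟩) (k := ⟨b', k⟩) (by simp only; omega) hb (by simp only; omega) (by simp only; omega)
    hne r s
  simp only [coeff_gaussLDU_E] at h0
  rw [sbr_eq_sc (parityAut_Egen ..) (parityAut_Egen ..) rfl, h0]

theorem sbr_Fgen_Fgen_eq_zero (a a' b b' : Fin (numBlocks lam nu)) (ha : (a' : ℕ) = a + 1)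
    (hb : (b' : ℕ) = b + 1) (hab : (a : ℕ) + 1 ≤ b) (i : Fin (sz lam nu a'))
    (j : Fin (sz lam nu a)) (h : Fin (sz lam nu b')) (k : Fin (sz lam nu b)) (r s : ℕ)
    (hne : (⟨b, k⟩ : BlockIdx lam nu) ≠ ⟨a', i⟩) :
    sbr (Fgen lam nu a' a i j r) (Fgen lam nu b' b h k s) = 0 := by
  have h0 := (rel_gaussLDU lam nu).F_F_eq_zero (blockParity_eq lam) (i := ⟨a', i⟩) (j := ⟨a, j⟩)
    (h := ⟨b', h⟩) (k := ⟨b, k⟩) (by simp only; omega) hb (by simp only; omega) (by simp only; omega)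
    hne r s
  simp only [coeff_gaussLDU_F] at h0
  rw [sbr_eq_sc (parityAut_Fgen ..) (parityAut_Fgen ..) rfl, h0]

theorem cubic_Egen (a a' b b' : Fin (numBlocks lam nu)) (ha : (a' : ℕ) = a + 1)
    (hb : (b' : ℕ) = b + 1) (hab : a ≠ b) (i h : Fin (sz lam nu a)) (j k : Fin (sz lam nu a'))
    (f : Fin (sz lam nu b)) (g : Fin (sz lam nu b')) (r s l : ℕ) :
    sbr (Egen lam nu a a' i j r) (sbr (Egen lam nu a a' h k s) (Egen lam nu b b' f g l))
      + sbr (Egen lam nu a a' i j s) (sbr (Egen lam nu a a' h k r) (Egen lam nu b b' f g l))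
      = 0 := by
  have h0 := (rel_gaussLDU lam nu).cubic (blockParity_eq lam) (.inl rfl) (i := ⟨a, i⟩)
    (j := ⟨a', j⟩) (h := ⟨a, h⟩) (k := ⟨a', k⟩) (f := ⟨b, f⟩) (g := ⟨b', g⟩) rfl ha rfl
    (fun e => hab (Fin.ext e.symm)) hb r s l
  simp only [coeff_gaussLDU_E] at h0
  rw [sbr_eq_sc (parityAut_Egen ..) (parityAut_sbr (parityAut_Egen ..) (parityAut_Egen ..)) rfl,
    sbr_eq_sc (parityAut_Egen ..) (parityAut_sbr (parityAut_Egen ..) (parityAut_Egen ..)) rfl,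
    sbr_eq_sc (parityAut_Egen ..) (parityAut_Egen ..) rfl,
    sbr_eq_sc (parityAut_Egen ..) (parityAut_Egen ..) rfl]
  exact h0

theorem cubic_Fgen (a a' b b' : Fin (numBlocks lam nu)) (ha : (a' : ℕ) = a + 1)
    (hb : (b' : ℕ) = b + 1) (hab : a ≠ b) (i h : Fin (sz lam nu a')) (j k : Fin (sz lam nu a))
    (f : Fin (sz lam nu b')) (g : Fin (sz lam nu b)) (r s l : ℕ) :
    sbr (Fgen lam nu a' a i j r) (sbr (Fgen lam nu a' a h k s) (Fgen lam nu b' b f g l))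
      + sbr (Fgen lam nu a' a i j s) (sbr (Fgen lam nu a' a h k r) (Fgen lam nu b' b f g l))
      = 0 := by
  have h0 := (rel_gaussLDU lam nu).cubic_F (blockParity_eq lam) (.inl rfl) (i := ⟨a', i⟩)
    (j := ⟨a, j⟩) (h := ⟨a', h⟩) (k := ⟨a, k⟩) (f := ⟨b', f⟩) (g := ⟨b, g⟩) rfl ha rfl
    (fun e => hab (Fin.ext e.symm)) hb r s l
  simp only [coeff_gaussLDU_F] at h0
  rw [sbr_eq_sc (parityAut_Fgen ..) (parityAut_sbr (parityAut_Fgen ..) (parityAut_Fgen ..)) rfl,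
    sbr_eq_sc (parityAut_Fgen ..) (parityAut_sbr (parityAut_Fgen ..) (parityAut_Fgen ..)) rfl,
    sbr_eq_sc (parityAut_Fgen ..) (parityAut_Fgen ..) rfl,
    sbr_eq_sc (parityAut_Fgen ..) (parityAut_Fgen ..) rfl]
  exact h0

theorem quartic_Egen (x₀ x₁ x₂ x₃ : Fin (numBlocks lam nu)) (h₁ : (x₁ : ℕ) = x₀ + 1)
    (h₂ : (x₂ : ℕ) = x₁ + 1) (h₃ : (x₃ : ℕ) = x₂ + 1) (i : Fin (sz lam nu x₀))
    (j h h₀ : Fin (sz lam nu x₁)) (k k₀ f : Fin (sz lam nu x₂)) (g : Fin (sz lam nu x₃))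
    (r s : ℕ) :
    sbr (sbr (Egen lam nu x₀ x₁ i j r) (Egen lam nu x₁ x₂ h k 1))
      (sbr (Egen lam nu x₁ x₂ h₀ k₀ 1) (Egen lam nu x₂ x₃ f g s)) = 0 := by
  have h0 := (rel_gaussLDU lam nu).quartic (blockParity_eq lam) (coeff_zero_gaussLDU_E lam nu)
    (coeff_zero_gaussLDU_E' lam nu) (i := ⟨x₀, i⟩) (j := ⟨x₁, j⟩) (h := ⟨x₁, h⟩) (k := ⟨x₂, k⟩)
    (h₀ := ⟨x₁, h₀⟩) (k₀ := ⟨x₂, k₀⟩) (f := ⟨x₂, f⟩) (g := ⟨x₃, g⟩) h₁ rfl h₂ rfl rfl rfl h₃ r s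
  simp only [coeff_gaussLDU_E] at h0
  rw [sbr_eq_sc (parityAut_sbr (parityAut_Egen ..) (parityAut_Egen ..))
      (parityAut_sbr (parityAut_Egen ..) (parityAut_Egen ..)) rfl,
    sbr_eq_sc (parityAut_Egen ..) (parityAut_Egen ..) rfl,
    sbr_eq_sc (parityAut_Egen ..) (parityAut_Egen ..) rfl]
  exact h0

theorem quartic_Fgen (x₀ x₁ x₂ x₃ : Fin (numBlocks lam nu)) (h₁ : (x₁ : ℕ) = x₀ + 1)
    (h₂ : (x₂ : ℕ) = x₁ + 1) (h₃ : (x₃ : ℕ) = x₂ + 1) (i : Fin (sz lam nu x₁))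
    (j : Fin (sz lam nu x₀)) (h h₀ : Fin (sz lam nu x₂)) (k k₀ : Fin (sz lam nu x₁))
    (f : Fin (sz lam nu x₃)) (g : Fin (sz lam nu x₂)) (r s : ℕ) :
    sbr (sbr (Fgen lam nu x₁ x₀ i j r) (Fgen lam nu x₂ x₁ h k 1))
      (sbr (Fgen lam nu x₂ x₁ h₀ k₀ 1) (Fgen lam nu x₃ x₂ f g s)) = 0 := by
  have h0 := (rel_gaussLDU lam nu).quartic_F (blockParity_eq lam) (coeff_zero_gaussLDU_F lam nu)
    (coeff_zero_gaussLDU_F' lam nu) (i := ⟨x₁, i⟩) (j := ⟨x₀, j⟩) (h := ⟨x₂, h⟩) (k := ⟨x₁, k⟩)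
    (h₀ := ⟨x₂, h₀⟩) (k₀ := ⟨x₁, k₀⟩) (f := ⟨x₃, f⟩) (g := ⟨x₂, g⟩) h₁ rfl h₂ rfl rfl rfl h₃ r s
  simp only [coeff_gaussLDU_F] at h0
  rw [sbr_eq_sc (parityAut_sbr (parityAut_Fgen ..) (parityAut_Fgen ..))
      (parityAut_sbr (parityAut_Fgen ..) (parityAut_Fgen ..)) rfl,
    sbr_eq_sc (parityAut_Fgen ..) (parityAut_Fgen ..) rfl,
    sbr_eq_sc (parityAut_Fgen ..) (parityAut_Fgen ..) rfl]
  exact h0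

end SuperYangian

open SuperYangian in
theorem theorem3 {M N : ℕ} (lam : Composition M) (nu : Composition N) :
    -- constant terms of the `D_a(u)`
    (∀ (a : Fin (numBlocks lam nu)) (i j : Fin (sz lam nu a)),
      Dgen lam nu a i j 0 = if i = j then 1 else 0) ∧
    -- `D_a(u)` and `D'_a(u)` are inverse to each other
    (∀ (a : Fin (numBlocks lam nu)) (i j : Fin (sz lam nu a)) (r : ℕ),
      ∑ t ∈ Finset.range (r + 1), ∑ p, Dgen lam nu a i p t * Dgen' lam nu a p j (r - t)
        = if r = 0 ∧ i = j then 1 else 0) ∧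
    -- `[D_a, D_b]` for `a = b` and for `a ≠ b`
    (∀ (a : Fin (numBlocks lam nu)) (i j h k : Fin (sz lam nu a)) (r s : ℕ),
      sbr (Dgen lam nu a i j r) (Dgen lam nu a h k s)
        = (-1) ^ bpar lam nu a * ∑ t ∈ Finset.range (min r s),
            (Dgen lam nu a h j t * Dgen lam nu a i k (r + s - 1 - t)
              - Dgen lam nu a h j (r + s - 1 - t) * Dgen lam nu a i k t)) ∧
    (∀ (a b : Fin (numBlocks lam nu)) (i j : Fin (sz lam nu a)) (h k : Fin (sz lam nu b))
      (r s : ℕ), a ≠ b → sbr (Dgen lam nu a i j r) (Dgen lam nu b h k s) = 0) ∧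
    -- `[D_a, E_b]` for `a = b`, for `a = b + 1`, and for the other `a`
    (∀ (b b' : Fin (numBlocks lam nu)), (b' : ℕ) = b + 1 →
      ∀ (i j h : Fin (sz lam nu b)) (k : Fin (sz lam nu b')) (r s : ℕ), 1 ≤ s →
      sbr (Dgen lam nu b i j r) (Egen lam nu b b' h k s)
        = if h = j then (-1) ^ bpar lam nu b * ∑ t ∈ Finset.range r, ∑ p,
            Dgen lam nu b i p t * Egen lam nu b b' p k (r + s - 1 - t) else 0) ∧
    (∀ (b b' : Fin (numBlocks lam nu)), (b' : ℕ) = b + 1 →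
      ∀ (i j : Fin (sz lam nu b')) (h : Fin (sz lam nu b)) (k : Fin (sz lam nu b')) (r s : ℕ),
      1 ≤ s →
      sbr (Dgen lam nu b' i j r) (Egen lam nu b b' h k s)
        = (if (b : ℕ) + 1 = lam.length then 1 else -(-1) ^ bpar lam nu b)
          * ∑ t ∈ Finset.range r, Dgen lam nu b' i k t * Egen lam nu b b' h j (r + s - 1 - t)) ∧
    (∀ (a b b' : Fin (numBlocks lam nu)), (b' : ℕ) = b + 1 → a ≠ b → a ≠ b' →
      ∀ (i j : Fin (sz lam nu a)) (h : Fin (sz lam nu b)) (k : Fin (sz lam nu b')) (r s : ℕ),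
      1 ≤ s → sbr (Dgen lam nu a i j r) (Egen lam nu b b' h k s) = 0) ∧
    -- `[D_a, F_b]` for `a = b`, for `a = b + 1`, and for the other `a`
    (∀ (b b' : Fin (numBlocks lam nu)), (b' : ℕ) = b + 1 →
      ∀ (i j : Fin (sz lam nu b)) (h : Fin (sz lam nu b')) (k : Fin (sz lam nu b)) (r s : ℕ),
      1 ≤ s →
      sbr (Dgen lam nu b i j r) (Fgen lam nu b' b h k s)
        = if k = i then -(-1) ^ bpar lam nu b * ∑ t ∈ Finset.range r, ∑ p,
            Fgen lam nu b' b h p (r + s - 1 - t) * Dgen lam nu b p j t else 0) ∧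
    (∀ (b b' : Fin (numBlocks lam nu)), (b' : ℕ) = b + 1 →
      ∀ (i j h : Fin (sz lam nu b')) (k : Fin (sz lam nu b)) (r s : ℕ), 1 ≤ s →
      sbr (Dgen lam nu b' i j r) (Fgen lam nu b' b h k s)
        = (if (b : ℕ) + 1 = lam.length then -1 else (-1) ^ bpar lam nu b)
          * ∑ t ∈ Finset.range r, Fgen lam nu b' b i k (r + s - 1 - t) * Dgen lam nu b' h j t) ∧
    (∀ (a b b' : Fin (numBlocks lam nu)), (b' : ℕ) = b + 1 → a ≠ b → a ≠ b' →
      ∀ (i j : Fin (sz lam nu a)) (h : Fin (sz lam nu b')) (k : Fin (sz lam nu b)) (r s : ℕ),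
      1 ≤ s → sbr (Dgen lam nu a i j r) (Fgen lam nu b' b h k s) = 0) ∧
    -- `[E_a, E_a]`
    (∀ (a a' : Fin (numBlocks lam nu)), (a' : ℕ) = a + 1 →
      ∀ (i h : Fin (sz lam nu a)) (j k : Fin (sz lam nu a')) (r s : ℕ), 1 ≤ r → 1 ≤ s →
      sbr (Egen lam nu a a' i j r) (Egen lam nu a a' h k s)
        = if (a : ℕ) + 1 = lam.length then
            ∑ t ∈ Finset.Ico 1 r, Egen lam nu a a' i k t * Egen lam nu a a' h j (r + s - 1 - t)
            - ∑ t ∈ Finset.Ico 1 s, Egen lam nu a a' i k t * Egen lam nu a a' h j (r + s - 1 - t)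
          else (-1) ^ bpar lam nu a *
            (∑ t ∈ Finset.Ico 1 s, Egen lam nu a a' i k t * Egen lam nu a a' h j (r + s - 1 - t)
            - ∑ t ∈ Finset.Ico 1 r,
                Egen lam nu a a' i k t * Egen lam nu a a' h j (r + s - 1 - t))) ∧
    -- `[F_a, F_a]`
    (∀ (a a' : Fin (numBlocks lam nu)), (a' : ℕ) = a + 1 →
      ∀ (i h : Fin (sz lam nu a')) (j k : Fin (sz lam nu a)) (r s : ℕ), 1 ≤ r → 1 ≤ s →
      sbr (Fgen lam nu a' a i j r) (Fgen lam nu a' a h k s)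
        = if (a : ℕ) + 1 = lam.length then
            ∑ t ∈ Finset.Ico 1 r, Fgen lam nu a' a i k (r + s - 1 - t) * Fgen lam nu a' a h j t
            - ∑ t ∈ Finset.Ico 1 s, Fgen lam nu a' a i k (r + s - 1 - t) * Fgen lam nu a' a h j t
          else (-1) ^ bpar lam nu a *
            (∑ t ∈ Finset.Ico 1 r, Fgen lam nu a' a i k (r + s - 1 - t) * Fgen lam nu a' a h j t
            - ∑ t ∈ Finset.Ico 1 s,
                Fgen lam nu a' a i k (r + s - 1 - t) * Fgen lam nu a' a h j t)) ∧
    -- `[E_a, F_b]` for `a = b` and for `a ≠ b`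
    (∀ (a a' : Fin (numBlocks lam nu)), (a' : ℕ) = a + 1 →
      ∀ (i : Fin (sz lam nu a)) (j h : Fin (sz lam nu a')) (k : Fin (sz lam nu a)) (r s : ℕ),
      1 ≤ r → 1 ≤ s →
      sbr (Egen lam nu a a' i j r) (Fgen lam nu a' a h k s)
        = -(-1) ^ bpar lam nu a' * ∑ t ∈ Finset.range (r + s),
            Dgen lam nu a' h j (r + s - 1 - t) * Dgen' lam nu a i k t) ∧
    (∀ (a a' b b' : Fin (numBlocks lam nu)), (a' : ℕ) = a + 1 → (b' : ℕ) = b + 1 → a ≠ b →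
      ∀ (i : Fin (sz lam nu a)) (j : Fin (sz lam nu a')) (h : Fin (sz lam nu b'))
        (k : Fin (sz lam nu b)) (r s : ℕ), 1 ≤ r → 1 ≤ s →
      sbr (Egen lam nu a a' i j r) (Fgen lam nu b' b h k s) = 0) ∧
    -- `[E_a, E_{a+1}]` and `[F_a, F_{a+1}]`
    (∀ (a a' a'' : Fin (numBlocks lam nu)), (a' : ℕ) = a + 1 → (a'' : ℕ) = a' + 1 →
      ∀ (i : Fin (sz lam nu a)) (j h : Fin (sz lam nu a')) (k : Fin (sz lam nu a'')) (r s : ℕ),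
      1 ≤ r → 1 ≤ s →
      sbr (Egen lam nu a a' i j (r + 1)) (Egen lam nu a' a'' h k s)
          - sbr (Egen lam nu a a' i j r) (Egen lam nu a' a'' h k (s + 1))
        = if h = j then (-1) ^ bpar lam nu a' *
            ∑ q, Egen lam nu a a' i q r * Egen lam nu a' a'' q k s else 0) ∧
    (∀ (a a' a'' : Fin (numBlocks lam nu)), (a' : ℕ) = a + 1 → (a'' : ℕ) = a' + 1 →
      ∀ (i : Fin (sz lam nu a')) (j : Fin (sz lam nu a)) (h : Fin (sz lam nu a''))
        (k : Fin (sz lam nu a')) (r s : ℕ), 1 ≤ r → 1 ≤ s →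
      sbr (Fgen lam nu a' a i j (r + 1)) (Fgen lam nu a'' a' h k s)
          - sbr (Fgen lam nu a' a i j r) (Fgen lam nu a'' a' h k (s + 1))
        = if i = k then -(-1) ^ bpar lam nu a' *
            ∑ q, Fgen lam nu a'' a' h q s * Fgen lam nu a' a q j r else 0) ∧
    -- `[E_a, E_b] = 0` for `b > a + 1`, and for `b = a + 1` and `h ≠ j`
    (∀ (a a' b b' : Fin (numBlocks lam nu)), (a' : ℕ) = a + 1 → (b' : ℕ) = b + 1 →
      (a : ℕ) + 1 < b →
      ∀ (i : Fin (sz lam nu a)) (j : Fin (sz lam nu a')) (h : Fin (sz lam nu b))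
        (k : Fin (sz lam nu b')) (r s : ℕ), 1 ≤ r → 1 ≤ s →
      sbr (Egen lam nu a a' i j r) (Egen lam nu b b' h k s) = 0) ∧
    (∀ (a a' a'' : Fin (numBlocks lam nu)), (a' : ℕ) = a + 1 → (a'' : ℕ) = a' + 1 →
      ∀ (i : Fin (sz lam nu a)) (j h : Fin (sz lam nu a')) (k : Fin (sz lam nu a'')) (r s : ℕ),
      1 ≤ r → 1 ≤ s → h ≠ j →
      sbr (Egen lam nu a a' i j r) (Egen lam nu a' a'' h k s) = 0) ∧
    -- `[F_a, F_b] = 0` for `b > a + 1`, and for `b = a + 1` and `i ≠ k`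
    (∀ (a a' b b' : Fin (numBlocks lam nu)), (a' : ℕ) = a + 1 → (b' : ℕ) = b + 1 →
      (a : ℕ) + 1 < b →
      ∀ (i : Fin (sz lam nu a')) (j : Fin (sz lam nu a)) (h : Fin (sz lam nu b'))
        (k : Fin (sz lam nu b)) (r s : ℕ), 1 ≤ r → 1 ≤ s →
      sbr (Fgen lam nu a' a i j r) (Fgen lam nu b' b h k s) = 0) ∧
    (∀ (a a' a'' : Fin (numBlocks lam nu)), (a' : ℕ) = a + 1 → (a'' : ℕ) = a' + 1 →
      ∀ (i : Fin (sz lam nu a')) (j : Fin (sz lam nu a)) (h : Fin (sz lam nu a''))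
        (k : Fin (sz lam nu a')) (r s : ℕ), 1 ≤ r → 1 ≤ s → i ≠ k →
      sbr (Fgen lam nu a' a i j r) (Fgen lam nu a'' a' h k s) = 0) ∧
    -- cubic Serre relations
    (∀ (a a' b b' : Fin (numBlocks lam nu)), (a' : ℕ) = a + 1 → (b' : ℕ) = b + 1 → a ≠ b →
      ∀ (i h : Fin (sz lam nu a)) (j k : Fin (sz lam nu a')) (f : Fin (sz lam nu b))
        (g : Fin (sz lam nu b')) (r s l : ℕ), 1 ≤ r → 1 ≤ s → 1 ≤ l →
      sbr (Egen lam nu a a' i j r) (sbr (Egen lam nu a a' h k s) (Egen lam nu b b' f g l))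
        + sbr (Egen lam nu a a' i j s) (sbr (Egen lam nu a a' h k r) (Egen lam nu b b' f g l))
        = 0) ∧
    (∀ (a a' b b' : Fin (numBlocks lam nu)), (a' : ℕ) = a + 1 → (b' : ℕ) = b + 1 → a ≠ b →
      ∀ (i h : Fin (sz lam nu a')) (j k : Fin (sz lam nu a)) (f : Fin (sz lam nu b'))
        (g : Fin (sz lam nu b)) (r s l : ℕ), 1 ≤ r → 1 ≤ s → 1 ≤ l →
      sbr (Fgen lam nu a' a i j r) (sbr (Fgen lam nu a' a h k s) (Fgen lam nu b' b f g l))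
        + sbr (Fgen lam nu a' a i j s) (sbr (Fgen lam nu a' a h k r) (Fgen lam nu b' b f g l))
        = 0) ∧
    -- quartic relations; `x₀ x₁ x₂ x₃` are the blocks `m - 1, m, m + 1, m + 2` (counted from `1`)
    (∀ (x₀ x₁ x₂ x₃ : Fin (numBlocks lam nu)), (x₁ : ℕ) + 1 = lam.length → (x₁ : ℕ) = x₀ + 1 →
      (x₂ : ℕ) = x₁ + 1 → (x₃ : ℕ) = x₂ + 1 →
      ∀ (i : Fin (sz lam nu x₀)) (j h h₀ : Fin (sz lam nu x₁)) (k k₀ f : Fin (sz lam nu x₂))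
        (g : Fin (sz lam nu x₃)) (r s : ℕ), 1 ≤ r → 1 ≤ s →
      sbr (sbr (Egen lam nu x₀ x₁ i j r) (Egen lam nu x₁ x₂ h k 1))
        (sbr (Egen lam nu x₁ x₂ h₀ k₀ 1) (Egen lam nu x₂ x₃ f g s)) = 0) ∧
    (∀ (x₀ x₁ x₂ x₃ : Fin (numBlocks lam nu)), (x₁ : ℕ) + 1 = lam.length → (x₁ : ℕ) = x₀ + 1 →
      (x₂ : ℕ) = x₁ + 1 → (x₃ : ℕ) = x₂ + 1 →
      ∀ (i : Fin (sz lam nu x₁)) (j : Fin (sz lam nu x₀)) (h h₀ : Fin (sz lam nu x₂))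
        (k k₀ : Fin (sz lam nu x₁)) (f : Fin (sz lam nu x₃)) (g : Fin (sz lam nu x₂)) (r s : ℕ),
      1 ≤ r → 1 ≤ s →
      sbr (sbr (Fgen lam nu x₁ x₀ i j r) (Fgen lam nu x₂ x₁ h k 1))
        (sbr (Fgen lam nu x₂ x₁ h₀ k₀ 1) (Fgen lam nu x₃ x₂ f g s)) = 0) := 
  ⟨Dgen_zero lam nu, sum_Dgen_mul_Dgen' lam nu, sbr_Dgen_Dgen lam nu,
    sbr_Dgen_Dgen_of_ne lam nu, sbr_Dgen_Egen lam nu, sbr_Dgen_Egen_next lam nu,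
    fun a b b' hb hab hab' i j h k r s _ =>
      sbr_Dgen_Egen_eq_zero lam nu a b b' hb hab hab' i j h k r s,
    sbr_Dgen_Fgen lam nu, sbr_Dgen_Fgen_next lam nu,
    fun a b b' hb hab hab' i j h k r s _ =>
      sbr_Dgen_Fgen_eq_zero lam nu a b b' hb hab hab' i j h k r s,
    sbr_Egen_Egen lam nu, sbr_Fgen_Fgen lam nu, sbr_Egen_Fgen lam nu,
    fun a a' b b' ha hb hab i j h k r s _ _ =>
      sbr_Egen_Fgen_eq_zero lam nu a a' b b' ha hb hab i j h k r s,
    sbr_Egen_Egen_next lam nu, sbr_Fgen_Fgen_next lam nu,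
    fun a a' b b' ha hb hab i j h k r s _ _ =>
      sbr_Egen_Egen_eq_zero lam nu a a' b b' ha hb hab.le i j h k r s fun e => by
        have := congrArg (fun x : BlockIdx lam nu => (x.1 : ℕ)) e
        simp only at this
        omega,
    fun a a' a'' ha ha' i j h k r s _ _ hne =>
      sbr_Egen_Egen_eq_zero lam nu a a' a' a'' ha ha' ha.ge i j h k r s fun e => by
        simp only [Sigma.mk.injEq, heq_eq_eq, true_and] at e
        exact hne e,
    fun a a' b b' ha hb hab i j h k r s _ _ =>
      sbr_Fgen_Fgen_eq_zero lam nu a a' b b' ha hb hab.le i j h k r s fun e => by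
        have := congrArg (fun x : BlockIdx lam nu => (x.1 : ℕ)) e
        simp only at this
        omega,
    fun a a' a'' ha ha' i j h k r s _ _ hne =>
      sbr_Fgen_Fgen_eq_zero lam nu a a' a' a'' ha ha' ha.ge i j h k r s fun e => by
        simp only [Sigma.mk.injEq, heq_eq_eq, true_and] at e
        exact hne e.symm,
    fun a a' b b' ha hb hab i h j k f g r s l _ _ _ =>
      cubic_Egen lam nu a a' b b' ha hb hab i h j k f g r s l,
    fun a a' b b' ha hb hab i h j k f g r s l _ _ _ =>
      cubic_Fgen lam nu a a' b b' ha hb hab i h j k f g r s l,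
    fun x₀ x₁ x₂ x₃ _ h₁ h₂ h₃ i j h h₀ k k₀ f g r s _ _ =>
      quartic_Egen lam nu x₀ x₁ x₂ x₃ h₁ h₂ h₃ i j h h₀ k k₀ f g r s,
    fun x₀ x₁ x₂ x₃ _ h₁ h₂ h₃ i j h h₀ k k₀ f g r s _ _ =>
      quartic_Fgen lam nu x₀ x₁ x₂ x₃ h₁ h₂ h₃ i j h h₀ k k₀ f g r s⟩
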